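/- Let $k$ be an algebraically closed field of characteristic different from $2,3,5$. Let $X$ be a connected reduced separated curve of finite type over $k$ which is nonsingular outside a closed point $q$, and let $\nu\colon C\to X$ be its normalisation, with $\nu^{-1}(q)=\{q_1,\dots,q_m\}$. Let $R$ be the local ring of $X$ at $q$, let $\widetilde R$ be its normalisation, with Jacobson radical $\widetilde{\mathfrak m}$, and let $I=(R:\widetilde R)$ be the conductor. Put $\delta=\dim_k\widetilde R/R$ and $d_i=\dim_k \widetilde{\mathfrak m}^i/\big((\widetilde{\mathfrak m}^i\cap R)+\widetilde{\mathfrak m}^{i+1}\big)$. Suppose that $q$ is Gorenstein, i.e. $\dim_k R/I=\delta$, and that it has genus two, i.e. $\delta-m+1=2$. The singularity is of type $I$ if $(d_1,d_2,d_3)=(1,0,1)$ and of type $I\!I$ if $(d_1,d_2,d_3)=(1,1,0)$. Let $\omega_X$ be the dualising sheaf of $X$, regarded (following Rosenlicht) as the sheaf of rational differentials $\eta$ on $C$ such that, at every closed point $x\in X$, $\sum_{p\in\nu^{-1}(x)}\operatorname{Res}_p(f\eta)=0$ for all $f\in\mathcal O_{X,x}$; regard $\omega_C(D)$, for a divisor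 $D$ on $C$, as a sheaf of rational differentials as well. 1. In type $I$, exactly one branch of $X$ at $q$ is singular. If $q_m$ is the point of $C$ on that branch, then $\omega_X$ is a line bundle and $$\nu^*\omega_X=\omega_C(2q_1+\dots+2q_{m-1}+4q_m).$$ 2. In type $I\!I$, there is exactly one pair of distinct branches of $X$ at $q$ that are nonsingular and tangent to each other. If $q_1$ and $q_m$ are the points of $C$ on these two branches, then $\omega_X$ is a line bundle and $$\nu^*\omega_X=\omega_C(3q_1+2q_2+\dots+2q_{m-1}+3q_m).$$ Consequently, if $q_i$ lies on a connected component $C_i\cong\mathbb P^1$ of $C$ that contains no other point over $q$, then $\nu^*\omega_X|_{C_i}$ has degree $2$ for $i=m$ and $0$ otherwise in type $I$, and degree $1$ for $i\in\{1,m\}$ and $0$ otherwise in type $I\!I$. In particular, if $C$ is the disjoint union of $m$ projective lines, each containing one of the $q_i$, then the multidegree of $\omega_X$ is $(0,\dots,0,2)$ in type $I$ and $(1,0,\dots,0,1)$ in type $I\!I$. -/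

import Mathlib

open CategoryTheory AlgebraicGeometry
open scoped KaehlerDifferential

universe u

noncomputable section

/-- A reduced curve `X` over a field `k`, nonsingular outside one closed point `q`, together with
its normalisation `ν : C ⟶ X`, where `C = C₁ ⊔ … ⊔ C_r` is the decomposition of the nonsingular
curve `C` into connected components, all of which pass through `q`.

Neither `X` nor the `C i` are assumed to be complete, and several points over `q` may lie on one
and the same component `C i`. -/
structure CurveWithNormalisation (k : Type u) [Field k] (r : ℕ) where
  /-- the curve -/
  X : Scheme.{u}
  /-- its structure morphism -/
  str : X ⟶ Spec (CommRingCat.of k)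
  /-- the point at which it may be singular -/
  q : X
  /-- the components of the normalisation -/
  C : Fin r → Scheme.{u}
  /-- the normalisation morphism -/
  ν : ∀ i, C i ⟶ X
  isReduced : IsReduced X
  isSeparated : IsSeparated str
  locallyOfFiniteType : LocallyOfFiniteType str
  quasiCompact : QuasiCompact str
  isClosed_q : IsClosed ({q} : Set X)
  dense_compl : Dense ({q}ᶜ : Set X)
  isIntegral : ∀ i, IsIntegral (C i)
  /-- the `C i` are nonsingular curves -/
  isDVR : ∀ i (p : C i), IsClosed ({p} : Set (C i)) →
    IsDiscreteValuationRing ((C i).presheaf.stalk p)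
  isFinite : IsFinite (Limits.Sigma.desc ν)
  isIso_compl : IsIso (Limits.Sigma.desc ν ∣_ ⟨{q}ᶜ, isClosed_q.isOpen_compl⟩)
  exists_over : ∀ i, ∃ p : C i, ν i p = q

namespace CurveWithNormalisation

variable {k : Type u} [Field k] {r : ℕ} (S : CurveWithNormalisation k r)

instance (i : Fin r) : IsIntegral (S.C i) := S.isIntegral i

/-- The map from the ground field to a local ring of a scheme over it. -/
def constToStalk {Y : Scheme.{u}} (f : Y ⟶ Spec (CommRingCat.of k)) (y : Y) :
    k →+* Y.presheaf.stalk y :=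
  ((Scheme.ΓSpecIso (CommRingCat.of k)).inv ≫ f.appTop ≫
    Y.presheaf.germ ⊤ y (TopologicalSpace.Opens.mem_top y)).hom

/-- The local rings and the function fields of the curves `C i` are `k`-algebras. -/
instance stalkAlgebra (i : Fin r) (p : S.C i) : Algebra k ((S.C i).presheaf.stalk p) :=
  (constToStalk (S.ν i ≫ S.str) p).toAlgebra

/-- The function field of `C i`. -/
abbrev K (i : Fin r) : Type u := (S.C i).functionField

/-- The local ring of `C i` at `p`. -/
abbrev O (i : Fin r) (p : S.C i) : Type u := (S.C i).presheaf.stalk p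

/-- The ring of rational functions on `C`, that is, on `X`. -/
abbrev Rat : Type u := ∀ i, S.K i

instance (i : Fin r) (p : S.C i) : IsScalarTower k (S.O i p) (S.K i) := by
  refine IsScalarTower.of_algebraMap_eq' ?_
  change (constToStalk (S.ν i ≫ S.str) (genericPoint (S.C i))) =
    ((S.C i).presheaf.stalkSpecializes _).hom.comp (constToStalk (S.ν i ≫ S.str) p)
  rw [constToStalk, constToStalk, ← CommRingCat.hom_comp]
  congr 1
  rw [Category.assoc, Category.assoc, TopCat.Presheaf.germ_stalkSpecializes]

instance (i : Fin r) (p : S.C i) : SMulCommClass k (S.O i p) (S.K i) :=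
  ⟨fun a b c => by simp only [Algebra.smul_def, mul_left_comm]⟩

/-- The points of `C` over a point `x` of `X`. -/
abbrev Fibre (x : S.X) : Type u := {p : Σ i, S.C i // S.ν p.1 p.2 = x}

/-- The branches of `X` at `q`: the points `q₁, …, q_m` of `C` over `q`. -/
abbrev Branch : Type u := S.Fibre S.q

/-- The map from the local ring of `X` at `x` to the function field of a component `C i` which has
a point over `x`. -/
def pull (i : Fin r) (x : S.X) (h : ∃ p : S.C i, S.ν i p = x) :
    S.X.presheaf.stalk x →+* S.K i :=
  ((S.ν i).stalkMap (genericPoint (S.C i))).hom.comp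
    (S.X.presheaf.stalkSpecializes (by
      obtain ⟨p, rfl⟩ := h
      exact ((genericPoint_spec (S.C i)).specializes trivial).map (S.ν i).continuous)).hom

theorem pull_constToStalk (i : Fin r) (x : S.X) (h : ∃ p : S.C i, S.ν i p = x) (c : k) :
    S.pull i x h (constToStalk S.str x c) = algebraMap k (S.K i) c := by
  change S.pull i x h (constToStalk S.str x c) =
    constToStalk (S.ν i ≫ S.str) (genericPoint (S.C i)) c
  rw [← RingHom.comp_apply]
  congr 1
  rw [pull, constToStalk, constToStalk, ← CommRingCat.hom_comp, ← CommRingCat.hom_comp]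
  simp only [Category.assoc, Scheme.Hom.comp_appTop, TopCat.Presheaf.germ_stalkSpecializes_assoc,
    Scheme.Hom.germ_stalkMap]
  rfl

/-- The local ring `R` of `X` at `q`, as a subring of the ring of rational functions. -/
def localRing : Subalgebra k S.Rat :=
  { (RingHom.pi fun i => S.pull i S.q (S.exists_over i)).range with
    algebraMap_mem' := fun c =>
      ⟨constToStalk S.str S.q c, funext fun i => S.pull_constToStalk i S.q (S.exists_over i) c⟩ }

/-- The `n`-th power of the maximal ideal of the local ring of `C i` at `p`, inside the function
field; for `n = 0` this is the local ring itself. -/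
def maxPow (i : Fin r) (p : S.C i) (n : ℕ) : Submodule k (S.K i) :=
  ((IsLocalRing.maximalIdeal (S.O i p) ^ n).restrictScalars k).map
    (IsScalarTower.toAlgHom k (S.O i p) (S.K i)).toLinearMap

/-- The rational functions vanishing to order at least `n` at every point over `q`. For `n = 0`
this is the normalisation `R̃` of `R`, and in general it is the `n`-th power of the Jacobson
radical `𝔪̃` of `R̃`. -/
def radPow (n : ℕ) : Submodule k S.Rat where
  carrier := {g | ∀ b : S.Branch, g b.1.1 ∈ S.maxPow b.1.1 b.1.2 n}
  zero_mem' := fun _ => Submodule.zero_mem _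
  add_mem' := fun hf hg b => Submodule.add_mem _ (hf b) (hg b)
  smul_mem' := fun c _ hf b => Submodule.smul_mem _ c (hf b)

/-- `R`, as a vector space. -/
abbrev R : Submodule k S.Rat := Subalgebra.toSubmodule S.localRing

/-- The `δ`-invariant `dim (R̃ / R)` of the singularity `q`. -/
def delta : ℕ := Module.finrank k (S.radPow 0 ⧸ S.R.submoduleOf (S.radPow 0))

/-- The genus `δ - m + 1` of the singularity `q` with `m` branches. -/
def genus : ℤ := (S.delta : ℤ) - (Nat.card S.Branch : ℤ) + 1

/-- The conductor `I = (R : R̃)`. -/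
def conductor : Submodule k S.Rat where
  carrier := {g | ∀ h ∈ S.radPow 0, g * h ∈ S.R}
  zero_mem' := fun h _ => by rw [zero_mul]; exact Submodule.zero_mem _
  add_mem' := fun hf hg h hh => by
    rw [add_mul]; exact Submodule.add_mem _ (hf h hh) (hg h hh)
  smul_mem' := fun c f hf h hh => by
    rw [smul_mul_assoc]; exact Submodule.smul_mem _ c (hf h hh)

/-- The singularity `q` is Gorenstein: `dim (R / I) = dim (R̃ / R)`. -/
def IsGorenstein : Prop :=
  Module.finrank k (S.R ⧸ S.conductor.submoduleOf S.R) = S.delta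

/-- The dimension of the graded piece `(R̃ / R)_n = 𝔪̃ⁿ / ((𝔪̃ⁿ ∩ R) + 𝔪̃ⁿ⁺¹)`. -/
def gradedDim (n : ℕ) : ℕ :=
  Module.finrank k
    (S.radPow n ⧸ ((S.radPow n ⊓ S.R) ⊔ S.radPow (n + 1)).submoduleOf (S.radPow n))

/-- Type `I`: the graded dimensions of `R̃ / R` in degrees `1, 2, 3` are `(1, 0, 1)`. -/
def IsTypeI : Prop := S.gradedDim 1 = 1 ∧ S.gradedDim 2 = 0 ∧ S.gradedDim 3 = 1

/-- Type `II`: the graded dimensions of `R̃ / R` in degrees `1, 2, 3` are `(1, 1, 0)`. -/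
def IsTypeII : Prop := S.gradedDim 1 = 1 ∧ S.gradedDim 2 = 1 ∧ S.gradedDim 3 = 0

/-- A branch of `X` at `q` is singular if no function in `R` vanishes on it to order exactly
one. -/
def IsSingularBranch (b : S.Branch) : Prop :=
  ¬ ∃ g ∈ S.R, g b.1.1 ∈ S.maxPow b.1.1 b.1.2 1 ∧ g b.1.1 ∉ S.maxPow b.1.1 b.1.2 2

/-- Two nonsingular branches are tangent if they have the same tangent line in the Zariski tangent
space of `X` at `q`: a function in the maximal ideal of `R` has vanishing linear part along one of
them if and only if it has so along the other one. -/
def AreTangent (a b : S.Branch) : Prop :=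
  ¬ S.IsSingularBranch a ∧ ¬ S.IsSingularBranch b ∧
    ∀ g ∈ S.R, g ∈ S.radPow 1 →
      (g a.1.1 ∈ S.maxPow a.1.1 a.1.2 2 ↔ g b.1.1 ∈ S.maxPow b.1.1 b.1.2 2)

/-- The rational differentials on `C`, componentwise. -/
abbrev RatDiff : Type u := ∀ i, Ω[S.K i⁄k]

/-- The stalk at `p` of the sheaf `ω_C = Ω_C` of regular differentials of `C`, inside the rational
differentials. -/
def regularDiff (i : Fin r) (p : S.C i) : Submodule (S.O i p) Ω[S.K i⁄k] :=
  Submodule.span (S.O i p)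
    (Set.range fun a : S.O i p => KaehlerDifferential.D k (S.K i) (algebraMap (S.O i p) (S.K i) a))

/-- The stalk at `p` of `ω_C(n p)`: the differentials with a pole of order at most `n` at `p`. -/
def twistedDiff (i : Fin r) (p : S.C i) (n : ℕ) : Submodule (S.O i p) Ω[S.K i⁄k] where
  carrier := {η | ∀ a ∈ IsLocalRing.maximalIdeal (S.O i p) ^ n, a • η ∈ S.regularDiff i p}
  zero_mem' := fun a _ => by rw [smul_zero]; exact Submodule.zero_mem _
  add_mem' := fun hf hg a ha => by
    rw [smul_add]; exact Submodule.add_mem _ (hf a ha) (hg a ha)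
  smul_mem' := fun c f hf a ha => by
    rw [smul_comm]; exact Submodule.smul_mem _ c (hf a ha)

/-- A uniformiser of `C i` at the closed point `p`. -/
def uniformiser (i : Fin r) (p : S.C i) : S.O i p :=
  Classical.epsilon fun t : S.O i p => Irreducible t

/-- The same, as a rational function. -/
def localParam (i : Fin r) (p : S.C i) : S.K i :=
  algebraMap (S.O i p) (S.K i) (S.uniformiser i p)

/-- `c` is the residue of `η` at `p`: the differential `η` can be written as
`a_N t^(-N-1) dt + … + a₁ t^(-2) dt + a₀ t^(-1) dt` plus a regular differential, where `t` is a
uniformiser at `p`, the `a_n` are constants, and `a₀ = c`. -/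
def HasResidue (i : Fin r) (p : S.C i) (η : Ω[S.K i⁄k]) (c : k) : Prop :=
  ∃ (N : ℕ) (a : ℕ → k), a 0 = c ∧
    η - ∑ n ∈ Finset.range (N + 1),
      a n • ((S.localParam i p)⁻¹ ^ (n + 1) • KaehlerDifferential.D k (S.K i) (S.localParam i p))
      ∈ S.regularDiff i p

open Classical in
/-- The residue of a rational differential at the closed point `p` of `C i`. -/
def residue (i : Fin r) (p : S.C i) (η : Ω[S.K i⁄k]) : k :=
  if h : ∃ c, S.HasResidue i p η c then h.choose else 0

/-- The stalk at the closed point `x` of the dualising sheaf `ω_X` (Rosenlicht): the rational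
differentials `η`, on the components through `x`, such that for all `f` in the local ring of `X`
at `x` the sum of the residues of `f η` at the points of `C` over `x` is zero. -/
def dualisingStalk (x : S.X) : Set S.RatDiff :=
  {η | (∀ i, (¬ ∃ p : S.C i, S.ν i p = x) → η i = 0) ∧
    ∀ f : S.X.presheaf.stalk x,
      ∑ᶠ p : S.Fibre x, S.residue p.1.1 p.1.2 (S.pull p.1.1 x ⟨p.1.2, p.2⟩ f • η p.1.1) = 0}

/-- The dualising sheaf is a line bundle: its stalk at every closed point `x` is free of rank one
over the local ring of `X` at `x`. -/
def DualisingIsLineBundle : Prop :=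
  ∀ x : S.X, IsClosed ({x} : Set S.X) →
    ∃ η₀ ∈ S.dualisingStalk x, ∀ η : S.RatDiff, η ∈ S.dualisingStalk x ↔
      ∃! f : S.X.presheaf.stalk x, ∀ i,
        (∀ h : ∃ p : S.C i, S.ν i p = x, η i = S.pull i x h f • η₀ i) ∧
        ((¬ ∃ p : S.C i, S.ν i p = x) → η i = 0)

/-- The stalk at the point `p` of `C i` of the image of `ν^* ω_X` in the rational differentials:
the submodule generated, over the local ring of `C i` at `p`, by the pullbacks of the sections of
`ω_X` near `ν p`. When `ω_X` is a line bundle, `ν^* ω_X` is a line bundle too, so that it is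
torsion free and maps isomorphically to its image. -/
def pullbackDualising (i : Fin r) (p : S.C i) : Submodule (S.O i p) Ω[S.K i⁄k] :=
  Submodule.span (S.O i p) {θ | ∃ η ∈ S.dualisingStalk (S.ν i p), η i = θ}

/-- `ν^* ω_X = ω_C(D)`, for an effective divisor `D` on `C` given by its coefficients: `ω_X` is a
line bundle, and `ν^* ω_X` and `ω_C(D)` have the same stalk, in the rational differentials, at
every closed point of `C`. -/
def PullbackDualisingEq (D : (Σ i, S.C i) → ℕ) : Prop :=
  S.DualisingIsLineBundle ∧
    ∀ i (p : S.C i), IsClosed ({p} : Set (S.C i)) →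
      S.pullbackDualising i p = S.twistedDiff i p (D ⟨i, p⟩)

open Classical in
/-- The divisor `∑ c_b b` on `C`, the sum running over the points `b` of `C` over `q`. -/
def branchDivisor (c : S.Branch → ℕ) (p : Σ i, S.C i) : ℕ :=
  if h : S.ν p.1 p.2 = S.q then c ⟨p, h⟩ else 0

open Classical in
/-- The function on the set of branches with value `a` on the branches in `s` and value `c` on
all other ones. -/
def branchValues {α : Type} (s : Set S.Branch) (a c : α) (b : S.Branch) : α :=
  if b ∈ s then a else c

/-- The line bundle `L` on `C i`, given by its stalks in the rational differentials, has degree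
`d`: it has a nonzero rational section `η` such that the orders of vanishing of `η`, as a section
of `L`, at the closed points of `C i` are almost all zero and add up to `d`. Here `η` has order `n`
at `p` if `t⁻ⁿ η` generates the stalk of `L` at `p`, for a uniformiser `t`. -/
def HasDegree (i : Fin r) (L : ∀ p : S.C i, Submodule (S.O i p) Ω[S.K i⁄k]) (d : ℤ) : Prop :=
  ∃ η : Ω[S.K i⁄k], η ≠ 0 ∧ ∃ n : {p : S.C i // IsClosed ({p} : Set (S.C i))} → ℤ,
    (Function.support n).Finite ∧
    (∀ p, L p.1 = Submodule.span (S.O i p.1) {(S.localParam i p.1) ^ (-(n p)) • η}) ∧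
    ∑ᶠ p, n p = d

/-- The component `C i` is a projective line: it is complete and its function field is `k(t)`. -/
def IsProjectiveLine (i : Fin r) : Prop :=
  IsProper (S.ν i ≫ S.str) ∧ Nonempty (S.K i ≃ₐ[k] RatFunc k)

/-- For every branch `b` whose component of `C` is a projective line containing no other point over
`q`, the restriction of `ν^* ω_X` to that component has degree `d b`. -/
def RationalMultidegree (d : S.Branch → ℤ) : Prop :=
  ∀ b : S.Branch, S.IsProjectiveLine b.1.1 → (∀ b' : S.Branch, b'.1.1 = b.1.1 → b' = b) →
    S.HasDegree b.1.1 (S.pullbackDualising b.1.1) (d b)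

end CurveWithNormalisation

end

/-! Everything is read off from Laurent expansions along the branches. Since `k` is algebraically
closed, the local ring of `C` at a closed point embeds into power series in a uniformiser, and by
the Chinese remainder theorem the expansions at the `m` points over `q` can be prescribed to any
finite order (`isDense_branchExpansion`). Let `L_n ⊆ k^m` (`leadSpace`) be the space of degree `n`
coefficients of those elements of `R` that have order at least `n` on every branch. It has
codimension `d_n`, one has `L_i L_j ⊆ L_{i+j}`, and `d_0 = m - 1` because `R` is local. As `δ = m +
1`, the given `d_n` already exhaust `δ`, so `R` contains all functions of order at least `4` (type
I) or `3` (type II); see `rad_le`.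

Conductor: suppose `R` contains the space `F` of functions of order at least `c_b` on each branch
`b`. Then `∑ c_b = dim R̃/F = δ + dim R/I + dim I/F`, so the Gorenstein condition gives `2δ ≤ ∑
c_b`, and equality forces `I = F` (`IsDense.conductor_eq`). In type I, `L_2` is everything while
`L_1` and `L_3` are hyperplanes; `L_1 L_2 ⊆ L_3` forces both to be one coordinate hyperplane `x_{b₀}
= 0`. So `b₀` is the singular branch, and `c` is `4` there and `2` elsewhere
(`exists_singular_branch`). In type II, `L_1` is a hyperplane `∑ v_b x_b = 0` and `F` may be taken
with `c = 3` on the support of `v` and `c = 2` off it. The inequality shows that the support has at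
least two elements, and three would make `L_2` everything because `L_1 L_1 ⊆ L_2`. The remaining two
branches are the tangent ones (`exists_tangent_branches`).

Dualising sheaf: differentials orthogonal to `R` have poles bounded by the conductor. A general
linear functional on `R̃/R` is the residue pairing with some `η₀` of exact pole orders `c_b`, and
`dim R/I = dim R̃/R` makes `f ↦ Res(f · η₀)` map `R` onto the dual of `R̃/R`. Hence `η₀` generates
the stalk at `q` (`exists_generator_dual`); at other points the residue condition just means
regularity.

Degree: on a projective line the differential of a coordinate has one double pole and no other zero
or pole, so a component with one branch `b` carries degree `c_b - 2`. -/

section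

/-! ### Laurent series vanishing to a given order -/

namespace LaurentSeries

/-- The algebra structure on the Laurent series whose scalar multiplication is the coefficientwise
one, made the preferred one. -/
noncomputable instance coefficientwiseAlgebra (k : Type*) [Field k] : Algebra k (LaurentSeries k) :=
  HahnSeries.instAlgebra

variable {k : Type*} [Field k]

/-- The Laurent series without terms of degree less than `n`. -/
def vanishing (k : Type*) [Field k] (n : ℤ) : Submodule k (LaurentSeries k) where
  carrier := {f | ∀ j < n, f.coeff j = 0}
  zero_mem' := fun _ _ => by simp
  add_mem' := fun hf hg j hj => by simp [hf j hj, hg j hj]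
  smul_mem' := fun c f hf j hj => by simp [hf j hj]

theorem mem_vanishing {n : ℤ} {f : LaurentSeries k} :
    f ∈ vanishing k n ↔ ∀ j < n, f.coeff j = 0 := Iff.rfl

theorem vanishing_anti {m n : ℤ} (h : m ≤ n) : vanishing k n ≤ vanishing k m :=
  fun _ hf j hj => hf j (hj.trans_le h)

theorem mem_vanishing_add_one {n : ℤ} {f : LaurentSeries k} :
    f ∈ vanishing k (n + 1) ↔ f ∈ vanishing k n ∧ f.coeff n = 0 := by
  constructor
  · intro h
    exact ⟨vanishing_anti (by omega) h, h n (by omega)⟩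
  · rintro ⟨h, h0⟩ j hj
    rcases (Int.lt_add_one_iff.mp hj).lt_or_eq with h' | rfl
    · exact h j h'
    · exact h0

theorem coeff_mul_of_mem {m n : ℤ} {f g : LaurentSeries k} (hf : f ∈ vanishing k m)
    (hg : g ∈ vanishing k n) : (f * g).coeff (m + n) = f.coeff m * g.coeff n := by
  rw [HahnSeries.coeff_mul]
  by_cases h : f.coeff m * g.coeff n = 0
  · rw [h]
    refine Finset.sum_eq_zero fun ij hij => ?_
    rw [Finset.mem_antidiagonal] at hij
    obtain ⟨h1, h2, h3⟩ := hij
    have h4 : m ≤ ij.1 := not_lt.mp fun h' => h1 (hf _ h')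
    have h5 : n ≤ ij.2 := not_lt.mp fun h' => h2 (hg _ h')
    have h6 : ij.1 = m := by omega
    have h7 : ij.2 = n := by omega
    rw [h6, h7, h]
  · rw [Finset.sum_eq_single (m, n)]
    · intro ij hij hne
      rw [Finset.mem_antidiagonal] at hij
      obtain ⟨h1, h2, h3⟩ := hij
      have h4 : m ≤ ij.1 := not_lt.mp fun h' => h1 (hf _ h')
      have h5 : n ≤ ij.2 := not_lt.mp fun h' => h2 (hg _ h')
      exact absurd (Prod.ext (by simp; omega) (by simp; omega)) hne
    · intro hn
      rw [Finset.mem_antidiagonal] at hn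
      simp only [HahnSeries.mem_support, not_and, and_true] at hn
      by_contra h'
      exact hn (left_ne_zero_of_mul h') (right_ne_zero_of_mul h')

theorem mul_mem_vanishing {m n : ℤ} {f g : LaurentSeries k} (hf : f ∈ vanishing k m)
    (hg : g ∈ vanishing k n) : f * g ∈ vanishing k (m + n) := by
  intro j hj
  rw [HahnSeries.coeff_mul]
  refine Finset.sum_eq_zero fun ij hij => ?_
  rw [Finset.mem_antidiagonal] at hij
  obtain ⟨h1, h2, h3⟩ := hij
  have h4 : m ≤ ij.1 := not_lt.mp fun h' => h1 (hf _ h')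
  have h5 : n ≤ ij.2 := not_lt.mp fun h' => h2 (hg _ h')
  omega

theorem mul_mem_vanishing_of_eq {m n l : ℤ} {f g : LaurentSeries k} (hf : f ∈ vanishing k m)
    (hg : g ∈ vanishing k n) (h : l = m + n) : f * g ∈ vanishing k l :=
  h ▸ mul_mem_vanishing hf hg

theorem single_mem_vanishing {m n : ℤ} (h : m ≤ n) (c : k) :
    HahnSeries.single n c ∈ vanishing k m := fun j hj => by
  rw [HahnSeries.coeff_single_of_ne (by omega)]

theorem algebraMap_eq_single (c : k) :
    algebraMap k (LaurentSeries k) c = HahnSeries.single 0 c := by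
  rfl

theorem algebraMap_mem_vanishing (c : k) : algebraMap k (LaurentSeries k) c ∈ vanishing k 0 := by
  rw [algebraMap_eq_single]; exact single_mem_vanishing le_rfl c

theorem one_mem_vanishing : (1 : LaurentSeries k) ∈ vanishing k 0 :=
  single_mem_vanishing le_rfl (1 : k)

theorem ofPowerSeries_mem_vanishing (f : PowerSeries k) :
    HahnSeries.ofPowerSeries ℤ k f ∈ vanishing k 0 := by
  intro j hj
  rw [PowerSeries.coeff_coe, if_pos hj]

theorem exists_mem_vanishing (f : LaurentSeries k) : ∃ n : ℕ, f ∈ vanishing k (-n) := by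
  refine ⟨(-f.order).toNat, fun j hj => ?_⟩
  by_contra h
  have := HahnSeries.order_le_of_coeff_ne_zero h
  omega

theorem coeff_single_mul' (m n : ℤ) (c : k) (f : LaurentSeries k) :
    (HahnSeries.single m c * f).coeff n = c * f.coeff (n - m) := by
  have := HahnSeries.coeff_single_mul_add (r := c) (x := f) (a := n - m) (b := m)
  rwa [sub_add_cancel] at this

end LaurentSeries

/-! ### The expansion of a rational function in powers of a uniformiser -/

namespace IsDiscreteValuationRing

open IsLocalRing LaurentSeries

variable {k O : Type*} [Field k] [CommRing O] [IsDomain O] [IsDiscreteValuationRing O]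
  [Algebra k O]

section Integral

variable (ρ : O →ₐ[k] k) {t : O} (ht : Irreducible t)

include ht in
theorem exists_eq_algebraMap_add_mul (x : O) :
    ∃ y : O, x = algebraMap k O (ρ x) + t * y := by
  have hρ : x - algebraMap k O (ρ x) ∈ IsLocalRing.maximalIdeal O := by
    rw [mem_maximalIdeal, mem_nonunits_iff]
    intro h
    have := h.map ρ
    simp at this
  rw [ht.maximalIdeal_eq, Ideal.mem_span_singleton] at hρ
  obtain ⟨y, hy⟩ := hρ
  exact ⟨y, by rw [← hy]; ring⟩

-- Define `s` by `x = ρ x + t * s x`, that is, subtract the constant term and divide by `t`. The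
-- `n`-th Taylor coefficient is `ρ (s^[n] x)`. Multiplicativity follows coefficient by coefficient
-- from the product rule `s (x * y) = ρ x * s y + s x * y`.
include ht in
theorem exists_powerSeries_hom :
    ∃ φ : O →ₐ[k] PowerSeries k, φ t = PowerSeries.X ∧
      ∀ x, PowerSeries.constantCoeff (φ x) = ρ x := by
  choose s hs using exists_eq_algebraMap_add_mul ρ ht
  have hρt : ρ t = 0 := by
    by_contra h
    have h1 := (isUnit_iff_ne_zero.mpr h).map (algebraMap k O)
    have h2 : t * (1 - s t) = algebraMap k O (ρ t) := by
      linear_combination hs t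
    rw [← h2] at h1
    exact ht.not_isUnit (isUnit_of_mul_isUnit_left h1)
  have cancel : ∀ x y, t * x = t * y → x = y := fun x y => mul_left_cancel₀ ht.ne_zero
  have hadd : ∀ x y, s (x + y) = s x + s y := fun x y => cancel _ _ (by
    have h1 := hs x
    have h2 := hs y
    have h3 := hs (x + y)
    rw [map_add, map_add] at h3
    linear_combination h1 + h2 - h3)
  have hmul : ∀ x y, s (x * y) = algebraMap k O (ρ x) * s y + s x * y := fun x y => cancel _ _ (by
    have h1 := hs x
    have h2 := hs y
    have h3 := hs (x * y)
    rw [map_mul, map_mul] at h3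
    linear_combination y * h1 + algebraMap k O (ρ x) * h2 - h3)
  have hconst : ∀ c, s (algebraMap k O c) = 0 := fun c => cancel _ _ (by
    have h1 := hs (algebraMap k O c)
    rw [AlgHom.commutes] at h1
    simp only [Algebra.algebraMap_self, RingHom.id_apply] at h1
    linear_combination -h1)
  let F : O → PowerSeries k := fun x => PowerSeries.mk fun n => ρ (s^[n] x)
  have F0 : ∀ x, PowerSeries.constantCoeff (F x) = ρ x := fun x => by
    rw [← PowerSeries.coeff_zero_eq_constantCoeff_apply]; simp [F]
  have Fs : ∀ x n, PowerSeries.coeff (n + 1) (F x) = PowerSeries.coeff n (F (s x)) := fun x n => by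
    simp [F]
  have Feq : ∀ x, F x = PowerSeries.C (ρ x) + PowerSeries.X * F (s x) := fun x => by
    ext n
    cases n with
    | zero => simp [F0]
    | succ n =>
      rw [Fs, map_add, PowerSeries.coeff_succ_X_mul, PowerSeries.coeff_succ_C, zero_add]
  have Fadd : ∀ x y, F (x + y) = F x + F y := fun x y => by
    ext n
    have : s^[n] (x + y) = s^[n] x + s^[n] y := by
      induction n generalizing x y with
      | zero => rfl
      | succ n ih => rw [Function.iterate_succ_apply, hadd, ih]; rfl
    simp [F, this]
  have Fconst : ∀ c, F (algebraMap k O c) = PowerSeries.C c := fun c => by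
    have hz : F 0 = 0 := by simpa using Fadd 0 0
    rw [Feq, hconst, hz]; simp
  have Fmul : ∀ n x y, PowerSeries.coeff n (F (x * y)) = PowerSeries.coeff n (F x * F y) := by
    intro n
    induction n with
    | zero => intro x y; simp [F0]
    | succ n ih =>
      intro x y
      have h1 : F x * F y = PowerSeries.C (ρ x) * PowerSeries.C (ρ y) +
          PowerSeries.X * (PowerSeries.C (ρ x) * F (s y) + F (s x) * F y) := by
        linear_combination F y * Feq x + PowerSeries.C (ρ x) * Feq y
      rw [Fs, hmul, Fadd, map_add, ih, ih, Fconst, h1, ← map_mul, map_add,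
        PowerSeries.coeff_succ_C, zero_add, PowerSeries.coeff_succ_X_mul, map_add]
  have Fone : F 1 = 1 := by simpa using Fconst 1
  refine ⟨{ toFun := F
            map_one' := Fone
            map_mul' := fun x y => PowerSeries.ext fun n => Fmul n x y
            map_zero' := by simpa using Fconst 0
            map_add' := Fadd
            commutes' := fun c => Fconst c }, ?_, F0⟩
  have hst : s t = 1 := cancel _ _ (by
    have := hs t
    rw [hρt, map_zero] at this
    linear_combination -this)
  change F t = _
  rw [Feq, hρt, hst, Fone]
  simp

end Integral

variable {K : Type*} [Field K] [Algebra O K] [IsFractionRing O K] [Algebra k K]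
  [IsScalarTower k O K]

/-- If `O` is a discrete valuation ring with residue field `k`, then its field of fractions embeds
into the field of Laurent series over `k` in such a way that `O` is the preimage of the ring of
power series. -/
theorem exists_laurentSeries_hom
    (hres : ∀ x : O, ∃ c : k, x - algebraMap k O c ∈ IsLocalRing.maximalIdeal O) {t : O} (ht : Irreducible t) :
    ∃ φ : K →ₐ[k] LaurentSeries k, φ (algebraMap O K t) = HahnSeries.single 1 1 ∧
      ∀ x, (∃ y, algebraMap O K y = x) ↔ φ x ∈ vanishing k 0 := by
  have hbij : Function.Bijective (algebraMap k (ResidueField O)) := by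
    refine ⟨(algebraMap k (ResidueField O)).injective, fun x => ?_⟩
    obtain ⟨x, rfl⟩ := residue_surjective x
    obtain ⟨c, hc⟩ := hres x
    refine ⟨c, ?_⟩
    rw [← sub_eq_zero, IsScalarTower.algebraMap_apply k O (ResidueField O),
      ResidueField.algebraMap_eq, ← map_sub, residue_eq_zero_iff]
    simpa using neg_mem hc
  let ρ : O →ₐ[k] k :=
    ((AlgEquiv.ofBijective (Algebra.ofId k (ResidueField O)) hbij).symm.toAlgHom).comp
      (IsScalarTower.toAlgHom k O (ResidueField O))
  obtain ⟨φ₀, h1, h2⟩ := exists_powerSeries_hom ρ ht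
  have hinj0 : Function.Injective φ₀ := by
    rw [injective_iff_map_eq_zero]
    intro x hx
    by_contra hne
    obtain ⟨n, u, rfl⟩ := eq_unit_mul_pow_irreducible hne ht
    rw [map_mul, map_pow, h1] at hx
    have : IsUnit (φ₀ (u : O)) := u.isUnit.map φ₀
    rw [this.mul_right_eq_zero] at hx
    exact pow_ne_zero n PowerSeries.X_ne_zero hx
  let ι : PowerSeries k →ₐ[k] LaurentSeries k := HahnSeries.ofPowerSeriesAlg ℤ k
  have hι : ∀ f, ι f = HahnSeries.ofPowerSeries ℤ k f := fun f => rfl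
  have hinj : Function.Injective (ι.comp φ₀) := by
    intro x y hxy
    exact hinj0 (HahnSeries.ofPowerSeries_injective hxy)
  refine ⟨IsFractionRing.liftAlgHom hinj, ?_, fun x => ⟨?_, fun hx => ?_⟩⟩
  · rw [IsFractionRing.liftAlgHom_apply, IsFractionRing.lift_algebraMap]
    change ι (φ₀ t) = _
    rw [h1, hι]
    exact PowerSeries.coe_X
  · rintro ⟨y, rfl⟩
    rw [IsFractionRing.liftAlgHom_apply, IsFractionRing.lift_algebraMap]
    exact ofPowerSeries_mem_vanishing _
  -- If `x⁻¹ = y` were a nonunit of `O`, then `φ x⁻¹` would have order at least `1`, and so would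
  -- its product with the integral `φ x`; but that product is `1`.
  · rcases ValuationRing.isInteger_or_isInteger O x with ⟨y, hy⟩ | ⟨y, hy⟩
    · exact ⟨y, hy⟩
    · by_cases hy0 : x = 0
      · exact ⟨0, by rw [hy0, map_zero]⟩
      have hyu : IsUnit y := by
        by_contra hnu
        have hρ : ρ y = 0 := by
          change (AlgEquiv.ofBijective (Algebra.ofId k (ResidueField O)) hbij).symm
            (residue O y) = 0
          rw [(residue_eq_zero_iff y).mpr hnu, map_zero]
        have h3 : ι (φ₀ y) ∈ vanishing k (0 + 1) := by
          rw [mem_vanishing_add_one]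
          refine ⟨ofPowerSeries_mem_vanishing _, ?_⟩
          rw [hι, PowerSeries.coeff_coe]
          simp [h2, hρ]
        have h4 := mul_mem_vanishing h3 hx
        have h5 : (ι (φ₀ y)) = IsFractionRing.liftAlgHom (K := K) hinj x⁻¹ := by
          rw [← hy, IsFractionRing.liftAlgHom_apply, IsFractionRing.lift_algebraMap]
          rfl
        rw [h5, ← map_mul, inv_mul_cancel₀ hy0, map_one] at h4
        have := h4 0 (by norm_num)
        simp at this
      obtain ⟨u, rfl⟩ := hyu
      refine ⟨(u⁻¹ : Oˣ), ?_⟩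
      rw [← inv_inv x, ← hy, eq_comm, inv_eq_iff_eq_inv, eq_comm]
      refine inv_eq_of_mul_eq_one_left ?_
      rw [← map_mul, Units.mul_inv, map_one]

end IsDiscreteValuationRing

end

section

/-! ### Curve singularities in terms of power series expansions along the branches -/

namespace Submodule

variable {k M : Type*} [Field k] [AddCommGroup M] [Module k M]

theorem mem_submoduleOf_iff {A B : Submodule k M} {x : B} : x ∈ A.submoduleOf B ↔ (x : M) ∈ A :=
  Iff.rfl

theorem le_of_map_mkQ_eq_bot {N A : Submodule k M} (h : A.map N.mkQ = ⊥) : A ≤ N := fun x hx => by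
  have h1 : N.mkQ x ∈ (⊥ : Submodule k (M ⧸ N)) := h ▸ mem_map_of_mem hx
  rwa [mem_bot, mkQ_apply, Quotient.mk_eq_zero] at h1

/-- Since `B ⊓ N ≤ A`, the quotient `B / A` is unchanged when `A` and `B` are replaced by their
images modulo `N`. This permits dimension counts in which only the images are finite dimensional. -/
theorem finrank_quotient_submoduleOf_add {N A B : Submodule k M} (hAB : A ≤ B) (hN : B ⊓ N ≤ A)
    [FiniteDimensional k (B.map N.mkQ)] :
    Module.finrank k (B ⧸ A.submoduleOf B) + Module.finrank k (A.map N.mkQ) =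
      Module.finrank k (B.map N.mkQ) := by
  have hle : A.map N.mkQ ≤ B.map N.mkQ := map_mono hAB
  let f : B →ₗ[k] (B.map N.mkQ) := N.mkQ.submoduleMap B
  have hf : Function.Surjective f := N.mkQ.submoduleMap_surjective B
  let g := ((A.map N.mkQ).submoduleOf (B.map N.mkQ)).mkQ.comp f
  have hg : Function.Surjective g := (mkQ_surjective _).comp hf
  have hker : LinearMap.ker g = A.submoduleOf B := by
    ext x
    rw [LinearMap.mem_ker, LinearMap.comp_apply, mkQ_apply, Quotient.mk_eq_zero, mem_submoduleOf_iff,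
      mem_submoduleOf_iff]
    constructor
    · rintro ⟨a, ha, h⟩
      have h' : N.mkQ a = N.mkQ (x : M) := h
      rw [mkQ_apply, mkQ_apply, Quotient.eq] at h'
      have := hN ⟨sub_mem (hAB ha) x.2, h'⟩
      have := sub_mem ha this
      rwa [sub_sub_cancel] at this
    · intro h
      exact ⟨x, h, rfl⟩
  have e := (Submodule.quotEquivOfEq _ _ hker.symm).trans (g.quotKerEquivOfSurjective hg)
  rw [e.finrank_eq, ← (Submodule.submoduleOfEquivOfLe hle).finrank_eq]
  exact Submodule.finrank_quotient_add_finrank _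

end Submodule

namespace BranchExpansion

open LaurentSeries Module

variable {k : Type*} [Field k] {B : Type*} {M : Type*} [CommRing M] [Algebra k M]
  (E : M →ₐ[k] (B → LaurentSeries k))

/-- The elements vanishing to order at least `c b` along each branch `b`. -/
def fil (c : B → ℤ) : Submodule k M where
  carrier := {g | ∀ b, E g b ∈ vanishing k (c b)}
  zero_mem' := fun b => by rw [map_zero]; exact Submodule.zero_mem _
  add_mem' := fun hf hg b => by rw [map_add]; exact Submodule.add_mem _ (hf b) (hg b)
  smul_mem' := fun a f hf b => by rw [map_smul]; exact Submodule.smul_mem _ a (hf b)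

theorem mem_fil {c : B → ℤ} {g : M} : g ∈ fil E c ↔ ∀ b, E g b ∈ vanishing k (c b) := Iff.rfl

theorem fil_anti {c d : B → ℤ} (h : ∀ b, c b ≤ d b) : fil E d ≤ fil E c :=
  fun _ hg b => vanishing_anti (h b) (hg b)

theorem mul_mem_fil {c d e : B → ℤ} {f g : M} (hf : f ∈ fil E c) (hg : g ∈ fil E d)
    (h : ∀ b, e b = c b + d b) : f * g ∈ fil E e := fun b => by
  rw [map_mul, Pi.mul_apply]
  exact mul_mem_vanishing_of_eq (hf b) (hg b) (h b)

/-- The elements vanishing to order at least `n` along all branches. -/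
abbrev rad (n : ℕ) : Submodule k M := fil E fun _ => n

/-- The coefficients of degree `n` of the expansions along the branches. -/
noncomputable def coeffs (n : ℤ) : M →ₗ[k] (B → k) where
  toFun g b := (E g b).coeff n
  map_add' f g := by ext b; simp
  map_smul' c f := by ext b; simp

theorem coeffs_apply (n : ℤ) (g : M) (b : B) : coeffs E n g b = (E g b).coeff n := rfl

theorem mem_rad_succ {n : ℕ} {g : M} : g ∈ rad E (n + 1) ↔ g ∈ rad E n ∧ coeffs E n g = 0 := by
  simp only [mem_fil, funext_iff, coeffs_apply, Pi.zero_apply, ← forall_and]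
  refine forall_congr' fun b => ?_
  rw [← mem_vanishing_add_one]
  push_cast
  rfl

theorem coeffs_mul {m n : ℕ} {f g : M} (hf : f ∈ rad E m) (hg : g ∈ rad E n) :
    coeffs E ((m + n : ℕ) : ℤ) (f * g) = coeffs E m f * coeffs E n g := by
  ext b
  rw [coeffs_apply, map_mul, Pi.mul_apply]
  push_cast
  exact coeff_mul_of_mem (hf b) (hg b)

/-- Expansions along the branches can be prescribed up to any given order. -/
def IsDense : Prop :=
  ∀ (G : B → LaurentSeries k) (N : ℕ), ∃ g : M, ∀ b, E g b - G b ∈ vanishing k N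

variable {E} in
theorem IsDense.exists_coeffs (hE : IsDense E) (n : ℕ) (x : B → k) :
    ∃ g ∈ rad E n, coeffs E n g = x := by
  obtain ⟨g, hg⟩ := hE (fun b => HahnSeries.single (n : ℤ) (x b)) (n + 1)
  refine ⟨g, fun b => ?_, ?_⟩
  · have := Submodule.add_mem _ (vanishing_anti (by push_cast; omega) (hg b))
      (single_mem_vanishing (le_refl (n : ℤ)) (x b))
    rwa [sub_add_cancel] at this
  · ext b
    have := hg b n (by push_cast; omega)
    rw [HahnSeries.coeff_sub, HahnSeries.coeff_single_same, sub_eq_zero] at this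
    exact this

/-- The colength of the elements of order at least `c` among all integral elements is the sum of
the `c b`. -/
theorem IsDense.finrank_quotient_fil [Fintype B] {E : M →ₐ[k] (B → LaurentSeries k)}
    (hE : IsDense E) (c : B → ℕ) :
    FiniteDimensional k (rad E 0 ⧸ (fil E fun b => c b).submoduleOf (rad E 0)) ∧
    finrank k (rad E 0 ⧸ (fil E fun b => c b).submoduleOf (rad E 0)) = ∑ b, c b := by
  let f : rad E 0 →ₗ[k] (∀ b, Fin (c b) → k) :=
    { toFun := fun g b j => (E g b).coeff (j : ℕ)
      map_add' := fun f g => by ext b; simp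
      map_smul' := fun a f => by ext b; simp }
  have hf : Function.Surjective f := by
    intro x
    let G : B → LaurentSeries k := fun b =>
      HahnSeries.ofPowerSeries ℤ k (PowerSeries.mk fun n => if h : n < c b then x b ⟨n, h⟩ else 0)
    obtain ⟨g, hg⟩ := hE G (∑ b, c b)
    have hg0 : g ∈ rad E 0 := fun b => by
      have := Submodule.add_mem _ (vanishing_anti (by positivity) (hg b))
        (ofPowerSeries_mem_vanishing (PowerSeries.mk fun n => if h : n < c b then x b ⟨n, h⟩ else 0))
      rw [sub_add_cancel] at this
      exact this
    refine ⟨⟨g, hg0⟩, ?_⟩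
    ext b j
    have h1 : c b ≤ ∑ b, c b := Finset.single_le_sum (fun _ _ => Nat.zero_le _) (Finset.mem_univ b)
    have := hg b (j : ℕ) (by have := j.2; omega)
    rw [HahnSeries.coeff_sub, sub_eq_zero] at this
    change (E g b).coeff (j : ℕ) = _
    rw [this]
    simp only [G]
    rw [HahnSeries.ofPowerSeries_apply_coeff, PowerSeries.coeff_mk, dif_pos j.2]
  have hker : LinearMap.ker f = (fil E fun b => (c b : ℤ)).submoduleOf (rad E 0) := by
    ext g
    rw [LinearMap.mem_ker, Submodule.mem_submoduleOf_iff]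
    constructor
    · intro h b j hj
      rcases lt_or_ge j 0 with hj0 | hj0
      · exact g.2 b j (by simpa using hj0)
      · lift j to ℕ using hj0
        exact congrFun (congrFun h b) ⟨j, by simpa using hj⟩
    · intro h
      ext b j
      exact h b (j : ℕ) (by simp)
  have e := (Submodule.quotEquivOfEq _ _ hker.symm).trans (f.quotKerEquivOfSurjective hf)
  refine ⟨e.symm.finiteDimensional, ?_⟩
  rw [e.finrank_eq, Module.finrank_pi_fintype]
  simp

variable (R : Subalgebra k M)

/-- The elements multiplying all integral elements into `R`. -/
def conductor : Submodule k M where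
  carrier := {g | ∀ h ∈ rad E 0, g * h ∈ R}
  zero_mem' := fun h _ => by rw [zero_mul]; exact R.zero_mem
  add_mem' := fun hf hg h hh => by rw [add_mul]; exact R.add_mem (hf h hh) (hg h hh)
  smul_mem' := fun c f hf h hh => by rw [smul_mul_assoc]; exact R.smul_mem (hf h hh) c

theorem one_mem_rad : (1 : M) ∈ rad E 0 := fun b => by
  rw [map_one]
  exact one_mem_vanishing

theorem conductor_le : conductor E R ≤ Subalgebra.toSubmodule R := fun g hg => by
  have := hg 1 (one_mem_rad E)
  rwa [mul_one] at this

/-- The `δ`-invariant. -/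
noncomputable def delta : ℕ :=
  finrank k (rad E 0 ⧸ (Subalgebra.toSubmodule R).submoduleOf (rad E 0))

/-- The dimensions of the graded pieces of `R̃ / R`. -/
noncomputable def gradedDim (n : ℕ) : ℕ :=
  finrank k (rad E n ⧸
    ((rad E n ⊓ Subalgebra.toSubmodule R) ⊔ rad E (n + 1)).submoduleOf (rad E n))

/-- The leading coefficients of the elements of `R` vanishing to order at least `n`. -/
noncomputable def leadSpace (n : ℕ) : Submodule k (B → k) :=
  (rad E n ⊓ Subalgebra.toSubmodule R).map (coeffs E n)

variable {E R}

theorem mem_leadSpace {n : ℕ} {x : B → k} :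
    x ∈ leadSpace E R n ↔ ∃ g ∈ R, g ∈ rad E n ∧ coeffs E n g = x := by
  constructor
  · rintro ⟨g, ⟨h1, h2⟩, h3⟩
    exact ⟨g, h2, h1, h3⟩
  · rintro ⟨g, h2, h1, h3⟩
    exact ⟨g, ⟨h1, h2⟩, h3⟩

theorem mul_mem_leadSpace {m n : ℕ} {x y : B → k} (hx : x ∈ leadSpace E R m)
    (hy : y ∈ leadSpace E R n) : x * y ∈ leadSpace E R (m + n) := by
  rw [mem_leadSpace] at *
  obtain ⟨f, hf, hf', rfl⟩ := hx
  obtain ⟨g, hg, hg', rfl⟩ := hy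
  exact ⟨f * g, R.mul_mem hf hg, mul_mem_fil E hf' hg' (by push_cast; simp), coeffs_mul E hf' hg'⟩

/-- An element whose leading coefficients occur in `R` lies in `R`, if all elements of higher order
do. -/
theorem mem_of_coeffs_mem {n : ℕ} (hn : rad E (n + 1) ≤ Subalgebra.toSubmodule R) {g : M}
    (hg : g ∈ rad E n) (h : coeffs E n g ∈ leadSpace E R n) : g ∈ R := by
  obtain ⟨f, hf, hf', h⟩ := mem_leadSpace.mp h
  have h1 : g - f ∈ rad E (n + 1) := by
    rw [mem_rad_succ, map_sub, h, sub_self]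
    exact ⟨sub_mem hg hf', rfl⟩
  have h2 : g - f ∈ R := hn h1
  have := R.add_mem h2 hf
  rwa [sub_add_cancel] at this

/-- By density, `coeffs E n` identifies `rad n / rad (n + 1)` with all of `B → k`; the part coming
from `R` becomes `leadSpace`. -/
theorem IsDense.finrank_quotient_leadSpace (hE : IsDense E) (n : ℕ) :
    finrank k ((B → k) ⧸ leadSpace E R n) = gradedDim E R n := by
  let f : rad E n →ₗ[k] ((B → k) ⧸ leadSpace E R n) :=
    (leadSpace E R n).mkQ.comp ((coeffs E n).comp (rad E n).subtype)
  have hf : Function.Surjective f := by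
    intro y
    obtain ⟨x, rfl⟩ := Submodule.mkQ_surjective _ y
    obtain ⟨g, hg, rfl⟩ := hE.exists_coeffs n x
    exact ⟨⟨g, hg⟩, rfl⟩
  have hker : LinearMap.ker f =
      ((rad E n ⊓ Subalgebra.toSubmodule R) ⊔ rad E (n + 1)).submoduleOf (rad E n) := by
    ext g
    rw [LinearMap.mem_ker, Submodule.mem_submoduleOf_iff]
    change (leadSpace E R n).mkQ (coeffs E n g) = 0 ↔ _
    rw [Submodule.mkQ_apply, Submodule.Quotient.mk_eq_zero, mem_leadSpace, Submodule.mem_sup]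
    constructor
    · rintro ⟨h, hR, hn, hc⟩
      refine ⟨h, ⟨hn, hR⟩, g - h, ?_, by abel⟩
      rw [mem_rad_succ, map_sub, hc, sub_self]
      exact ⟨sub_mem g.2 hn, rfl⟩
    · rintro ⟨h, ⟨hn, hR⟩, z, hz, e⟩
      refine ⟨h, hR, hn, ?_⟩
      rw [mem_rad_succ] at hz
      rw [← e, map_add, hz.2, add_zero]
  exact ((Submodule.quotEquivOfEq _ _ hker.symm).trans
    (f.quotKerEquivOfSurjective hf)).finrank_eq.symm

theorem IsDense.leadSpace_eq_top [Finite B] (hE : IsDense E) {n : ℕ} (h : gradedDim E R n = 0) :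
    leadSpace E R n = ⊤ := by
  rw [← hE.finrank_quotient_leadSpace, finrank_zero_iff, Submodule.Quotient.subsingleton_iff] at h
  exact h

/-- The value of `finrank` on an infinite dimensional space is `0`, so `delta E R ≠ 0` is what
guarantees that `R̃ / R` is finite dimensional. -/
theorem delta_eq (hδ : delta E R ≠ 0) :
    FiniteDimensional k ((rad E 0).map (Subalgebra.toSubmodule R).mkQ) ∧
      finrank k ((rad E 0).map (Subalgebra.toSubmodule R).mkQ) = delta E R := by
  have hker : LinearMap.ker ((Subalgebra.toSubmodule R).mkQ.comp (rad E 0).subtype) =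
      (Subalgebra.toSubmodule R).submoduleOf (rad E 0) := by
    rw [LinearMap.ker_comp, Submodule.ker_mkQ]; rfl
  have e := ((Submodule.quotEquivOfEq _ _ hker.symm).trans
    (LinearMap.quotKerEquivRange _)).trans (LinearEquiv.ofEq _ ((rad E 0).map
      (Subalgebra.toSubmodule R).mkQ) (by rw [LinearMap.range_comp, Submodule.range_subtype]))
  have : FiniteDimensional k (rad E 0 ⧸ (Subalgebra.toSubmodule R).submoduleOf (rad E 0)) :=
    Module.finite_of_finrank_pos (Nat.pos_of_ne_zero hδ)
  exact ⟨e.finiteDimensional, e.finrank_eq.symm⟩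

/-- The graded dimensions in degrees below `n`, plus the dimension of the image of `rad n` in `R̃ /
R`, add up to `δ`. If the former already reach `δ`, that image is zero. -/
theorem rad_le (hδ : delta E R ≠ 0) {n : ℕ}
    (h : delta E R ≤ ∑ i ∈ Finset.range n, gradedDim E R i) :
    rad E n ≤ Subalgebra.toSubmodule R := by
  obtain ⟨hfin, heq⟩ := delta_eq hδ
  have hmono : ∀ i j, i ≤ j → rad E j ≤ rad E i := fun i j hij => fil_anti E fun _ => by omega
  have hfin' : ∀ i, FiniteDimensional k ((rad E i).map (Subalgebra.toSubmodule R).mkQ) := fun i =>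
    Submodule.finiteDimensional_of_le (Submodule.map_mono (hmono 0 i (Nat.zero_le i)))
  have hstep : ∀ i, gradedDim E R i +
      finrank k ((rad E (i + 1)).map (Subalgebra.toSubmodule R).mkQ) =
      finrank k ((rad E i).map (Subalgebra.toSubmodule R).mkQ) := fun i => by
    have := hfin' i
    have hs : (rad E i ⊓ Subalgebra.toSubmodule R).map (Subalgebra.toSubmodule R).mkQ ⊔
        (rad E (i + 1)).map (Subalgebra.toSubmodule R).mkQ =
        (rad E (i + 1)).map (Subalgebra.toSubmodule R).mkQ := by
      refine sup_eq_right.mpr (le_trans (Submodule.map_mono inf_le_right) ?_)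
      rw [Submodule.mkQ_map_self]
      exact bot_le
    rw [gradedDim, ← Submodule.finrank_quotient_submoduleOf_add
      (sup_le inf_le_left (hmono i (i + 1) (Nat.le_succ i))) le_sup_left, Submodule.map_sup, hs]
  have hsum : ∀ m, ∑ i ∈ Finset.range m, gradedDim E R i +
      finrank k ((rad E m).map (Subalgebra.toSubmodule R).mkQ) = delta E R := by
    intro m
    induction m with
    | zero => simpa using heq
    | succ m ih => rw [Finset.sum_range_succ, add_assoc, hstep, ih]
  have h0 : finrank k ((rad E n).map (Subalgebra.toSubmodule R).mkQ) = 0 := by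
    have := hsum n
    omega
  have := hfin' n
  rw [Submodule.finrank_eq_zero] at h0
  exact Submodule.le_of_map_mkQ_eq_bot h0

variable [Fintype B]

theorem IsDense.exists_equation (hE : IsDense E) {n : ℕ} (h : gradedDim E R n = 1) :
    ∃ v : B → k, v ≠ 0 ∧ ∀ x, x ∈ leadSpace E R n ↔ ∑ b, v b * x b = 0 := by
  classical
  rw [← hE.finrank_quotient_leadSpace] at h
  let e := LinearEquiv.ofFinrankEq ((B → k) ⧸ leadSpace E R n) k (by rw [h, finrank_self])
  let l : (B → k) →ₗ[k] k := e.toLinearMap.comp (leadSpace E R n).mkQ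
  have hl : ∀ x, x ∈ leadSpace E R n ↔ l x = 0 := fun x => by
    change _ ↔ e ((leadSpace E R n).mkQ x) = 0
    rw [LinearEquiv.map_eq_zero_iff, Submodule.mkQ_apply, Submodule.Quotient.mk_eq_zero]
  have hs : ∀ x, l x = ∑ b, l (Pi.single b 1) * x b := fun x => by
    conv_lhs => rw [LinearMap.pi_apply_eq_sum_univ l x]
    refine Finset.sum_congr rfl fun b _ => ?_
    rw [smul_eq_mul, mul_comm]
    congr 2
    ext j
    simp [Pi.single_apply, eq_comm]
  refine ⟨fun b => l (Pi.single b 1), fun h0 => ?_, fun x => by rw [hl, hs]⟩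
  have htop : leadSpace E R n = ⊤ := by
    rw [eq_top_iff]
    intro x _
    rw [hl, hs]
    exact Finset.sum_eq_zero fun b _ => by rw [congrFun h0 b]; simp
  have : Subsingleton ((B → k) ⧸ leadSpace E R n) := Submodule.Quotient.subsingleton_iff.mpr htop
  rw [finrank_zero_of_subsingleton] at h
  exact zero_ne_one h

/-- `R` is a local ring with residue field `k`. -/
structure IsLocalAt (E : M →ₐ[k] (B → LaurentSeries k)) (R : Subalgebra k M) : Prop where
  le : Subalgebra.toSubmodule R ≤ rad E 0
  coeff_zero : ∀ g ∈ R, ∀ b b', (E g b).coeff 0 = (E g b').coeff 0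

/-- An element of `R` has the same constant term on all branches, so the leading space in degree
zero is the diagonal line. -/
theorem IsDense.gradedDim_zero [Nonempty B] (hE : IsDense E) (hR : IsLocalAt E R) :
    gradedDim E R 0 + 1 = Fintype.card B := by
  have h1 : leadSpace E R 0 = Submodule.span k {(1 : B → k)} := by
    ext x
    rw [mem_leadSpace, Submodule.mem_span_singleton]
    constructor
    · rintro ⟨g, hg, -, rfl⟩
      obtain ⟨b₀⟩ := ‹Nonempty B›
      refine ⟨(E g b₀).coeff 0, ?_⟩
      ext b
      simp only [Pi.smul_apply, Pi.one_apply, smul_eq_mul, mul_one]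
      exact hR.coeff_zero g hg _ _
    · rintro ⟨c, rfl⟩
      refine ⟨algebraMap k M c, R.algebraMap_mem c, ?_, ?_⟩
      · exact hR.le (R.algebraMap_mem c)
      · ext b
        rw [coeffs_apply, AlgHom.commutes, Pi.algebraMap_apply, algebraMap_eq_single]
        simp
  rw [← hE.finrank_quotient_leadSpace, h1,
    ← finrank_span_singleton (K := k) (v := (1 : B → k)) one_ne_zero,
    Submodule.finrank_quotient_add_finrank, finrank_fintype_fun_eq_card]

/-- If `R` contains all elements of order at least `c`, then `2 δ ≤ ∑ c`, with equality only if
these elements form the conductor. -/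
theorem IsDense.conductor_eq (hE : IsDense E) (hR : IsLocalAt E R)
    (hGor : finrank k (Subalgebra.toSubmodule R ⧸
      (conductor E R).submoduleOf (Subalgebra.toSubmodule R)) = delta E R)
    (c : B → ℕ) (hc : fil E (fun b => c b) ≤ Subalgebra.toSubmodule R) :
    2 * delta E R ≤ ∑ b, c b ∧
      (∑ b, c b ≤ 2 * delta E R → conductor E R = fil E fun b => c b) := by
  set F := fil E (fun b => (c b : ℤ)) with hF
  obtain ⟨hfin, hrank⟩ := hE.finrank_quotient_fil c
  have h1 : F ≤ conductor E R := fun g hg h hh =>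
    hc (mul_mem_fil E hg hh (by simp))
  have h2 := conductor_le E R
  have h3 := hR.le
  have hker : LinearMap.ker (F.mkQ.comp (rad E 0).subtype) = F.submoduleOf (rad E 0) := by
    rw [LinearMap.ker_comp, Submodule.ker_mkQ]; rfl
  have e := ((Submodule.quotEquivOfEq _ _ hker.symm).trans
    (LinearMap.quotKerEquivRange _)).trans (LinearEquiv.ofEq _ ((rad E 0).map F.mkQ)
      (by rw [LinearMap.range_comp, Submodule.range_subtype]))
  have hfin0 : FiniteDimensional k ((rad E 0).map F.mkQ) := e.finiteDimensional
  have hfin1 : FiniteDimensional k ((Subalgebra.toSubmodule R).map F.mkQ) :=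
    Submodule.finiteDimensional_of_le (Submodule.map_mono h3)
  have hfin2 : FiniteDimensional k ((conductor E R).map F.mkQ) :=
    Submodule.finiteDimensional_of_le (Submodule.map_mono h2)
  -- Along the chain `F ≤ I ≤ R ≤ R̃` this gives `∑ c = δ + dim R/F`, and the next line gives `dim
  -- R/F = dim R/I + dim I/F`, where `dim R/I = δ`.
  have e1 := Submodule.finrank_quotient_submoduleOf_add h3 (N := F) (inf_le_right.trans hc)
  have e2 := Submodule.finrank_quotient_submoduleOf_add h2 (N := F) (inf_le_right.trans h1)
  rw [← e.finrank_eq, hrank] at e1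
  rw [hGor] at e2
  change delta E R + _ = _ at e1
  refine ⟨by omega, fun hle => le_antisymm ?_ h1⟩
  have h0 : finrank k ((conductor E R).map F.mkQ) = 0 := by omega
  rw [Submodule.finrank_eq_zero] at h0
  exact Submodule.le_of_map_mkQ_eq_bot h0

end BranchExpansion

end

/-! ### Leading coefficients and conductor in types I and II -/

section

namespace BranchExpansion

open LaurentSeries Module

variable {k : Type*} [Field k] {B : Type*} {M : Type*} [CommRing M] [Algebra k M]
  {E : M →ₐ[k] (B → LaurentSeries k)} {R : Subalgebra k M}

theorem IsLocalAt.mem_rad_one (hR : IsLocalAt E R) {g : M} (hg : g ∈ R) {b : B}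
    (h : E g b ∈ vanishing k 1) : g ∈ rad E 1 := by
  rw [mem_rad_succ]
  refine ⟨hR.le hg, ?_⟩
  ext b'
  exact (hR.coeff_zero g hg b' b).trans (h 0 (by norm_num))

/-- An element of `R` vanishing on one branch vanishes on all of them, so smoothness of a single
branch is visible in the leading space of degree one. -/
theorem IsLocalAt.exists_order_one_iff (hR : IsLocalAt E R) (b : B) :
    (∃ g ∈ R, E g b ∈ vanishing k 1 ∧ (E g b).coeff 1 ≠ 0) ↔ ∃ x ∈ leadSpace E R 1, x b ≠ 0 := by
  constructor
  · rintro ⟨g, hg, h1, h2⟩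
    exact ⟨_, mem_leadSpace.mpr ⟨g, hg, hR.mem_rad_one hg h1, rfl⟩, h2⟩
  · rintro ⟨x, hx, hb⟩
    obtain ⟨g, hg, h1, rfl⟩ := mem_leadSpace.mp hx
    exact ⟨g, hg, h1 b, hb⟩

variable [Fintype B] [DecidableEq B]

theorem sum_mul_single (v : B → k) (b : B) (c : k) :
    ∑ b', v b' * (Pi.single b c : B → k) b' = v b * c := by
  rw [Finset.sum_eq_single b]
  · simp
  · intro b' _ h; simp [h]
  · simp

/-- The difference of multiples of coordinate vectors solving a linear equation. -/
theorem sum_mul_single_sub_single (v : B → k) (b b' : B) :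
    ∑ i, v i * (Pi.single b (v b') - Pi.single b' (v b) : B → k) i = 0 := by
  simp only [Pi.sub_apply, mul_sub, Finset.sum_sub_distrib, sum_mul_single]
  ring

variable (hE : IsDense E) (hR : IsLocalAt E R) (hδ : delta E R = Fintype.card B + 1)
  (hGor : finrank k (Subalgebra.toSubmodule R ⧸
      (conductor E R).submoduleOf (Subalgebra.toSubmodule R)) = delta E R)
include hE hR hδ hGor

/-- The inclusion `L_1 L_2 ⊆ L_3` with `L_2 = k^B` forces `L_1 = L_3 = {x b₀ = 0}`. The exponents
`4, 2, …, 2` add up to `2δ`, so the conductor is determined once the elements of these orders are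
known to lie in `R`. -/
theorem exists_singular_branch (h1 : gradedDim E R 1 = 1) (h2 : gradedDim E R 2 = 0)
    (h3 : gradedDim E R 3 = 1) :
    ∃ b₀ : B, (∀ b, (∃ g ∈ R, E g b ∈ vanishing k 1 ∧ (E g b).coeff 1 ≠ 0) ↔ b ≠ b₀) ∧
      conductor E R = fil E fun b => ((if b = b₀ then 4 else 2 : ℕ) : ℤ) := by
  obtain ⟨v, hv0, hv⟩ := hE.exists_equation h1
  obtain ⟨w, hw0, hw⟩ := hE.exists_equation h3
  have htop := hE.leadSpace_eq_top h2
  -- Multiplying `x` by a coordinate vector of `L_2` isolates its `b`-th coordinate inside `L_3`.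
  have hVW : ∀ x ∈ leadSpace E R 1, ∀ b, w b * x b = 0 := fun x hx b => by
    have := mul_mem_leadSpace hx (htop ▸ Submodule.mem_top : Pi.single b 1 ∈ leadSpace E R 2)
    rw [hw] at this
    have h' : x * Pi.single b 1 = Pi.single b (x b) := by
      rw [← Pi.single_mul_right, mul_one]
    rwa [h', sum_mul_single] at this
  obtain ⟨b₀, hb₀⟩ := Function.ne_iff.mp hw0
  have : Nonempty B := ⟨b₀⟩
  have hvb : ∀ b, b ≠ b₀ → v b = 0 := fun b hb => by
    have := hVW _ ((hv _).mpr (sum_mul_single_sub_single v b₀ b)) b₀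
    rw [Pi.sub_apply, Pi.single_eq_same, Pi.single_eq_of_ne hb.symm, sub_zero] at this
    exact (mul_eq_zero.mp this).resolve_left hb₀
  have hvb₀ : v b₀ ≠ 0 := fun h => hv0 (funext fun b => by
    by_cases hb : b = b₀
    · rw [hb, h]; rfl
    · exact hvb b hb)
  have hV : ∀ x, x ∈ leadSpace E R 1 ↔ x b₀ = 0 := fun x => by
    rw [hv, Finset.sum_eq_single b₀ (fun b _ hb => by rw [hvb b hb, zero_mul]) (by simp),
      mul_eq_zero, or_iff_right hvb₀]
  have hwb : ∀ b, b ≠ b₀ → w b = 0 := fun b hb => by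
    have := hVW (Pi.single b 1) ((hV _).mpr (Pi.single_eq_of_ne hb.symm _)) b
    rwa [Pi.single_eq_same, mul_one] at this
  have hW : ∀ x, x b₀ = 0 → x ∈ leadSpace E R 3 := fun x hx => by
    rw [hw]
    refine Finset.sum_eq_zero fun b _ => ?_
    by_cases hb : b = b₀
    · rw [hb, hx, mul_zero]
    · rw [hwb b hb, zero_mul]
  have h0 := hE.gradedDim_zero hR
  -- The degrees `0, 1, 2, 3` contribute `(m - 1) + 1 + 0 + 1 = m + 1 = δ`.
  have hle : rad E 4 ≤ Subalgebra.toSubmodule R := rad_le (by omega) (by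
    rw [hδ]
    simp only [Finset.sum_range_succ, Finset.sum_range_zero, h1, h2, h3]
    omega)
  refine ⟨b₀, fun b => ?_, ?_⟩
  · rw [hR.exists_order_one_iff]
    constructor
    · rintro ⟨x, hx, hxb⟩ rfl
      exact hxb ((hV x).mp hx)
    · intro hb
      exact ⟨Pi.single b 1, (hV _).mpr (Pi.single_eq_of_ne hb.symm _), by simp⟩
  · refine (hE.conductor_eq hR hGor _ ?_).2 ?_
    · intro g hg
      have hlin : ∀ b, b ≠ b₀ → ∃ h ∈ R, h ∈ rad E 1 ∧ coeffs E 1 h = Pi.single b 1 :=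
        fun b hb => mem_leadSpace.mp ((hV _).mpr (Pi.single_eq_of_ne hb.symm _))
      choose! h hhR hh1 hhc using hlin
      -- An arbitrary element of `R` with the quadratic part of `g` might have a cubic term on `b₀`.
      -- Squares avoid this: `h b` has order at least two on `b₀`, so `h b * h b` has order at least
      -- four there, while its quadratic part is the coordinate vector of `b`. Then `g - f` has
      -- order at least three everywhere and no cubic term on `b₀`.
      let f : M := ∑ b ∈ Finset.univ.erase b₀, (E g b).coeff 2 • (h b * h b)
      have hfR : f ∈ R := Subalgebra.sum_mem _ fun b hb =>
        R.smul_mem (R.mul_mem (hhR b (Finset.ne_of_mem_erase hb))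
          (hhR b (Finset.ne_of_mem_erase hb))) _
      have hsq : ∀ b, b ≠ b₀ → h b * h b ∈ rad E 2 := fun b hb =>
        mul_mem_fil E (hh1 b hb) (hh1 b hb) (by simp)
      have hf2 : f ∈ rad E 2 := Submodule.sum_mem _ fun b hb =>
        Submodule.smul_mem _ _ (hsq b (Finset.ne_of_mem_erase hb))
      have hg2 : g ∈ rad E 2 := fil_anti E (fun b => by split_ifs <;> norm_num) hg
      have hb₀4 : E f b₀ ∈ vanishing k 4 := by
        simp only [f, map_sum, Finset.sum_apply, map_smul, Pi.smul_apply, map_mul, Pi.mul_apply]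
        refine Submodule.sum_mem _ fun b hb => Submodule.smul_mem _ _ ?_
        have hb' := Finset.ne_of_mem_erase hb
        have h5 : E (h b) b₀ ∈ vanishing k (1 + 1) := by
          rw [mem_vanishing_add_one]
          refine ⟨hh1 b hb' b₀, ?_⟩
          have := congrFun (hhc b hb') b₀
          rwa [Pi.single_eq_of_ne hb'.symm] at this
        exact mul_mem_vanishing_of_eq h5 h5 (by norm_num)
      have hg4 : E g b₀ ∈ vanishing k 4 := by simpa using hg b₀
      have hcf : ∀ b, b ≠ b₀ → coeffs E 2 f b = (E g b).coeff 2 := fun b hb => by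
        simp only [f, map_sum, map_smul, Finset.sum_apply, Pi.smul_apply]
        rw [Finset.sum_eq_single b]
        · have := coeffs_mul E (hh1 b hb) (hh1 b hb)
          norm_num at this
          rw [this, hhc b hb]
          simp
        · intro b' hb' hne
          have := coeffs_mul E (hh1 b' (Finset.ne_of_mem_erase hb'))
            (hh1 b' (Finset.ne_of_mem_erase hb'))
          norm_num at this
          rw [this, hhc b' (Finset.ne_of_mem_erase hb')]
          simp [hne.symm]
        · intro hb'
          exact absurd (Finset.mem_erase.mpr ⟨hb, Finset.mem_univ _⟩) hb'
      have h3 : g - f ∈ rad E 3 := by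
        rw [mem_rad_succ]
        refine ⟨sub_mem hg2 hf2, funext fun b => ?_⟩
        rw [map_sub, Pi.sub_apply]
        by_cases hb : b = b₀
        · subst hb
          change (E g b).coeff 2 - (E f b).coeff 2 = 0
          rw [hg4 2 (by norm_num), hb₀4 2 (by norm_num), sub_zero]
        · change _ - coeffs E 2 f b = 0
          rw [hcf b hb]
          exact sub_self _
      have h4 : g - f ∈ R := by
        refine mem_of_coeffs_mem hle h3 (hW _ ?_)
        change (E (g - f) b₀).coeff 3 = 0
        rw [map_sub, Pi.sub_apply, HahnSeries.coeff_sub, hg4 3 (by norm_num),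
          hb₀4 3 (by norm_num), sub_zero]
      have := R.add_mem h4 hfR
      rwa [sub_add_cancel] at this
    -- Here `4 + 2 (m - 1) = 2 (m + 1)`.
    · rw [hδ, Finset.sum_ite, Finset.filter_eq' , if_pos (Finset.mem_univ _), Finset.filter_ne']
      simp only [Finset.sum_const, Finset.card_singleton, smul_eq_mul,
        Finset.card_erase_of_mem (Finset.mem_univ b₀), Finset.card_univ]
      have := Fintype.card_pos (α := B)
      omega

/-- The two branches are the support of the linear form `v` cutting out `L_1`. The Gorenstein
inequality excludes a smaller support, and `L_1 L_1 ⊆ L_2 ≠ k^B` excludes a larger one. -/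
theorem exists_tangent_branches (h1 : gradedDim E R 1 = 1) (h2 : gradedDim E R 2 = 1) :
    ∃ b₁ b₂ : B, b₁ ≠ b₂ ∧
      (∀ b, ∃ g ∈ R, E g b ∈ vanishing k 1 ∧ (E g b).coeff 1 ≠ 0) ∧
      (∀ a b, a ≠ b → ((∀ g ∈ R, g ∈ rad E 1 → ((E g a).coeff 1 = 0 ↔ (E g b).coeff 1 = 0)) ↔
        (a = b₁ ∧ b = b₂) ∨ (a = b₂ ∧ b = b₁))) ∧
      conductor E R = fil E fun b => ((if b = b₁ ∨ b = b₂ then 3 else 2 : ℕ) : ℤ) := by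
  classical
  obtain ⟨v, hv0, hv⟩ := hE.exists_equation h1
  obtain ⟨w, hw0, hw⟩ := hE.exists_equation h2
  have hVV : ∀ x ∈ leadSpace E R 1, ∀ y ∈ leadSpace E R 1, ∑ b, w b * (x * y) b = 0 :=
    fun x hx y hy => by
    have := mul_mem_leadSpace hx hy
    rwa [hw] at this
  obtain ⟨b₁, hb₁⟩ := Function.ne_iff.mp hv0
  have : Nonempty B := ⟨b₁⟩
  have h0 := hE.gradedDim_zero hR
  -- The degrees `0, 1, 2` contribute `(m - 1) + 1 + 1 = δ`.
  have hle : rad E 3 ≤ Subalgebra.toSubmodule R := rad_le (by omega) (by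
    rw [hδ]
    simp only [Finset.sum_range_succ, Finset.sum_range_zero, h1, h2]
    omega)
  have hsingle : ∀ b, v b = 0 → Pi.single b 1 ∈ leadSpace E R 1 := fun b hb => by
    rw [hv, sum_mul_single, hb, zero_mul]
  -- The coordinate vector of `b` is idempotent, so it lies in `L_2` as soon as it lies in `L_1`.
  have hwv : ∀ b, v b = 0 → w b = 0 := fun b hb => by
    have := hVV _ (hsingle b hb) _ (hsingle b hb)
    rwa [← Pi.single_mul, mul_one, sum_mul_single, mul_one] at this
  let Z : Finset B := Finset.univ.filter fun b => v b ≠ 0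
  have hZ : ∀ b, b ∈ Z ↔ v b ≠ 0 := fun b => by simp [Z]
  have hfil : fil E (fun b => ((if v b ≠ 0 then 3 else 2 : ℕ) : ℤ)) ≤
      Subalgebra.toSubmodule R := by
    intro g hg
    have hg2 : g ∈ rad E 2 := fil_anti E (fun b => by split_ifs <;> norm_num) hg
    refine mem_of_coeffs_mem hle hg2 ((hw _).mpr (Finset.sum_eq_zero fun b _ => ?_))
    by_cases hb : v b = 0
    · rw [hwv b hb, zero_mul]
    · have h' : coeffs E 2 g b = 0 := hg b 2 (by simp [hb])
      exact mul_eq_zero_of_right _ h'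
  obtain ⟨hsum, hcond⟩ := hE.conductor_eq hR hGor _ hfil
  have hcount : ∑ b, (if v b ≠ 0 then 3 else 2) = 2 * Fintype.card B + Z.card := by
    have : ∀ b, (if v b ≠ 0 then 3 else 2) = 2 + (if v b ≠ 0 then 1 else 0) := fun b => by
      split_ifs <;> rfl
    simp only [this]
    rw [Finset.sum_add_distrib, Finset.sum_const, Finset.card_univ, smul_eq_mul, mul_comm,
      Finset.card_filter]
  rw [hcount] at hsum hcond
  -- From `2δ ≤ 2m + |Z|` and `δ = m + 1`.
  have hcard2 : 2 ≤ Z.card := by omega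
  have hcard : Z.card = 2 := by
    by_contra hne
    have h3 : 2 < Z.card := by omega
    refine hw0 (funext fun b => ?_)
    by_cases hb : v b = 0
    · exact hwv b hb
    have hbZ : b ∈ Z := (hZ b).mpr hb
    have hcard' : 1 < (Z.erase b).card := by rw [Finset.card_erase_of_mem hbZ]; omega
    obtain ⟨b', hb', b'', hb'', hne'⟩ := Finset.one_lt_card.mp hcard'
    rw [Finset.mem_erase, hZ] at hb' hb''
    -- With three distinct elements in the support, the product of `v b' e_b - v b e_b'` and `v b''
    -- e_b - v b e_b''` is `v b' * v b''` times the coordinate vector `e_b`. So `w b = 0` for every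
    -- `b`, contradicting `w ≠ 0`.
    have := hVV _ ((hv _).mpr (sum_mul_single_sub_single v b b'))
      _ ((hv _).mpr (sum_mul_single_sub_single v b b''))
    rw [Finset.sum_eq_single b] at this
    · simp only [Pi.mul_apply, Pi.sub_apply, Pi.single_eq_same, Pi.single_eq_of_ne hb'.1.symm,
        Pi.single_eq_of_ne hb''.1.symm, sub_zero, mul_eq_zero, hb'.2, hb''.2, or_false] at this
      exact this
    · intro i _ hi
      simp only [Pi.mul_apply, Pi.sub_apply, Pi.single_eq_of_ne hi, zero_sub, mul_eq_zero, neg_eq_zero]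
      right
      by_cases hib : i = b'
      · right
        rw [Pi.single_eq_of_ne (hib ▸ hne')]
      · left
        rw [Pi.single_eq_of_ne hib]
    · simp
  obtain ⟨a₁, a₂, hne, hZeq⟩ := Finset.card_eq_two.mp hcard
  have hmem : ∀ b, v b ≠ 0 ↔ b = a₁ ∨ b = a₂ := fun b => by
    rw [← hZ, hZeq, Finset.mem_insert, Finset.mem_singleton]
  have hv1 : v a₁ ≠ 0 := (hmem _).mpr (Or.inl rfl)
  have hv2 : v a₂ ≠ 0 := (hmem _).mpr (Or.inr rfl)
  have hV : ∀ x, x ∈ leadSpace E R 1 ↔ v a₁ * x a₁ + v a₂ * x a₂ = 0 := fun x => by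
    rw [hv, ← Finset.sum_subset (Finset.subset_univ {a₁, a₂}), Finset.sum_pair hne]
    intro b _ hb
    rw [← hZeq, hZ, not_not] at hb
    rw [hb, zero_mul]
  have htan : ∀ x ∈ leadSpace E R 1, x a₁ = 0 ↔ x a₂ = 0 := fun x hx => by
    rw [hV] at hx
    constructor
    · intro h
      rw [h, mul_zero, zero_add, mul_eq_zero] at hx
      exact hx.resolve_left hv2
    · intro h
      rw [h, mul_zero, add_zero, mul_eq_zero] at hx
      exact hx.resolve_left hv1
  refine ⟨a₁, a₂, hne, fun b => ?_, fun a b hab => ⟨fun h => ?_, ?_⟩, ?_⟩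
  · rw [hR.exists_order_one_iff]
    by_cases hb : v b = 0
    · exact ⟨_, hsingle b hb, by simp⟩
    · have hx := (hv _).mpr (sum_mul_single_sub_single v a₁ a₂)
      rcases (hmem b).mp hb with rfl | rfl
      · exact ⟨_, hx, by simpa [Pi.single_eq_of_ne hne] using hv2⟩
      · exact ⟨_, hx, by simpa [Pi.single_eq_of_ne hne.symm] using hv1⟩
  · have hlead : ∀ x ∈ leadSpace E R 1, x a = 0 ↔ x b = 0 := fun x hx => by
      obtain ⟨g, hg, hg1, rfl⟩ := mem_leadSpace.mp hx
      exact h g hg hg1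
    -- Off the support of `v` the coordinate vector itself lies in `L_1`; it vanishes at exactly one
    -- of the two branches and so disproves tangency.
    have ha : v a ≠ 0 := fun ha => by
      have := (hlead _ (hsingle a ha)).mpr (Pi.single_eq_of_ne hab.symm _)
      simp at this
    have hb : v b ≠ 0 := fun hb => by
      have := (hlead _ (hsingle b hb)).mp (Pi.single_eq_of_ne hab _)
      simp at this
    rw [hmem] at ha hb
    rcases ha with rfl | rfl <;> rcases hb with rfl | rfl
    · exact absurd rfl hab
    · exact Or.inl ⟨rfl, rfl⟩
    · exact Or.inr ⟨rfl, rfl⟩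
    · exact absurd rfl hab
  · rintro (⟨rfl, rfl⟩ | ⟨rfl, rfl⟩) g hg hg1
    · exact htan _ (mem_leadSpace.mpr ⟨g, hg, hg1, rfl⟩)
    · exact (htan _ (mem_leadSpace.mpr ⟨g, hg, hg1, rfl⟩)).symm
  · rw [hcond (by omega)]
    simp only [hmem]

end BranchExpansion

end

/-! ### Residue duality: the dual of a Gorenstein local ring is generated by one differential -/

section

/-- The range is `A / ker f`, which maps onto `A / N` and so has dimension at least that of `T`. -/
theorem LinearMap.surjective_of_ker_le {k A T : Type*} [Field k] [AddCommGroup A] [Module k A]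
    [AddCommGroup T] [Module k T] [FiniteDimensional k T] {f : A →ₗ[k] T} {N : Submodule k A}
    (hN : LinearMap.ker f ≤ N) (h : Module.finrank k (A ⧸ N) = Module.finrank k T) :
    Function.Surjective f := by
  refine LinearMap.range_eq_top.mp
    (Submodule.eq_top_of_finrank_eq (le_antisymm (LinearMap.range f).finrank_le ?_))
  have : FiniteDimensional k (A ⧸ LinearMap.ker f) := f.quotKerEquivRange.symm.finiteDimensional
  rw [← h, ← f.quotKerEquivRange.finrank_eq]
  exact LinearMap.finrank_le_finrank_of_surjective (f := Submodule.factor hN)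
    (Submodule.factor_surjective hN)

/-- A linear map from `A` to `T` is surjective if its kernel is so small that the dimensions
agree. -/
theorem Submodule.exists_mem_eq_of_finrank_eq {k M U : Type*} [Field k] [AddCommGroup M]
    [Module k M] [AddCommGroup U] [Module k U] {Φ : M →ₗ[k] U} {A N : Submodule k M}
    {T : Submodule k U} [FiniteDimensional k T] (hA : ∀ f ∈ A, Φ f ∈ T)
    (hN : ∀ f ∈ A, Φ f = 0 → f ∈ N)
    (h : Module.finrank k (A ⧸ N.submoduleOf A) = Module.finrank k T) {l : U} (hl : l ∈ T) :
    ∃ f ∈ A, Φ f = l := by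
  let Ψ : A →ₗ[k] T := (Φ.comp A.subtype).codRestrict _ fun f => hA f f.2
  have hker : LinearMap.ker Ψ ≤ N.submoduleOf A := fun f hf =>
    hN f f.2 (congrArg Subtype.val (LinearMap.mem_ker.mp hf))
  obtain ⟨f, hf⟩ := LinearMap.surjective_of_ker_le hker h ⟨l, hl⟩
  exact ⟨f, f.2, congrArg Subtype.val hf⟩

namespace BranchExpansion

open LaurentSeries Module

variable {k : Type*} [Field k] {B : Type*} {M : Type*} [CommRing M] [Algebra k M]
  {E : M →ₐ[k] (B → LaurentSeries k)} {R : Subalgebra k M}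

theorem smul_single_one (n : ℤ) (c : k) :
    c • (HahnSeries.single n 1 : LaurentSeries k) = HahnSeries.single n c := by
  ext i
  rw [HahnSeries.coeff_smul]
  by_cases h : i = n
  · rw [h, HahnSeries.coeff_single_same, HahnSeries.coeff_single_same, smul_eq_mul, mul_one]
  · rw [HahnSeries.coeff_single_of_ne h, HahnSeries.coeff_single_of_ne h, smul_zero]

theorem exists_order {f : LaurentSeries k} {n : ℤ} (h : f ∉ vanishing k n) :
    ∃ m < n, f ∈ vanishing k m ∧ f.coeff m ≠ 0 := by
  rw [mem_vanishing] at h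
  push Not at h
  obtain ⟨j, hj, hne⟩ := h
  have hf : f ≠ 0 := by rintro rfl; exact hne rfl
  refine ⟨f.order, (HahnSeries.order_le_of_coeff_ne_zero hne).trans_lt hj, fun i hi => ?_,
    HahnSeries.coeff_order_eq_zero.not.mpr hf⟩
  exact HahnSeries.coeff_eq_zero_of_lt_order hi

/-- A factor of exact order `n` can be cancelled. -/
theorem mem_vanishing_of_mul_mem {f g : LaurentSeries k} {m n l : ℤ} (hg : g ∈ vanishing k n)
    (hg0 : g.coeff n ≠ 0) (h : f * g ∈ vanishing k l) (hl : l = m + n) : f ∈ vanishing k m := by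
  by_contra hf
  obtain ⟨j, hj, hfj, hne⟩ := exists_order hf
  have := coeff_mul_of_mem hfj hg
  rw [h (j + n) (by omega)] at this
  exact mul_ne_zero hne hg0 this.symm

variable [Fintype B] {D : Type*} [AddCommGroup D] [Module M D] (Δ : D →+ (B → LaurentSeries k))

/-- The sum of the residues along the branches. -/
def resSum (η : D) : k := ∑ b, (Δ η b).coeff (-1)

theorem resSum_add (η θ : D) : resSum Δ (η + θ) = resSum Δ η + resSum Δ θ := by
  simp [resSum, Finset.sum_add_distrib]

theorem resSum_sub (η θ : D) : resSum Δ (η - θ) = resSum Δ η - resSum Δ θ := by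
  simp [resSum, Finset.sum_sub_distrib]

theorem exists_nat_forall_mem_vanishing (G : B → LaurentSeries k) :
    ∃ N : ℕ, ∀ b, G b ∈ vanishing k (-N) := by
  choose n hn using fun b => exists_mem_vanishing (G b)
  refine ⟨∑ b, n b, fun b => vanishing_anti ?_ (hn b)⟩
  have : n b ≤ ∑ b, n b := Finset.single_le_sum (fun _ _ => Nat.zero_le _) (Finset.mem_univ b)
  omega

section

variable {Δ} (hE : IsDense E) (hΔ : ∀ (g : M) (η : D) (b : B), Δ (g • η) b = E g b * Δ η b)
include hE hΔ

/-- If `η` had a leading term of degree `m < -c b` on `b`, a function close to `t^(-1-m)` on `b` and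
highly vanishing on the other branches would lie in `fil E c` and pick out the nonzero leading
coefficient as its residue sum. -/
theorem mem_vanishing_of_resSum (c : B → ℕ) {η : D}
    (h : ∀ g ∈ fil E (fun b => c b), resSum Δ (g • η) = 0) (b : B) :
    Δ η b ∈ vanishing k (-c b) := by
  classical
  by_contra hb
  obtain ⟨m, hm, hηm, hne⟩ := exists_order hb
  obtain ⟨N, hN⟩ := exists_nat_forall_mem_vanishing (Δ η)
  obtain ⟨C, hc⟩ : ∃ C, ∀ b', c b' ≤ C := ⟨∑ b, c b, fun b' =>
    Finset.single_le_sum (fun _ _ => Nat.zero_le _) (Finset.mem_univ b')⟩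
  -- In the precision, `N` cancels the poles of `η` on the other branches, `C` ensures order at
  -- least `c`, and `-m` fixes the coefficient of degree `-1 - m` on `b`.
  obtain ⟨g, hg⟩ := hE (Pi.single b (HahnSeries.single (-1 - m) 1)) (N + C + (-m).toNat)
  have hgb : E g b ∈ vanishing k (-1 - m) := by
    have := hg b
    rw [Pi.single_eq_same] at this
    have := Submodule.add_mem _ (vanishing_anti (by push_cast; omega) this)
      (single_mem_vanishing (le_refl (-1 - m)) (1 : k))
    rwa [sub_add_cancel] at this
  have hgb' : ∀ b', b' ≠ b → E g b' ∈ vanishing k (N + c b') := fun b' hne' => by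
    have := hg b'
    rw [Pi.single_eq_of_ne hne', sub_zero] at this
    exact vanishing_anti (by have := hc b'; push_cast; omega) this
  have hgf : g ∈ fil E fun b => (c b : ℤ) := fun b' => by
    by_cases hb' : b' = b
    · subst hb'
      exact vanishing_anti (by dsimp only; omega) hgb
    · exact vanishing_anti (by dsimp only; omega) (hgb' b' hb')
  have := h g hgf
  rw [resSum, Finset.sum_eq_single b] at this
  · rw [hΔ] at this
    have h1 := coeff_mul_of_mem hgb hηm
    have h2 := hg b (-1 - m) (by push_cast; omega)
    rw [Pi.single_eq_same, HahnSeries.coeff_sub, HahnSeries.coeff_single_same, sub_eq_zero] at h2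
    rw [sub_add_cancel, this, h2, one_mul] at h1
    exact hne h1.symm
  · intro b' _ hb'
    rw [hΔ]
    exact mul_mem_vanishing_of_eq (l := c b') (hgb' b' hb') (hN b') (by omega) _ (by omega)
  · simp

/-- The principal parts of a differential along the branches can be prescribed. -/
theorem exists_prescribed {θ : D} (hθ : ∀ b, Δ θ b ≠ 0) (G : B → LaurentSeries k) :
    ∃ η : D, ∀ b, Δ η b - G b ∈ vanishing k 0 := by
  obtain ⟨N, hN⟩ := exists_nat_forall_mem_vanishing (Δ θ)
  obtain ⟨g, hg⟩ := hE (fun b => G b / Δ θ b) N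
  refine ⟨g • θ, fun b => ?_⟩
  have h1 : Δ (g • θ) b - G b = (E g b - G b / Δ θ b) * Δ θ b := by
    rw [hΔ, sub_mul, div_mul_cancel₀ _ (hθ b)]
  rw [h1]
  exact mul_mem_vanishing_of_eq (hg b) (hN b) (by simp)

end

/-- The differentials such that the sum of the residues vanishes for all multiples by elements
of `R`. -/
def dual (R : Subalgebra k M) : Set D := {η | ∀ f ∈ R, resSum Δ (f • η) = 0}

variable {Δ} (hE : IsDense E) (hR : IsLocalAt E R)
  (hΔ : ∀ (g : M) (η : D) (b : B), Δ (g • η) b = E g b * Δ η b)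
  {c : B → ℕ} (hcond : conductor E R = fil E fun b => (c b : ℤ))

section

include hE hΔ hcond

theorem mem_vanishing_of_mem_dual {η : D} (hη : η ∈ dual Δ R) (b : B) :
    Δ η b ∈ vanishing k (-c b) :=
  mem_vanishing_of_resSum hE hΔ c (fun g hg => hη g (conductor_le E R (hcond ▸ hg))) b

end

section

variable (hδ : delta E R ≠ 0)
include hE hR hΔ hcond hδ

/-- Every linear functional `l` on `R̃ / R` is a residue pairing with some `η`, whose coefficient of
degree `-c b` on `b` is the value of `l` at the class of `t^(c b - 1)` on `b`. These classes are
nonzero, and over an infinite field some `l` is nonzero on all of them. -/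
theorem exists_mem_dual_coeff_ne_zero [Infinite k] (hc : ∀ b, c b ≠ 0) {θ : D}
    (hθ : ∀ b, Δ θ b ≠ 0) :
    ∃ η ∈ dual Δ R, ∀ b, (Δ η b).coeff (-c b) ≠ 0 := by
  classical
  have hFR : fil E (fun b => (c b : ℤ)) ≤ Subalgebra.toSubmodule R := hcond ▸ conductor_le E R
  have hcle : ∀ b', c b' ≤ ∑ b, c b := fun b' =>
    Finset.single_le_sum (fun _ _ => Nat.zero_le _) (Finset.mem_univ b')
  choose e he using fun (b : B) (j : ℕ) =>
    hE (Pi.single b (HahnSeries.single (j : ℤ) 1)) (∑ b, c b)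
  have he_same : ∀ b j, E (e b j) b - HahnSeries.single (j : ℤ) 1 ∈ vanishing k (c b) :=
    fun b j => by
      have := he b j b
      rw [Pi.single_eq_same] at this
      exact vanishing_anti (by have := hcle b; omega) this
  have he_ne : ∀ b j b', b' ≠ b → E (e b j) b' ∈ vanishing k (c b') := fun b j b' hb' => by
    have := he b j b'
    rw [Pi.single_eq_of_ne hb', sub_zero] at this
    exact vanishing_anti (by have := hcle b'; omega) this
  have he0 : ∀ b j, e b j ∈ rad E 0 := fun b j b' => by
    by_cases hb' : b' = b
    · subst hb'
      have := Submodule.add_mem _ (vanishing_anti (by positivity) (he_same b' j))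
        (single_mem_vanishing (m := 0) (by positivity : (0 : ℤ) ≤ j) (1 : k))
      rwa [sub_add_cancel] at this
    · exact vanishing_anti (by positivity) (he_ne b j b' hb')
  let Q := rad E 0 ⧸ (Subalgebra.toSubmodule R).submoduleOf (rad E 0)
  have : FiniteDimensional k Q := Module.finite_of_finrank_pos (Nat.pos_of_ne_zero hδ)
  let π : rad E 0 →ₗ[k] Q := Submodule.mkQ _
  have hπ : ∀ x : rad E 0, π x = 0 ↔ (x : M) ∈ R := fun x => by
    change Submodule.mkQ _ x = 0 ↔ _
    rw [Submodule.mkQ_apply, Submodule.Quotient.mk_eq_zero]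
    rfl
  -- Modulo elements of order at least `c`, multiplying this element by an integral `h` only scales
  -- it by the constant term of `h` on `b`. If it were in `R`, it would be in the conductor, hence
  -- of order at least `c b` on `b`.
  have htop : ∀ b, e b (c b - 1) ∉ R := fun b hb => by
    have hlast : E (e b (c b - 1)) b ∈ vanishing k ((c b : ℤ) - 1) := by
      have := Submodule.add_mem _ (vanishing_anti (by omega) (he_same b (c b - 1)))
        (single_mem_vanishing (m := (c b : ℤ) - 1) (n := ((c b - 1 : ℕ) : ℤ))
          (by have := hc b; omega) (1 : k))
      rwa [sub_add_cancel] at this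
    have hone : (E (e b (c b - 1)) b).coeff ((c b : ℤ) - 1) = 1 := by
      have := he_same b (c b - 1) ((c b : ℤ) - 1) (by omega)
      rw [HahnSeries.coeff_sub, sub_eq_zero] at this
      rw [this, show ((c b : ℤ) - 1) = ((c b - 1 : ℕ) : ℤ) by have := hc b; omega,
        HahnSeries.coeff_single_same]
    have hmem : e b (c b - 1) ∈ conductor E R := fun h hh => by
      have h1 : e b (c b - 1) * h - (E h b).coeff 0 • e b (c b - 1) ∈
          fil E (fun b => (c b : ℤ)) := fun b' => by
        rw [map_sub, map_smul, map_mul, Pi.sub_apply, Pi.mul_apply, Pi.smul_apply]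
        by_cases hb' : b' = b
        · subst hb'
          change _ ∈ vanishing k (c b' : ℤ)
          rw [← sub_add_cancel (c b' : ℤ) 1, mem_vanishing_add_one]
          constructor
          · exact sub_mem (mul_mem_vanishing_of_eq hlast (hh b') (by simp))
              (Submodule.smul_mem _ _ hlast)
          · have := coeff_mul_of_mem hlast (hh b')
            simp only [Nat.cast_zero, add_zero] at this
            rw [HahnSeries.coeff_sub, this, HahnSeries.coeff_smul, smul_eq_mul, mul_comm, sub_self]
        · exact sub_mem (mul_mem_vanishing_of_eq (he_ne b _ b' hb') (hh b') (by simp))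
            (Submodule.smul_mem _ _ (he_ne b _ b' hb'))
      have h2 := R.add_mem (hFR h1) (R.smul_mem hb ((E h b).coeff 0))
      rwa [sub_add_cancel] at h2
    rw [hcond] at hmem
    have := hmem b ((c b : ℤ) - 1) (by dsimp only; omega)
    rw [hone] at this
    exact one_ne_zero this
  obtain ⟨l, hl⟩ := Module.exists_dual_forall_apply_ne_zero (K := k)
    (fun b => π ⟨e b (c b - 1), he0 b _⟩) (fun b h => htop b ((hπ _).mp h))
  let L : B → ℕ → k := fun b j => l (π ⟨e b j, he0 b j⟩)
  -- The principal part is chosen so that pairing with `t^j` on the branch `b` gives `l` of the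
  -- class of `e b j`.
  obtain ⟨η, hη⟩ := exists_prescribed hE hΔ hθ
    (fun b => ∑ j ∈ Finset.range (c b), HahnSeries.single (-(j : ℤ) - 1) (L b j))
  have hres : ∀ f : rad E 0, resSum Δ ((f : M) • η) = l (π f) := fun f => by
    -- The truncation of `f` below order `c` differs from `f` by an element of the conductor, to
    -- which `l` is blind.
    let f' : rad E 0 :=
      ∑ b, ∑ j ∈ Finset.range (c b), (E f b).coeff (j : ℤ) • ⟨e b j, he0 b j⟩
    have hf' : (f' : M) = ∑ b, ∑ j ∈ Finset.range (c b), (E f b).coeff (j : ℤ) • e b j := by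
      simp only [f', Submodule.coe_sum, Submodule.coe_smul]
    have hEf' : ∀ b', E (f' : M) b' -
        ∑ j ∈ Finset.range (c b'), HahnSeries.single (j : ℤ) ((E f b').coeff (j : ℤ)) ∈
          vanishing k (c b') := fun b' => by
      rw [hf']
      simp only [map_sum, Finset.sum_apply, map_smul, Pi.smul_apply]
      rw [← Finset.add_sum_erase _ _ (Finset.mem_univ b'), add_sub_right_comm,
        ← Finset.sum_sub_distrib]
      refine Submodule.add_mem _ (Submodule.sum_mem _ fun j _ => ?_) (Submodule.sum_mem _
        fun b hb => Submodule.sum_mem _ fun j _ => Submodule.smul_mem _ _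
          (he_ne b j b' (Finset.ne_of_mem_erase hb).symm))
      have := Submodule.smul_mem _ ((E f b').coeff (j : ℤ)) (he_same b' j)
      rwa [smul_sub, smul_single_one] at this
    have hff' : ((f - f' : rad E 0) : M) ∈ R := hFR fun b' => by
      rw [Submodule.coe_sub, map_sub, Pi.sub_apply]
      have h1 : E (f : M) b' - ∑ j ∈ Finset.range (c b'),
          HahnSeries.single (j : ℤ) ((E f b').coeff (j : ℤ)) ∈ vanishing k (c b') := by
        intro i hi
        rw [HahnSeries.coeff_sub, HahnSeries.coeff_sum]
        rcases lt_or_ge i 0 with hi0 | hi0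
        · rw [f.2 b' i (by simpa using hi0), Finset.sum_eq_zero, sub_zero]
          intro j _
          rw [HahnSeries.coeff_single_of_ne (by omega)]
        · lift i to ℕ using hi0
          rw [Finset.sum_eq_single i, HahnSeries.coeff_single_same, sub_self]
          · intro j _ hj
            rw [HahnSeries.coeff_single_of_ne (by omega)]
          · intro hi'
            exact absurd (Finset.mem_range.mpr (by simpa using hi)) hi'
      have := Submodule.sub_mem _ h1 (hEf' b')
      rwa [sub_sub_sub_cancel_right] at this
    have h2 : l (π f) = l (π f') := by
      rw [← sub_eq_zero, ← map_sub, ← map_sub, (hπ _).mpr hff', map_zero]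
    rw [h2]
    simp only [f', map_sum, map_smul, smul_eq_mul]
    rw [resSum]
    refine Finset.sum_congr rfl fun b _ => ?_
    have h3 := mul_mem_vanishing (f.2 b) (hη b) (-1) (by norm_num)
    rw [mul_sub, HahnSeries.coeff_sub, sub_eq_zero] at h3
    rw [hΔ, h3, Finset.mul_sum, HahnSeries.coeff_sum]
    refine Finset.sum_congr rfl fun j _ => ?_
    rw [mul_comm, coeff_single_mul', mul_comm]
    congr 2
    ring
  refine ⟨η, fun f hf => ?_, fun b => ?_⟩
  · rw [hres ⟨f, hR.le hf⟩, (hπ _).mpr hf, map_zero]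
  · have := hη b (-c b) (by have := hc b; omega)
    rw [HahnSeries.coeff_sub, sub_eq_zero] at this
    rw [this, HahnSeries.coeff_sum, Finset.sum_eq_single (c b - 1)]
    · rw [show (-((c b - 1 : ℕ) : ℤ) - 1) = -c b by have := hc b; omega,
        HahnSeries.coeff_single_same]
      exact hl b
    · intro j hj hne
      rw [HahnSeries.coeff_single_of_ne (by rw [Finset.mem_range] at hj; omega)]
    · intro hnot
      exact absurd (Finset.mem_range.mpr (by have := hc b; omega)) hnot

/-- The pairing `(f, h) ↦ Res(f h η)` embeds `R / I` into the annihilator of `R` in the dual of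
`R̃`. Both have dimension `δ`, so the functional attached to `g` is also attached to some `f ∈ R`,
and then `g - f ∈ I ⊆ R`. -/
theorem mem_of_smul_mem_dual (hGor : finrank k (Subalgebra.toSubmodule R ⧸
      (conductor E R).submoduleOf (Subalgebra.toSubmodule R)) = delta E R)
    {η : D} (hη : η ∈ dual Δ R) (hne : ∀ b, (Δ η b).coeff (-c b) ≠ 0) {g : M}
    (hg : g • η ∈ dual Δ R) : g ∈ R := by
  have hηc := mem_vanishing_of_mem_dual hE hΔ hcond hη
  have hg0 : g ∈ rad E 0 := fun b =>
    mem_vanishing_of_mul_mem (hηc b) (hne b)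
      (hΔ g η b ▸ mem_vanishing_of_mem_dual hE hΔ hcond hg b) (by simp)
  -- A differential `f • η` orthogonal to all integral elements has no poles; as `η` has exact pole
  -- order `c`, the factor `f` has order at least `c`.
  have hzero : ∀ f ∈ rad E 0, (∀ h ∈ rad E 0, resSum Δ ((f * h) • η) = 0) →
      f ∈ conductor E R := fun f _ hf => by
    rw [hcond]
    intro b
    have := mem_vanishing_of_resSum hE hΔ (fun _ => 0) (η := f • η) (fun h hh => by
      rw [smul_smul, mul_comm]; exact hf h hh) b
    rw [hΔ] at this
    exact mem_vanishing_of_mul_mem (hηc b) (hne b) this (by simp)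
  have hsm : ∀ (a : k) (f : M), resSum Δ ((a • f) • η) = a * resSum Δ (f • η) := fun a f => by
    simp only [resSum, hΔ, map_smul, Pi.smul_apply, smul_mul_assoc, HahnSeries.coeff_smul,
      smul_eq_mul, Finset.mul_sum]
  obtain ⟨Φ, hΦ⟩ : ∃ Φ : M →ₗ[k] Dual k (rad E 0), ∀ f h, Φ f h = resSum Δ ((f * h) • η) :=
    ⟨LinearMap.mk₂ k (fun f (h : rad E 0) => resSum Δ ((f * h) • η))
      (fun f f' h => by rw [add_mul, add_smul, resSum_add])
      (fun a f h => by rw [smul_mul_assoc, hsm, smul_eq_mul])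
      (fun f h h' => by rw [Submodule.coe_add, mul_add, add_smul, resSum_add])
      (fun a f h => by rw [Submodule.coe_smul, mul_smul_comm, hsm, smul_eq_mul]),
      fun f h => rfl⟩
  have hann : ∀ f, f • η ∈ dual Δ R →
      Φ f ∈ ((Subalgebra.toSubmodule R).submoduleOf (rad E 0)).dualAnnihilator := fun f hf => by
    rw [Submodule.mem_dualAnnihilator]
    intro h hh
    rw [hΦ, mul_comm, ← smul_smul]
    exact hf h hh
  have hRdual : ∀ f ∈ R, f • η ∈ dual Δ R := fun f hf h hh => by
    rw [smul_smul]
    exact hη _ (R.mul_mem hh hf)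
  set W := (Subalgebra.toSubmodule R).submoduleOf (rad E 0) with hW
  have : FiniteDimensional k (rad E 0 ⧸ W) :=
    Module.finite_of_finrank_pos (Nat.pos_of_ne_zero hδ)
  have : FiniteDimensional k W.dualAnnihilator :=
    W.dualQuotEquivDualAnnihilator.finiteDimensional
  have hfr : finrank k W.dualAnnihilator = delta E R := by
    rw [← W.dualQuotEquivDualAnnihilator.finrank_eq, Subspace.dual_finrank_eq]; rfl
  obtain ⟨f, hfR, hf⟩ : ∃ f ∈ Subalgebra.toSubmodule R, Φ f = Φ g :=
    Submodule.exists_mem_eq_of_finrank_eq (fun f hf => hann f (hRdual f hf)) (N := conductor E R)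
      (fun f hf h0 => hzero f (hR.le hf) fun h hh => by
        rw [← hΦ f ⟨h, hh⟩, h0]; rfl) (hGor.trans hfr.symm) (hann g hg)
  have hgf : g - f ∈ conductor E R := by
    refine hzero _ (sub_mem hg0 (hR.le hfR)) fun h hh => ?_
    rw [sub_mul, sub_smul, resSum_sub, sub_eq_zero]
    exact ((hΦ g ⟨h, hh⟩).symm.trans (LinearMap.congr_fun hf.symm _)).trans (hΦ f ⟨h, hh⟩)
  have := R.add_mem (conductor_le E R hgf) hfR
  rwa [sub_add_cancel] at this

end

/-- For a Gorenstein singularity with conductor the elements of order at least `c`, the dual of `R`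
is generated by an element of exact pole orders `c`. -/
theorem exists_generator_dual [Infinite k] (hE : IsDense E) (hR : IsLocalAt E R)
    (hΔ : ∀ (g : M) (η : D) (b : B), Δ (g • η) b = E g b * Δ η b)
    {c : B → ℕ} (hcond : conductor E R = fil E fun b => (c b : ℤ)) (hδ : delta E R ≠ 0)
    (hGor : finrank k (Subalgebra.toSubmodule R ⧸
      (conductor E R).submoduleOf (Subalgebra.toSubmodule R)) = delta E R)
    (hc : ∀ b, c b ≠ 0) {θ : D} (hθ : ∀ b, Δ θ b ≠ 0)
    (hgen : ∀ η₀ : D, (∀ b, Δ η₀ b ≠ 0) → ∀ η : D, ∃ g : M, η = g • η₀) :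
    ∃ η₀ ∈ dual Δ R, (∀ b, (Δ η₀ b).coeff (-c b) ≠ 0) ∧
      ∀ η, η ∈ dual Δ R ↔ ∃ g ∈ R, η = g • η₀ := by
  obtain ⟨η₀, h1, h2⟩ := exists_mem_dual_coeff_ne_zero hE hR hΔ hcond hδ hc hθ
  refine ⟨η₀, h1, h2, fun η => ⟨fun hη => ?_, ?_⟩⟩
  · obtain ⟨g, rfl⟩ := hgen η₀ (fun b h => h2 b (by rw [h]; rfl)) η
    exact ⟨g, mem_of_smul_mem_dual hE hR hΔ hcond hδ hGor h1 h2 hη, rfl⟩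
  · rintro ⟨g, hg, rfl⟩ f hf
    rw [smul_smul]
    exact h1 _ (R.mul_mem hf hg)

end BranchExpansion

end

section

/-! ### Differentials on a nonsingular curve -/

namespace IsDiscreteValuationRing

open IsLocalRing KaehlerDifferential

variable {k O K : Type u} [Field k] [CommRing O] [IsDomain O] [IsDiscreteValuationRing O]
  [Algebra k O] [Field K] [Algebra O K] [Algebra k K] [IsScalarTower k O K]
  [Algebra.EssFiniteType k O]
  (hres : ∀ x : O, ∃ c : k, x - algebraMap k O c ∈ IsLocalRing.maximalIdeal O)
  {t : O} (ht : Irreducible t)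

section

include hres ht

-- Nakayama: writing `a = c + t b` with `c` constant gives `da = b dt + t db`, so `dt` generates
-- modulo the maximal ideal. The module is finitely generated because `O` is essentially of finite
-- type.
variable (K) in
theorem span_range_D_eq :
    Submodule.span O (Set.range fun a : O => D k K (algebraMap O K a)) =
      Submodule.span O {D k K (algebraMap O K t)} := by
  refine le_antisymm ?_ (Submodule.span_mono (Set.singleton_subset_iff.mpr ⟨t, rfl⟩))
  have hmap : Submodule.span O (Set.range fun a : O => D k K (algebraMap O K a)) =
      (⊤ : Submodule O Ω[O⁄k]).map (KaehlerDifferential.map k k O K) := by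
    rw [← KaehlerDifferential.span_range_derivation, Submodule.map_span, ← Set.range_comp]
    congr 1
    ext x
    simp [KaehlerDifferential.map_D]
  have hfg : (Submodule.span O (Set.range fun a : O => D k K (algebraMap O K a))).FG := by
    rw [hmap]
    exact Submodule.FG.map _ Module.Finite.fg_top
  refine Submodule.le_of_le_smul_of_le_jacobson_bot hfg (maximalIdeal_le_jacobson ⊥) ?_
  rw [Submodule.span_le]
  rintro _ ⟨a, rfl⟩
  obtain ⟨c, hc⟩ := hres a
  rw [ht.maximalIdeal_eq, Ideal.mem_span_singleton] at hc
  obtain ⟨b, hb⟩ := hc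
  have ha : algebraMap O K a = algebraMap k K c + algebraMap O K t * algebraMap O K b := by
    rw [← map_mul, ← hb, map_sub, ← IsScalarTower.algebraMap_apply]; ring
  have hD : D k K (algebraMap O K a) =
      b • D k K (algebraMap O K t) + t • D k K (algebraMap O K b) := by
    rw [ha, map_add, Derivation.map_algebraMap, zero_add, Derivation.leibniz,
      algebraMap_smul, algebraMap_smul, add_comm]
  change D k K (algebraMap O K a) ∈ _
  rw [hD]
  refine Submodule.add_mem_sup (Submodule.smul_mem _ _ (Submodule.mem_span_singleton_self _))
    (Submodule.smul_mem_smul ?_ (Submodule.subset_span ⟨b, rfl⟩))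
  rw [ht.maximalIdeal_eq]
  exact Ideal.mem_span_singleton_self t

variable [IsFractionRing O K]

theorem exists_eq_smul_D (η : Ω[K⁄k]) : ∃ g : K, η = g • D k K (algebraMap O K t) := by
  have h1 : ∀ a : O, D k K (algebraMap O K a) ∈ Submodule.span K {D k K (algebraMap O K t)} := by
    intro a
    have h : D k K (algebraMap O K a) ∈ Submodule.span O {D k K (algebraMap O K t)} :=
      span_range_D_eq K hres ht ▸ Submodule.subset_span ⟨a, rfl⟩
    obtain ⟨b, hb⟩ := Submodule.mem_span_singleton.mp h
    rw [← hb, ← algebraMap_smul K b]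
    exact Submodule.smul_mem _ _ (Submodule.mem_span_singleton_self _)
  have h2 : η ∈ Submodule.span K (Set.range (D k K)) := by
    rw [KaehlerDifferential.span_range_derivation]; trivial
  have h3 : Submodule.span K (Set.range (D k K)) ≤
      Submodule.span K {D k K (algebraMap O K t)} := by
    rw [Submodule.span_le]
    rintro _ ⟨x, rfl⟩
    obtain ⟨a, s, hs, rfl⟩ := IsFractionRing.div_surjective (A := O) x
    have hs0 : algebraMap O K s ≠ 0 := IsFractionRing.to_map_ne_zero_of_mem_nonZeroDivisors hs
    have h4 := (D k K).leibniz (algebraMap O K a / algebraMap O K s) (algebraMap O K s)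
    rw [div_mul_cancel₀ _ hs0] at h4
    have h5 : algebraMap O K s • D k K (algebraMap O K a / algebraMap O K s) ∈
        Submodule.span K {D k K (algebraMap O K t)} := by
      rw [← sub_eq_iff_eq_add'.mpr h4]
      exact sub_mem (h1 a) (Submodule.smul_mem _ _ (h1 s))
    exact (Submodule.smul_mem_iff _ hs0).mp h5
  obtain ⟨g, hg⟩ := Submodule.mem_span_singleton.mp (h3 h2)
  exact ⟨g, hg.symm⟩

/-- If `dt = 0` then `Ω[K⁄k] = 0`, so `K` is unramified over `k`, hence separable algebraic, hence
equal to `k`. The uniformiser would then be a constant, which is zero or a unit. -/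
theorem D_ne_zero [IsAlgClosed k] : D k K (algebraMap O K t) ≠ 0 := by
  intro h0
  have hsub : Subsingleton Ω[K⁄k] := subsingleton_of_forall_eq 0 fun η => by
    obtain ⟨g, rfl⟩ := exists_eq_smul_D hres ht η
    rw [h0, smul_zero]
  have : Algebra.FormallyUnramified k K := ⟨hsub⟩
  have : Algebra.EssFiniteType O K := Algebra.EssFiniteType.of_isLocalization _ (nonZeroDivisors O)
  have : Algebra.EssFiniteType k K := Algebra.EssFiniteType.comp k O K
  have : Algebra.IsSeparable k K := Algebra.FormallyUnramified.isSeparable k K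
  obtain ⟨c, hc⟩ := (IsAlgClosed.algebraMap_bijective_of_isIntegral (k := k) (K := K)).surjective
    (algebraMap O K t)
  rw [IsScalarTower.algebraMap_apply k O K] at hc
  have hct := IsFractionRing.injective O K hc
  have hc0 : c ≠ 0 := by
    rintro rfl
    rw [map_zero] at hct
    exact ht.ne_zero hct.symm
  exact ht.not_isUnit (hct ▸ (isUnit_iff_ne_zero.mpr hc0).map (algebraMap k O))

theorem smul_D_mem_span_iff [IsAlgClosed k] (g : K) :
    g • D k K (algebraMap O K t) ∈
        Submodule.span O (Set.range fun a : O => D k K (algebraMap O K a)) ↔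
      ∃ a, algebraMap O K a = g := by
  rw [span_range_D_eq K hres ht, Submodule.mem_span_singleton]
  refine exists_congr fun a => ?_
  rw [← algebraMap_smul K a]
  exact ⟨fun h => smul_left_injective K (D_ne_zero hres ht) h, fun h => by rw [h]⟩

end

end IsDiscreteValuationRing

end

/-! ### Points of the normalisation and their local rings -/

namespace CurveWithNormalisation

variable {k : Type u} [Field k] {r : ℕ} (S : CurveWithNormalisation k r)

instance : IsReduced S.X := S.isReduced
instance : IsSeparated S.str := S.isSeparated
instance : LocallyOfFiniteType S.str := S.locallyOfFiniteType
instance : QuasiCompact S.str := S.quasiCompact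
instance : IsFinite (Limits.Sigma.desc S.ν) := S.isFinite

theorem desc_ι_apply (i : Fin r) (p : S.C i) :
    Limits.Sigma.desc S.ν (Limits.Sigma.ι S.C i p) = S.ν i p := by
  rw [← Scheme.Hom.comp_apply, Limits.Sigma.ι_desc]

theorem exists_sigmaι_eq (z : (∐ S.C : Scheme.{u})) : ∃ i p, Limits.Sigma.ι S.C i p = z := by
  exact (sigmaOpenCover S.C).exists_eq z

instance isClosedImmersion_sigmaι (i : Fin r) : IsClosedImmersion (Limits.Sigma.ι S.C i) := by
  refine IsClosedImmersion.of_isPreimmersion _ ?_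
  have h : Set.range (Limits.Sigma.ι S.C i) =
      (⋃ j ∈ {j : Fin r | j ≠ i}, Set.range (Limits.Sigma.ι S.C j))ᶜ := by
    ext z
    simp only [Set.mem_compl_iff, Set.mem_iUnion, Set.mem_ofPred_eq, not_exists]
    constructor
    · rintro ⟨p, rfl⟩ j hj ⟨p', hp'⟩
      have := (sigmaι_eq_iff S.C _ _ _ _).mp hp'
      exact hj (Sigma.mk.inj this).1
    · intro h
      obtain ⟨j, p, rfl⟩ := S.exists_sigmaι_eq z
      by_cases hj : j = i
      · subst hj; exact ⟨p, rfl⟩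
      · exact absurd ⟨p, rfl⟩ (h j hj)
  rw [h, isClosed_compl_iff]
  exact isOpen_biUnion fun j _ => (Limits.Sigma.ι S.C j).opensRange.isOpen

instance isFinite_ν (i : Fin r) : IsFinite (S.ν i) := by
  rw [← Limits.Sigma.ι_desc S.ν i]
  infer_instance

instance finite_fibre (x : S.X) : Finite (S.Fibre x) := by
  have hfin := (Limits.Sigma.desc S.ν).finite_preimage_singleton x
  have := hfin.to_subtype
  refine Finite.of_injective (β := (Limits.Sigma.desc S.ν ⁻¹' {x} : Set _))
    (fun p => ⟨Limits.Sigma.ι S.C p.1.1 p.1.2, by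
      rw [Set.mem_preimage, S.desc_ι_apply]; exact p.2⟩) fun p p' h => ?_
  exact Subtype.ext ((sigmaι_eq_iff S.C _ _ _ _).mp (congrArg Subtype.val h))

/-- The fibre of a finite morphism over a closed point is closed and discrete. -/
theorem isClosed_of_isClosed_ν {i : Fin r} {p : S.C i} (h : IsClosed ({S.ν i p} : Set S.X)) :
    IsClosed ({p} : Set (S.C i)) := by
  have hF : IsClosed (S.ν i ⁻¹' {S.ν i p}) := h.preimage (S.ν i).continuous
  have hd := (S.ν i).isDiscrete_preimage_singleton (S.ν i p)
  have hp : p ∈ S.ν i ⁻¹' {S.ν i p} := rfl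
  have := hd.to_subtype
  have h1 : IsClosed ({⟨p, hp⟩} : Set (S.ν i ⁻¹' {S.ν i p})) := isClosed_discrete _
  have h2 := (hF.isClosedEmbedding_subtypeVal.isClosed_iff_image_isClosed).mp h1
  rwa [Set.image_singleton] at h2

theorem isClosed_branch (b : S.Branch) : IsClosed ({b.1.2} : Set (S.C b.1.1)) :=
  S.isClosed_of_isClosed_ν (by rw [b.2]; exact S.isClosed_q)

theorem constToStalk_eq {Y : Scheme.{u}} (f : Y ⟶ Spec (CommRingCat.of k)) (y : Y) :
    constToStalk f y = (f.stalkMap y).hom.comp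
      ((Scheme.ΓSpecIso (CommRingCat.of k)).inv ≫
        (Spec (CommRingCat.of k)).presheaf.germ ⊤ (f y) (TopologicalSpace.Opens.mem_top _)).hom := by
  rw [constToStalk, ← CommRingCat.hom_comp]
  congr 1
  rw [Category.assoc, Scheme.Hom.germ_stalkMap]
  rfl

theorem essFiniteType_toStalk (A : CommRingCat.{u}) (z : PrimeSpectrum A) :
    ((Scheme.ΓSpecIso A).inv ≫ (Spec A).presheaf.germ ⊤ z
      (TopologicalSpace.Opens.mem_top _)).hom.EssFiniteType := by
  have h : (algebraMap A ((Spec.structureSheaf A).presheaf.stalk z)).EssFiniteType :=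
    RingHom.EssFiniteType.holdsForLocalization _ z.asIdeal.primeCompl
  exact h

instance essFiniteType (i : Fin r) (p : S.C i) : Algebra.EssFiniteType k (S.O i p) := by
  rw [← RingHom.essFiniteType_algebraMap]
  change (constToStalk (S.ν i ≫ S.str) p).EssFiniteType
  rw [constToStalk_eq]
  refine RingHom.EssFiniteType.comp ?_ (LocallyOfFiniteType.stalkMap _ p)
  exact essFiniteType_toStalk _ _

theorem fromSpecStalk_comp {Y : Scheme.{u}} (f : Y ⟶ Spec (CommRingCat.of k)) (y : Y) :
    Y.fromSpecStalk y ≫ f = Spec.map (CommRingCat.ofHom (constToStalk f y)) := by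
  have h1 : f = Y.toSpecΓ ≫ Spec.map ((Scheme.ΓSpecIso (CommRingCat.of k)).inv ≫ f.appTop) := by
    rw [Spec.map_comp, ← Scheme.toSpecΓ_naturality_assoc]
    simp
  conv_lhs => rw [h1]
  rw [Scheme.fromSpecStalk_toSpecΓ_assoc, ← Spec.map_comp]
  congr 1

/-- At a closed point of a scheme of finite type over an algebraically closed field, every function
is constant up to a function vanishing there. -/
theorem exists_sub_constToStalk_mem [IsAlgClosed k] {Y : Scheme.{u}}
    (f : Y ⟶ Spec (CommRingCat.of k)) [LocallyOfFiniteType f] {y : Y} (hy : IsClosed ({y} : Set Y))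
    (g : Y.presheaf.stalk y) :
    ∃ c : k, g - constToStalk f y c ∈ IsLocalRing.maximalIdeal (Y.presheaf.stalk y) := by
  have hs : Function.Surjective ((Y.residue y).hom.comp (constToStalk f y)) := by
    have h1 : CommRingCat.ofHom ((Y.residue y).hom.comp (constToStalk f y)) =
        (residueFieldIsoBase f y hy).inv := by
      refine Spec.map_injective ?_
      rw [SpecMap_residueFieldIsoBase_inv, CommRingCat.ofHom_comp, Spec.map_comp,
        ← fromSpecStalk_comp, Scheme.fromSpecResidueField, Category.assoc]
      rfl
    have h2 : Function.Bijective
        (CommRingCat.ofHom ((Y.residue y).hom.comp (constToStalk f y))) := by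
      rw [h1]
      exact ConcreteCategory.bijective_of_isIso _
    exact h2.surjective
  obtain ⟨c, hc⟩ := hs (Y.residue y g)
  refine ⟨c, ?_⟩
  rw [← IsLocalRing.residue_eq_zero_iff, map_sub, sub_eq_zero]
  exact hc.symm

end CurveWithNormalisation

/-- Simultaneous approximation at finitely many points of an affine nonsingular curve. -/
theorem IsLocalization.AtPrime.exists_approx {A K : Type*} [CommRing A] [IsDomain A] [Field K]
    [Algebra A K] [IsFractionRing A K] {J : Type*} [Finite J] {P : J → Ideal A}
    [∀ j, (P j).IsPrime] (hmax : ∀ j, (P j).IsMaximal) (hinj : Function.Injective P)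
    {O : J → Type*} [∀ j, CommRing (O j)] [∀ j, IsDomain (O j)]
    [∀ j, IsDiscreteValuationRing (O j)] [∀ j, Algebra A (O j)]
    [∀ j, IsLocalization.AtPrime (O j) (P j)] [∀ j, Algebra (O j) K]
    [∀ j, IsScalarTower A (O j) K] (G : J → K) (N : ℕ) :
    ∃ g : K, ∀ j, ∃ y ∈ IsLocalRing.maximalIdeal (O j) ^ N, algebraMap (O j) K y = g - G j := by
  classical
  obtain ⟨s, hs⟩ := IsLocalization.exist_integer_multiples_of_finite (nonZeroDivisors A) G
  choose x hx using hs
  have hs0 : (s : A) ≠ 0 := nonZeroDivisors.ne_zero s.2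
  have hsK : algebraMap A K s ≠ 0 := IsFractionRing.to_map_ne_zero_of_mem_nonZeroDivisors s.2
  choose t ht using fun j => IsDiscreteValuationRing.exists_irreducible (O j)
  have hinjO : ∀ j, Function.Injective (algebraMap A (O j)) := fun j a b hab => by
    refine IsFractionRing.injective A K ?_
    rw [IsScalarTower.algebraMap_apply A (O j) K, hab, ← IsScalarTower.algebraMap_apply]
  have hsO : ∀ j, ∃ n : ℕ, ∃ u : (O j)ˣ, algebraMap A (O j) s = u * t j ^ n := fun j => by
    refine IsDiscreteValuationRing.eq_unit_mul_pow_irreducible ?_ (ht j)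
    exact fun h => hs0 (hinjO j (h.trans (map_zero _).symm))
  choose n u hu using hsO
  have := Fintype.ofFinite J
  have hn : ∀ j, n j ≤ ∑ j, n j := fun j =>
    Finset.single_le_sum (fun _ _ => Nat.zero_le _) (Finset.mem_univ j)
  -- With `s` a common denominator, `G j = x j / s`. Approximating the numerators to the extra order
  -- `∑ n j` makes up for the division by `s`, which has order `n j` at `j`.
  set N' := N + ∑ j, n j with hN'
  have hcop : Pairwise fun i j => IsCoprime (P i ^ N') (P j ^ N') := fun i j hij =>
    IsCoprime.pow (Ideal.isCoprime_of_isMaximal (hinj.ne hij))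
  obtain ⟨a, ha⟩ := Ideal.quotientInfToPiQuotient_surj hcop fun j => Ideal.Quotient.mk _ (x j)
  obtain ⟨a, rfl⟩ := Ideal.Quotient.mk_surjective a
  have ha' : ∀ j, a - x j ∈ P j ^ N' := fun j => by
    rw [← Ideal.Quotient.eq]
    exact congrFun ha j
  refine ⟨algebraMap A K a / algebraMap A K s, fun j => ?_⟩
  have hmem : algebraMap A (O j) (a - x j) ∈ IsLocalRing.maximalIdeal (O j) ^ N' := by
    have := Ideal.mem_map_of_mem (algebraMap A (O j)) (ha' j)
    rwa [Ideal.map_pow, IsLocalization.AtPrime.map_eq_maximalIdeal (P j) (O j)] at this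
  rw [(ht j).maximalIdeal_eq, Ideal.span_singleton_pow, Ideal.mem_span_singleton] at hmem
  obtain ⟨z, hz⟩ := hmem
  obtain ⟨d, hd⟩ := Nat.exists_eq_add_of_le (show n j ≤ N' by have := hn j; omega)
  refine ⟨t j ^ d * ((u j)⁻¹ : (O j)ˣ) * z, ?_, ?_⟩
  · rw [(ht j).maximalIdeal_eq, Ideal.span_singleton_pow, Ideal.mem_span_singleton, mul_assoc]
    exact Dvd.dvd.mul_right (pow_dvd_pow _ (by have := hn j; omega)) _
  · have h1 : algebraMap A K a / algebraMap A K s - G j =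
        algebraMap (O j) K (algebraMap A (O j) (a - x j)) / algebraMap A K s := by
      rw [← IsScalarTower.algebraMap_apply, map_sub, sub_div, hx j]
      congr 1
      rw [eq_div_iff hsK, mul_comm]
      exact (Algebra.smul_def _ _).symm
    rw [h1, eq_div_iff hsK, hz, IsScalarTower.algebraMap_apply A (O j) K, hu j, ← map_mul]
    congr 1
    rw [hd, pow_add]
    have := (u j).inv_mul
    linear_combination t j ^ d * z * t j ^ n j * this

/-! ### The normalisation as an isomorphism away from the singular point -/

namespace AlgebraicGeometry.Scheme.Hom

variable {Y X : Scheme.{u}} {f : Y ⟶ X} {U : X.Opens}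

theorem isIso_stalkMap_of_isIso_restrict (hf : IsIso (f ∣_ U)) {y : Y} (hy : f y ∈ U) :
    IsIso (f.stalkMap y) := by
  have h : ∀ z : ((f ⁻¹ᵁ U : Y.Opens) : Scheme.{u}), IsIso ((f ∣_ U).stalkMap z) :=
    fun z => inferInstance
  exact ((MorphismProperty.isomorphisms CommRingCat).arrow_mk_iso_iff
    (morphismRestrictStalkMap f U ⟨y, hy⟩)).mp (h ⟨y, hy⟩)

theorem exists_eq_of_isIso_restrict (hf : IsIso (f ∣_ U)) {x : X} (hx : x ∈ U) :
    ∃ y, f y = x := by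
  obtain ⟨z, hz⟩ := (f ∣_ U).homeomorph.surjective ⟨x, hx⟩
  exact ⟨z.1, by
    rw [← morphismRestrict_base_coe (U := U) (x := z)]
    exact congrArg Subtype.val hz⟩

theorem eq_of_isIso_restrict (hf : IsIso (f ∣_ U)) {y y' : Y} (h : f y = f y') (hy : f y ∈ U) :
    y = y' := by
  have key : ∀ z z' : ((f ⁻¹ᵁ U : Y.Opens) : Scheme.{u}), f z.1 = f z'.1 → z = z' := by
    intro z z' h
    refine (f ∣_ U).homeomorph.injective (Subtype.ext ?_)
    change ((f ∣_ U) z).1 = ((f ∣_ U) z').1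
    rw [morphismRestrict_base_coe, morphismRestrict_base_coe, h]
  exact congrArg Subtype.val (key ⟨y, hy⟩ ⟨y', show f y' ∈ U from h ▸ hy⟩ h)

end AlgebraicGeometry.Scheme.Hom

namespace CurveWithNormalisation

variable {k : Type u} [Field k] {r : ℕ} (S : CurveWithNormalisation k r)

theorem pull_eq_algebraMap (i : Fin r) (p : S.C i) (h : ∃ p', S.ν i p' = S.ν i p)
    (f : S.X.presheaf.stalk (S.ν i p)) :
    S.pull i (S.ν i p) h f = algebraMap (S.O i p) (S.K i) ((S.ν i).stalkMap p f) := by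
  change _ = ((S.C i).presheaf.stalkSpecializes _) ((S.ν i).stalkMap p f)
  rw [← ConcreteCategory.comp_apply, ← Scheme.Hom.stalkSpecializes_stalkMap]
  rfl

instance isIso_restrict :
    IsIso (Limits.Sigma.desc S.ν ∣_ ⟨{S.q}ᶜ, S.isClosed_q.isOpen_compl⟩) := S.isIso_compl

theorem isIso_stalkMap {i : Fin r} {p : S.C i} (hp : S.ν i p ≠ S.q) :
    IsIso ((S.ν i).stalkMap p) := by
  have key : ∀ g : S.C i ⟶ S.X, g = Limits.Sigma.ι S.C i ≫ Limits.Sigma.desc S.ν → g p ≠ S.q →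
      IsIso (g.stalkMap p) := by
    rintro _ rfl hq
    rw [Scheme.Hom.stalkMap_comp]
    have h1 := Scheme.Hom.isIso_stalkMap_of_isIso_restrict S.isIso_restrict
      (y := Limits.Sigma.ι S.C i p) hq
    have h2 : IsIso ((Limits.Sigma.ι S.C i).stalkMap p) := inferInstance
    exact @IsIso.comp_isIso _ _ _ _ _ _ _ h1 h2
  exact key _ (Limits.Sigma.ι_desc S.ν i).symm hp

/-- The pullback of functions near `x` to functions near a point `p` over `x`. -/
theorem exists_stalkMap {i : Fin r} {x : S.X} {p : S.C i} (hp : S.ν i p = x)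
    (h : ∃ p, S.ν i p = x) :
    ∃ φ : S.X.presheaf.stalk x →+* S.O i p, IsLocalHom φ ∧
      (∀ f, S.pull i x h f = algebraMap (S.O i p) (S.K i) (φ f)) ∧
      (x ≠ S.q → Function.Bijective φ) := by
  subst hp
  refine ⟨((S.ν i).stalkMap p).hom, inferInstance, S.pull_eq_algebraMap i p h, fun hq => ?_⟩
  have := S.isIso_stalkMap hq
  exact ConcreteCategory.bijective_of_isIso ((S.ν i).stalkMap p)

theorem pull_germ (i : Fin r) {x : S.X} (h : ∃ p, S.ν i p = x) {W : S.X.Opens} (hx : x ∈ W)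
    (hg : S.ν i (genericPoint (S.C i)) ∈ W) (s : Γ(S.X, W)) :
    S.pull i x h (S.X.presheaf.germ W x hx s) =
      (S.ν i).stalkMap (genericPoint (S.C i)) (S.X.presheaf.germ W _ hg s) := by
  rw [pull, RingHom.comp_apply]
  congr 1
  rw [← ConcreteCategory.comp_apply, TopCat.Presheaf.germ_stalkSpecializes]

theorem generic_mem {i : Fin r} {x : S.X} (h : ∃ p, S.ν i p = x) {W : S.X.Opens} (hx : x ∈ W) :
    S.ν i (genericPoint (S.C i)) ∈ W := by
  obtain ⟨p, rfl⟩ := h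
  exact (((genericPoint_spec (S.C i)).specializes trivial).map (S.ν i).continuous).mem_open
    W.isOpen hx

theorem existsUnique_over {x : S.X} (hx : x ≠ S.q) : ∃! p : Σ i, S.C i, S.ν p.1 p.2 = x := by
  obtain ⟨z, hz⟩ := Scheme.Hom.exists_eq_of_isIso_restrict S.isIso_restrict (x := x) hx
  obtain ⟨i, p, rfl⟩ := S.exists_sigmaι_eq z
  refine ⟨⟨i, p⟩, by rw [← hz, S.desc_ι_apply], fun p' hp' => ?_⟩
  have h2 : Limits.Sigma.desc S.ν (Limits.Sigma.ι S.C p'.1 p'.2) = x := by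
    rw [S.desc_ι_apply]; exact hp'
  exact (sigmaι_eq_iff S.C _ _ _ _).mp
    (Scheme.Hom.eq_of_isIso_restrict S.isIso_restrict (h2.trans hz.symm) (h2 ▸ hx))

/-- A function is determined by its pullbacks to the components of the normalisation. -/
theorem eq_zero_of_pull_eq_zero {x : S.X} {f : S.X.presheaf.stalk x}
    (hf : ∀ i h, S.pull i x h f = 0) : f = 0 := by
  obtain ⟨W, hxW, s, rfl⟩ := S.X.presheaf.exists_germ_eq f
  -- Components not passing through `x` give no condition on `f`; they are removed by shrinking the
  -- neighbourhood.
  let Z : Set S.X := ⋃ i ∈ {i : Fin r | ¬ ∃ p, S.ν i p = x}, Set.range (S.ν i)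
  have hZ : IsClosed Z := Set.Finite.isClosed_biUnion (Set.toFinite _) fun i _ =>
    (S.ν i).isClosedMap.isClosed_range
  have hxZ : x ∉ Z := by
    intro hxZ
    obtain ⟨i, hi, hxi⟩ := Set.mem_iUnion₂.mp hxZ
    exact hi hxi
  let W' : S.X.Opens := W ⊓ ⟨Zᶜ, hZ.isOpen_compl⟩
  have hW' : W' ≤ W := inf_le_left
  have hx' : x ∈ W' := ⟨hxW, hxZ⟩
  suffices h0 : S.X.presheaf.map (homOfLE hW').op s = 0 by
    rw [← S.X.presheaf.germ_res_apply (homOfLE hW') x hx', h0, map_zero]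
  -- On a reduced scheme a section vanishes once it is nowhere invertible. If it were invertible
  -- somewhere, then also at some `y ≠ q` by density, hence in the function field of the component
  -- through `y`, where it pulls back to zero.
  rw [← AlgebraicGeometry.basicOpen_eq_bot_iff, eq_bot_iff]
  intro y hy
  exfalso
  obtain ⟨y, hy, hyq⟩ := S.dense_compl.inter_open_nonempty _
    (S.X.basicOpen (S.X.presheaf.map (homOfLE hW').op s)).isOpen ⟨y, hy⟩
  obtain ⟨⟨i, p⟩, hp : S.ν i p = y, -⟩ := S.existsUnique_over hyq
  have hyW' : y ∈ W' := S.X.basicOpen_le _ hy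
  have hi : ∃ p, S.ν i p = x := by
    by_contra hi
    exact hyW'.2 (Set.mem_biUnion (Set.mem_ofPred_eq.mpr hi) ⟨p, hp⟩)
  have hu := (Scheme.mem_basicOpen _ _ y hyW').mp hy
  have hgen := S.generic_mem ⟨p, hp⟩ hyW'
  have h1 := hu.map (S.pull i y ⟨p, hp⟩)
  rw [S.pull_germ i ⟨p, hp⟩ hyW' hgen, TopCat.Presheaf.germ_res_apply, ← S.pull_germ i hi hxW,
    hf i hi] at h1
  exact not_isUnit_zero h1

end CurveWithNormalisation

/-! ### Laurent expansions of functions and differentials at closed points -/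

section

open LaurentSeries
open KaehlerDifferential (D)

theorem AlgebraicGeometry.IsAffineOpen.exists_approx {Y : Scheme.{u}} [IsIntegral Y]
    {V : Y.Opens} (hV : IsAffineOpen V) {J : Type*} [Finite J] {x : J → Y} (hx : ∀ j, x j ∈ V)
    (hinj : Function.Injective x) (hc : ∀ j, IsClosed ({x j} : Set Y))
    (hdvr : ∀ j, IsDiscreteValuationRing (Y.presheaf.stalk (x j)))
    (G : J → Y.functionField) (N : ℕ) :
    ∃ g : Y.functionField, ∀ j, ∃ y ∈ IsLocalRing.maximalIdeal (Y.presheaf.stalk (x j)) ^ N,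
      algebraMap (Y.presheaf.stalk (x j)) Y.functionField y = g - G j := by
  rcases isEmpty_or_nonempty J with hJ | ⟨⟨j₀⟩⟩
  · exact ⟨0, fun j => isEmptyElim j⟩
  have : Nonempty V := ⟨⟨_, hx j₀⟩⟩
  have := functionField_isFractionRing_of_isAffineOpen Y V hV
  let _alg : ∀ j, Algebra Γ(Y, V) (Y.presheaf.stalk (x j)) := fun j =>
    Y.presheaf.algebra_section_stalk (⟨x j, hx j⟩ : V)
  have hloc : ∀ j, IsLocalization.AtPrime (Y.presheaf.stalk (x j))
      (hV.primeIdealOf ⟨x j, hx j⟩).asIdeal := fun j => hV.isLocalization_stalk ⟨x j, hx j⟩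
  have hst : ∀ j, IsScalarTower Γ(Y, V) (Y.presheaf.stalk (x j)) Y.functionField := fun j =>
    functionField_isScalarTower Y V ⟨x j, hx j⟩
  refine IsLocalization.AtPrime.exists_approx (A := Γ(Y, V))
    (P := fun j => (hV.primeIdealOf ⟨x j, hx j⟩).asIdeal)
    (O := fun j => Y.presheaf.stalk (x j))
    (fun j => hV.primeIdealOf_isMaximal_of_isClosed _ (hc j)) (fun i j hij => hinj ?_) G N
  have h := congrArg hV.fromSpec (PrimeSpectrum.ext hij)
  rwa [hV.fromSpec_primeIdealOf, hV.fromSpec_primeIdealOf] at h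

namespace IsDiscreteValuationRing

variable {k O K : Type u} [Field k] [CommRing O] [Field K] [Algebra O K] [Algebra k K] {t : O}
  {φ : K →ₐ[k] LaurentSeries k}

theorem expansion_zpow (hφt : φ (algebraMap O K t) = HahnSeries.single 1 1) (n : ℤ) :
    φ (algebraMap O K t ^ n) = HahnSeries.single n 1 := by
  have h0 : (HahnSeries.single 1 1 : LaurentSeries k) ≠ 0 :=
    mt HahnSeries.single_eq_zero_iff.mp one_ne_zero
  rw [map_zpow₀, hφt]
  induction n using Int.induction_on with
  | zero => rw [zpow_zero]; rfl
  | succ n ih => rw [zpow_add_one₀ h0, ih, HahnSeries.single_mul_single, one_mul]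
  | pred n ih =>
    rw [zpow_sub_one₀ h0, ih, mul_inv_eq_iff_eq_mul₀ h0, HahnSeries.single_mul_single, one_mul,
      sub_add_cancel]

theorem exists_sub_expansion_mem (hφt : φ (algebraMap O K t) = HahnSeries.single 1 1)
    (f : LaurentSeries k) (N : ℕ) : ∃ x, φ x - f ∈ vanishing k N := by
  obtain ⟨n, hn⟩ := f.exists_mem_vanishing
  refine ⟨∑ j ∈ Finset.Ico (-n : ℤ) N, f.coeff j • algebraMap O K t ^ j, fun j hj => ?_⟩
  rw [map_sum, HahnSeries.coeff_sub, HahnSeries.coeff_sum]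
  have h1 : ∀ i ∈ Finset.Ico (-n : ℤ) N, (φ (f.coeff i • algebraMap O K t ^ i)).coeff j =
      if j = i then f.coeff j else 0 := fun i _ => by
    rw [map_smul, expansion_zpow hφt, HahnSeries.coeff_smul, HahnSeries.coeff_single]
    split_ifs with h
    · rw [h, smul_eq_mul, mul_one]
    · rw [smul_zero]
  rw [Finset.sum_congr rfl h1, Finset.sum_ite_eq, sub_eq_zero]
  split_ifs with h
  · rfl
  · rw [hn j]
    rw [Finset.mem_Ico] at h
    omega

variable [IsDomain O] [IsDiscreteValuationRing O]

theorem exists_mem_maximalIdeal_pow_iff (ht : Irreducible t)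
    (hφt : φ (algebraMap O K t) = HahnSeries.single 1 1)
    (hφ : ∀ x, (∃ y, algebraMap O K y = x) ↔ φ x ∈ vanishing k 0) (n : ℕ) (x : K) :
    (∃ y ∈ IsLocalRing.maximalIdeal O ^ n, algebraMap O K y = x) ↔ φ x ∈ vanishing k n := by
  have htK : algebraMap O K t ≠ 0 := fun h => by
    rw [h, map_zero] at hφt
    exact one_ne_zero (HahnSeries.single_eq_zero_iff.mp hφt.symm)
  constructor
  · rintro ⟨y, hy, rfl⟩
    rw [ht.maximalIdeal_eq, Ideal.span_singleton_pow, Ideal.mem_span_singleton] at hy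
    obtain ⟨z, rfl⟩ := hy
    rw [map_mul, map_mul, map_pow, ← zpow_natCast, expansion_zpow hφt]
    exact mul_mem_vanishing_of_eq (single_mem_vanishing le_rfl 1) ((hφ _).mp ⟨z, rfl⟩) (by simp)
  · intro h
    obtain ⟨z, hz⟩ := (hφ (algebraMap O K t ^ (-n : ℤ) * x)).mpr (by
      rw [map_mul, expansion_zpow hφt]
      exact mul_mem_vanishing_of_eq (single_mem_vanishing le_rfl 1) h (by simp))
    refine ⟨t ^ n * z, ?_, ?_⟩
    · rw [ht.maximalIdeal_eq, Ideal.span_singleton_pow, Ideal.mem_span_singleton]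
      exact dvd_mul_right _ _
    · rw [map_mul, hz, map_pow, zpow_neg, zpow_natCast, mul_inv_cancel_left₀ (pow_ne_zero _ htK)]

end IsDiscreteValuationRing

namespace CurveWithNormalisation

variable {k : Type u} [Field k] {r : ℕ} (S : CurveWithNormalisation k r)

theorem irreducible_uniformiser {i : Fin r} {p : S.C i} (hp : IsClosed ({p} : Set (S.C i))) :
    Irreducible (S.uniformiser i p) := by
  have := S.isDVR i p hp
  exact Classical.epsilon_spec (IsDiscreteValuationRing.exists_irreducible (S.O i p))

theorem mem_maxPow {i : Fin r} {p : S.C i} {n : ℕ} {x : S.K i} : x ∈ S.maxPow i p n ↔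
    ∃ y ∈ IsLocalRing.maximalIdeal (S.O i p) ^ n, algebraMap (S.O i p) (S.K i) y = x := Iff.rfl

instance locallyOfFiniteType_str (i : Fin r) : LocallyOfFiniteType (S.ν i ≫ S.str) :=
  inferInstance

/-- Rational functions with prescribed beginnings of the expansions at the branches. -/
theorem exists_sub_mem_maxPow (G : ∀ b : S.Branch, S.K b.1.1) (N : ℕ) :
    ∃ g : S.Rat, ∀ b : S.Branch, g b.1.1 - G b ∈ S.maxPow b.1.1 b.1.2 N := by
  -- An affine neighbourhood of `q` has affine preimage in each component, since `ν` is finite; so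
  -- all points over `q` on a component lie in one affine open set.
  obtain ⟨_, ⟨U, hU, rfl⟩, hqU, -⟩ :=
    S.X.isBasis_affineOpens.exists_subset_of_mem_open (Set.mem_univ S.q) isOpen_univ
  have h : ∀ i, ∃ g : S.K i, ∀ j : {p : S.C i // S.ν i p = S.q},
      g - G ⟨⟨i, j.1⟩, j.2⟩ ∈ S.maxPow i j.1 N := fun i => by
    have hfin : Finite {p : S.C i // S.ν i p = S.q} :=
      Finite.of_injective (β := S.Branch) (fun j => ⟨⟨i, j.1⟩, j.2⟩) fun a b hab => by
        simpa [Subtype.ext_iff] using hab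
    have hc : ∀ j : {p : S.C i // S.ν i p = S.q}, IsClosed ({j.1} : Set (S.C i)) := fun j =>
      S.isClosed_branch ⟨⟨i, j.1⟩, j.2⟩
    exact (hU.preimage (S.ν i)).exists_approx (x := fun j : {p : S.C i // S.ν i p = S.q} => j.1)
      (fun j => show S.ν i j.1 ∈ U from j.2.symm ▸ hqU) Subtype.val_injective hc
      (fun j => S.isDVR i j.1 (hc j)) (fun j => G ⟨⟨i, j.1⟩, j.2⟩) N
  choose g hg using h
  exact ⟨g, fun b => hg b.1.1 ⟨b.1.2, b.2⟩⟩

variable [IsAlgClosed k]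

theorem exists_sub_algebraMap_mem {i : Fin r} {p : S.C i} (hp : IsClosed ({p} : Set (S.C i)))
    (x : S.O i p) : ∃ c : k, x - algebraMap k (S.O i p) c ∈ IsLocalRing.maximalIdeal (S.O i p) :=
  exists_sub_constToStalk_mem (S.ν i ≫ S.str) hp x

theorem exists_expansion {i : Fin r} {p : S.C i} (hp : IsClosed ({p} : Set (S.C i))) :
    ∃ φ : S.K i →ₐ[k] LaurentSeries k, φ (S.localParam i p) = HahnSeries.single 1 1 ∧
      ∀ x, (∃ y, algebraMap (S.O i p) (S.K i) y = x) ↔ φ x ∈ vanishing k 0 := by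
  have := S.isDVR i p hp
  exact IsDiscreteValuationRing.exists_laurentSeries_hom (S.exists_sub_algebraMap_mem hp)
    (S.irreducible_uniformiser hp)

/-- The Laurent expansion of rational functions at a closed point. -/
noncomputable def expansion {i : Fin r} {p : S.C i} (hp : IsClosed ({p} : Set (S.C i))) :
    S.K i →ₐ[k] LaurentSeries k :=
  (S.exists_expansion hp).choose

section

variable {i : Fin r} {p : S.C i} (hp : IsClosed ({p} : Set (S.C i)))

theorem expansion_localParam_zpow (n : ℤ) :
    S.expansion hp (S.localParam i p ^ n) = HahnSeries.single n 1 := by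
  have := S.isDVR i p hp
  exact IsDiscreteValuationRing.expansion_zpow (S.exists_expansion hp).choose_spec.1 n

theorem exists_algebraMap_eq_iff (x : S.K i) :
    (∃ y, algebraMap (S.O i p) (S.K i) y = x) ↔ S.expansion hp x ∈ vanishing k 0 :=
  (S.exists_expansion hp).choose_spec.2 x

theorem mem_maxPow_iff (n : ℕ) (x : S.K i) :
    x ∈ S.maxPow i p n ↔ S.expansion hp x ∈ vanishing k n := by
  have := S.isDVR i p hp
  exact IsDiscreteValuationRing.exists_mem_maximalIdeal_pow_iff (S.irreducible_uniformiser hp)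
    (S.exists_expansion hp).choose_spec.1 (S.exists_expansion hp).choose_spec.2 n x

theorem exists_sub_expansion_mem (f : LaurentSeries k) (N : ℕ) :
    ∃ x, S.expansion hp x - f ∈ vanishing k N := by
  have := S.isDVR i p hp
  exact IsDiscreteValuationRing.exists_sub_expansion_mem (S.exists_expansion hp).choose_spec.1 f N

include hp in
theorem D_localParam_ne_zero : D k (S.K i) (S.localParam i p) ≠ 0 := by
  have := S.isDVR i p hp
  exact IsDiscreteValuationRing.D_ne_zero (S.exists_sub_algebraMap_mem hp)
    (S.irreducible_uniformiser hp)

/-- The coefficient of a rational differential with respect to the differential of a uniformiser. -/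
noncomputable def diffCoeff : Ω[S.K i⁄k] ≃ₗ[S.K i] S.K i :=
  (LinearEquiv.ofBijective (LinearMap.toSpanSingleton (S.K i) _ (D k (S.K i) (S.localParam i p)))
    ⟨smul_left_injective _ (S.D_localParam_ne_zero hp), fun η => by
      have := S.isDVR i p hp
      obtain ⟨g, hg⟩ := IsDiscreteValuationRing.exists_eq_smul_D (S.exists_sub_algebraMap_mem hp)
        (S.irreducible_uniformiser hp) η
      exact ⟨g, hg.symm⟩⟩).symm

theorem diffCoeff_smul_D (g : S.K i) :
    S.diffCoeff hp (g • D k (S.K i) (S.localParam i p)) = g := by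
  rw [diffCoeff, LinearEquiv.symm_apply_eq]
  rfl

theorem diffCoeff_smul_D_self (η : Ω[S.K i⁄k]) :
    S.diffCoeff hp η • D k (S.K i) (S.localParam i p) = η := by
  apply (S.diffCoeff hp).injective
  rw [diffCoeff_smul_D]

/-- The Laurent expansion of rational differentials at a closed point. -/
noncomputable def diffExpansion : Ω[S.K i⁄k] →+ LaurentSeries k :=
  (S.expansion hp : S.K i →+ LaurentSeries k).comp
    (S.diffCoeff hp : Ω[S.K i⁄k] →+ S.K i)

theorem diffExpansion_apply (η : Ω[S.K i⁄k]) :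
    S.diffExpansion hp η = S.expansion hp (S.diffCoeff hp η) := rfl

theorem diffExpansion_smul (g : S.K i) (η : Ω[S.K i⁄k]) :
    S.diffExpansion hp (g • η) = S.expansion hp g * S.diffExpansion hp η := by
  rw [diffExpansion_apply, map_smul, smul_eq_mul, map_mul, diffExpansion_apply]

theorem diffExpansion_eq_zero_iff {η : Ω[S.K i⁄k]} : S.diffExpansion hp η = 0 ↔ η = 0 := by
  rw [diffExpansion_apply, map_eq_zero, LinearEquiv.map_eq_zero_iff]

theorem mem_regularDiff_iff (η : Ω[S.K i⁄k]) :
    η ∈ S.regularDiff i p ↔ S.diffExpansion hp η ∈ vanishing k 0 := by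
  have := S.isDVR i p hp
  rw [diffExpansion_apply, ← S.exists_algebraMap_eq_iff hp,
    ← IsDiscreteValuationRing.smul_D_mem_span_iff (S.exists_sub_algebraMap_mem hp)
      (S.irreducible_uniformiser hp)]
  exact Eq.to_iff (congrArg (· ∈ S.regularDiff i p) (S.diffCoeff_smul_D_self hp η).symm)

theorem mem_twistedDiff_iff (n : ℕ) (η : Ω[S.K i⁄k]) :
    η ∈ S.twistedDiff i p n ↔ S.diffExpansion hp η ∈ vanishing k (-n) := by
  have := S.isDVR i p hp
  change (∀ a ∈ IsLocalRing.maximalIdeal (S.O i p) ^ n, a • η ∈ S.regularDiff i p) ↔ _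
  have key : ∀ a : S.O i p, a • η ∈ S.regularDiff i p ↔
      S.expansion hp (algebraMap _ (S.K i) a) * S.diffExpansion hp η ∈ vanishing k 0 := fun a => by
    rw [← algebraMap_smul (S.K i) a, S.mem_regularDiff_iff hp, diffExpansion_smul]
  constructor
  · intro h
    have h1 := (key _).mp (h (S.uniformiser i p ^ n)
      (Ideal.pow_mem_pow ((IsLocalRing.mem_maximalIdeal _).mpr
        (S.irreducible_uniformiser hp).not_isUnit) n))
    have h2 : S.expansion hp (algebraMap _ (S.K i) (S.uniformiser i p ^ n)) =
        HahnSeries.single (n : ℤ) 1 := by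
      rw [map_pow, ← zpow_natCast]
      exact S.expansion_localParam_zpow hp n
    rw [h2] at h1
    intro j hj
    have := h1 (j + n) (by omega)
    rwa [coeff_single_mul', one_mul, add_sub_cancel_right] at this
  · intro h a ha
    rw [key]
    exact mul_mem_vanishing_of_eq ((S.mem_maxPow_iff hp n _).mp ⟨a, ha, rfl⟩) h (by omega)

theorem diffExpansion_smul_const (c : k) (η : Ω[S.K i⁄k]) :
    S.diffExpansion hp (c • η) = c • S.diffExpansion hp η := by
  rw [← algebraMap_smul (S.K i) c, diffExpansion_smul, AlgHom.commutes, Algebra.smul_def]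

/-- The defining presentation lists the principal part of `η`, so its entry of index `0` must be the
coefficient of degree `-1`. This makes the residue unique, and truncating the expansion shows that
it exists. -/
theorem hasResidue_iff (η : Ω[S.K i⁄k]) (c : k) :
    S.HasResidue i p η c ↔ (S.diffExpansion hp η).coeff (-1) = c := by
  have key : ∀ (N : ℕ) (a : ℕ → k), η - ∑ n ∈ Finset.range (N + 1),
      a n • ((S.localParam i p)⁻¹ ^ (n + 1) • D k (S.K i) (S.localParam i p)) ∈
        S.regularDiff i p ↔ S.diffExpansion hp η - ∑ n ∈ Finset.range (N + 1),
          HahnSeries.single (-(n + 1) : ℤ) (a n) ∈ vanishing k 0 := fun N a => by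
    rw [S.mem_regularDiff_iff hp, map_sub, map_sum]
    have h1 : ∀ n, S.diffExpansion hp (a n • ((S.localParam i p)⁻¹ ^ (n + 1) •
        D k (S.K i) (S.localParam i p))) = HahnSeries.single (-(n + 1) : ℤ) (a n) := fun n => by
      rw [diffExpansion_smul_const, diffExpansion_apply, diffCoeff_smul_D, inv_pow,
        ← zpow_natCast, ← zpow_neg, expansion_localParam_zpow]
      push_cast
      ext j
      rw [HahnSeries.coeff_smul, HahnSeries.coeff_single, HahnSeries.coeff_single]
      split_ifs <;> simp
    simp only [h1]
  constructor
  · rintro ⟨N, a, rfl, h⟩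
    have h1 := (key N a).mp h (-1) (by norm_num)
    rw [HahnSeries.coeff_sub, HahnSeries.coeff_sum, Finset.sum_eq_single 0, sub_eq_zero] at h1
    · rw [h1]; simp
    · intro n _ hn
      rw [HahnSeries.coeff_single_of_ne (by omega)]
    · simp
  · rintro rfl
    obtain ⟨N, hN⟩ := (S.diffExpansion hp η).exists_mem_vanishing
    refine ⟨N, fun n => (S.diffExpansion hp η).coeff (-(n + 1)), by simp, (key N _).mpr ?_⟩
    intro j hj
    rw [HahnSeries.coeff_sub, HahnSeries.coeff_sum, sub_eq_zero]
    by_cases hjN : j < -N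
    · rw [hN j hjN]
      refine (Finset.sum_eq_zero fun n hn => ?_).symm
      by_cases hjn : j = -(n + 1)
      · rw [hjn, HahnSeries.coeff_single_same, ← hjn, hN j hjN]
      · rw [HahnSeries.coeff_single_of_ne hjn]
    · obtain ⟨m, rfl⟩ : ∃ m : ℕ, j = -(m + 1) := ⟨(-j - 1).toNat, by omega⟩
      rw [Finset.sum_eq_single m, HahnSeries.coeff_single_same]
      · intro n _ hn
        rw [HahnSeries.coeff_single_of_ne (by omega)]
      · intro hm
        rw [Finset.mem_range] at hm
        omega

theorem residue_eq (η : Ω[S.K i⁄k]) :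
    S.residue i p η = (S.diffExpansion hp η).coeff (-1) := by
  have h : ∃ c, S.HasResidue i p η c := ⟨_, (S.hasResidue_iff hp η _).mpr rfl⟩
  rw [residue, dif_pos h]
  exact ((S.hasResidue_iff hp η _).mp h.choose_spec).symm

end

end CurveWithNormalisation

end

/-! ### The stalks of the dualising sheaf -/

section

open LaurentSeries BranchExpansion
open KaehlerDifferential (D)

namespace CurveWithNormalisation

variable {k : Type u} [Field k] {r : ℕ} (S : CurveWithNormalisation k r)

theorem mem_localRing {g : S.Rat} :
    g ∈ S.localRing ↔ ∃ f, ∀ i, S.pull i S.q (S.exists_over i) f = g i :=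
  ⟨fun ⟨f, hf⟩ => ⟨f, fun i => congrFun hf i⟩, fun ⟨f, hf⟩ => ⟨f, funext hf⟩⟩

noncomputable instance : Fintype S.Branch := Fintype.ofFinite _

theorem delta_eq_card_add_one (hgenus : S.genus = 2) : S.delta = Fintype.card S.Branch + 1 := by
  rw [genus, Nat.card_eq_fintype_card] at hgenus
  omega

variable [IsAlgClosed k]

/-- The Laurent expansions of rational functions along the branches. -/
noncomputable def branchExpansion : S.Rat →ₐ[k] (S.Branch → LaurentSeries k) :=
  AlgHom.pi fun b => (S.expansion (S.isClosed_branch b)).comp (Pi.evalAlgHom k _ b.1.1)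

theorem branchExpansion_apply (g : S.Rat) (b : S.Branch) :
    S.branchExpansion g b = S.expansion (S.isClosed_branch b) (g b.1.1) := rfl

theorem mem_maxPow_branch_iff (b : S.Branch) (n : ℕ) (g : S.Rat) :
    g b.1.1 ∈ S.maxPow b.1.1 b.1.2 n ↔ S.branchExpansion g b ∈ vanishing k n :=
  S.mem_maxPow_iff (S.isClosed_branch b) n _

theorem isDense_branchExpansion : IsDense S.branchExpansion := fun G N => by
  choose x hx using fun b => S.exists_sub_expansion_mem (S.isClosed_branch b) (G b) N
  obtain ⟨g, hg⟩ := S.exists_sub_mem_maxPow x N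
  refine ⟨g, fun b => ?_⟩
  have h := (S.mem_maxPow_iff (S.isClosed_branch b) N _).mp (hg b)
  rw [map_sub] at h
  have := Submodule.add_mem _ h (hx b)
  rwa [sub_add_sub_cancel] at this

theorem radPow_eq (n : ℕ) : S.radPow n = rad S.branchExpansion n := by
  ext g
  exact forall_congr' fun b => S.mem_maxPow_branch_iff b n g

theorem conductor_eq : S.conductor = BranchExpansion.conductor S.branchExpansion S.localRing := by
  ext g
  change (∀ h ∈ S.radPow 0, g * h ∈ S.R) ↔ ∀ h ∈ rad S.branchExpansion 0, g * h ∈ S.localRing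
  rw [radPow_eq]
  rfl

theorem delta_eq : S.delta = BranchExpansion.delta S.branchExpansion S.localRing := by
  rw [delta, BranchExpansion.delta, radPow_eq]

theorem gradedDim_eq (n : ℕ) :
    S.gradedDim n = BranchExpansion.gradedDim S.branchExpansion S.localRing n := by
  rw [gradedDim, BranchExpansion.gradedDim, radPow_eq, radPow_eq]

/-- A function at `q` is a constant plus an element of the maximal ideal, and the pullbacks to the
points over `q` are local homomorphisms. So that constant is the constant term on every branch. -/
theorem isLocalAt_localRing : IsLocalAt S.branchExpansion S.localRing := by
  refine ⟨fun g hg b => ?_, fun g hg => ?_⟩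
  · obtain ⟨f, hf⟩ := S.mem_localRing.mp hg
    obtain ⟨φ, -, hφ, -⟩ := S.exists_stalkMap b.2 (S.exists_over b.1.1)
    rw [branchExpansion_apply, ← hf, hφ]
    exact (S.exists_algebraMap_eq_iff (S.isClosed_branch b) _).mp ⟨_, rfl⟩
  · obtain ⟨f, hf⟩ := S.mem_localRing.mp hg
    obtain ⟨c, hc⟩ := exists_sub_constToStalk_mem S.str S.isClosed_q f
    suffices h : ∀ b, (S.branchExpansion g b).coeff 0 = c from fun b b' => (h b).trans (h b').symm
    intro b
    obtain ⟨φ, hloc, hφ, -⟩ := S.exists_stalkMap b.2 (S.exists_over b.1.1)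
    have h1 : φ (f - constToStalk S.str S.q c) ∈ IsLocalRing.maximalIdeal _ :=
      (IsLocalRing.mem_maximalIdeal _).mpr fun hu =>
        (IsLocalRing.mem_maximalIdeal _).mp hc (isUnit_of_map_unit φ _ hu)
    have h2 := (S.mem_maxPow_iff (S.isClosed_branch b) 1 _).mp
      (S.mem_maxPow.mpr ⟨_, by rwa [pow_one], rfl⟩)
    rw [← hφ, map_sub, hf, pull_constToStalk, map_sub, AlgHom.commutes] at h2
    have h3 := h2 0 (by norm_num)
    rw [HahnSeries.coeff_sub, algebraMap_eq_single, HahnSeries.coeff_single_same, sub_eq_zero] at h3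
    exact h3

theorem isSingularBranch_iff (b : S.Branch) : S.IsSingularBranch b ↔
    ¬ ∃ g ∈ S.localRing, S.branchExpansion g b ∈ vanishing k 1 ∧
      (S.branchExpansion g b).coeff 1 ≠ 0 := by
  refine not_congr (exists_congr fun g => and_congr Iff.rfl ?_)
  rw [mem_maxPow_branch_iff, mem_maxPow_branch_iff]
  have h2 : ((2 : ℕ) : ℤ) = 1 + 1 := by norm_num
  rw [h2, mem_vanishing_add_one, Nat.cast_one]
  tauto

theorem areTangent_iff (hns : ∀ b, ∃ g ∈ S.localRing, S.branchExpansion g b ∈ vanishing k 1 ∧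
      (S.branchExpansion g b).coeff 1 ≠ 0) (a b : S.Branch) : S.AreTangent a b ↔
    ∀ g ∈ S.localRing, g ∈ rad S.branchExpansion 1 →
      ((S.branchExpansion g a).coeff 1 = 0 ↔ (S.branchExpansion g b).coeff 1 = 0) := by
  have h : ∀ b, ¬ S.IsSingularBranch b := fun b =>
    (S.isSingularBranch_iff b).not.mpr (not_not.mpr (hns b))
  rw [AreTangent, and_iff_right (h a), and_iff_right (h b), radPow_eq]
  refine forall₂_congr fun g _ => forall_congr' fun hg => ?_
  have key : ∀ b, g b.1.1 ∈ S.maxPow b.1.1 b.1.2 2 ↔ (S.branchExpansion g b).coeff 1 = 0 := by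
    intro b
    have h2 : ((2 : ℕ) : ℤ) = 1 + 1 := by norm_num
    have h3 : S.branchExpansion g b ∈ vanishing k 1 := by
      have := hg b
      rwa [Nat.cast_one] at this
    rw [mem_maxPow_branch_iff, h2, mem_vanishing_add_one, and_iff_right h3]
  rw [key, key]

/-- The Laurent expansions of rational differentials along the branches. -/
noncomputable def branchDiffExpansion : S.RatDiff →+ (S.Branch → LaurentSeries k) :=
  AddMonoidHom.pi fun b =>
    (S.diffExpansion (S.isClosed_branch b)).comp (Pi.evalAddMonoidHom _ b.1.1)

theorem branchDiffExpansion_apply (η : S.RatDiff) (b : S.Branch) :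
    S.branchDiffExpansion η b = S.diffExpansion (S.isClosed_branch b) (η b.1.1) := rfl

theorem branchDiffExpansion_smul (g : S.Rat) (η : S.RatDiff) (b : S.Branch) :
    S.branchDiffExpansion (g • η) b = S.branchExpansion g b * S.branchDiffExpansion η b :=
  S.diffExpansion_smul (S.isClosed_branch b) _ _

/-- Every component has a point over `q`, so the vanishing clause in `dualisingStalk` is void here
and only the residue condition remains. -/
theorem mem_dualisingStalk_q {η : S.RatDiff} :
    η ∈ S.dualisingStalk S.q ↔ η ∈ dual S.branchDiffExpansion S.localRing := by
  have h : ∀ f : S.X.presheaf.stalk S.q,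
      (∑ᶠ p : S.Fibre S.q, S.residue p.1.1 p.1.2 (S.pull p.1.1 S.q ⟨p.1.2, p.2⟩ f • η p.1.1)) =
        resSum S.branchDiffExpansion
          ((fun i => S.pull i S.q (S.exists_over i) f : S.Rat) • η) := fun f => by
    rw [finsum_eq_sum_of_fintype]
    exact Finset.sum_congr rfl fun b _ => S.residue_eq (S.isClosed_branch b) _
  constructor
  · rintro ⟨-, hη⟩ g hg
    obtain ⟨f, hf⟩ := S.mem_localRing.mp hg
    rw [← funext hf, ← h, hη]
  · intro hη
    exact ⟨fun i hi => absurd (S.exists_over i) hi, fun f => (h f).trans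
      (hη _ (S.mem_localRing.mpr ⟨f, fun _ => rfl⟩))⟩

theorem exists_eq_smul {η₀ : S.RatDiff} (h : ∀ i, η₀ i ≠ 0) (η : S.RatDiff) :
    ∃ g : S.Rat, η = g • η₀ := by
  have hi : ∀ i, ∃ g : S.K i, η i = g • η₀ i := fun i => by
    obtain ⟨p, hp⟩ := S.exists_over i
    have hc := S.isClosed_branch ⟨⟨i, p⟩, hp⟩
    have h0 : S.diffCoeff hc (η₀ i) ≠ 0 := (LinearEquiv.map_ne_zero_iff _).mpr (h i)
    refine ⟨S.diffCoeff hc (η i) / S.diffCoeff hc (η₀ i), (S.diffCoeff hc).injective ?_⟩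
    rw [map_smul, smul_eq_mul, div_mul_cancel₀ _ h0]
  choose g hg using hi
  exact ⟨g, funext hg⟩

theorem ne_zero_of_branchDiffExpansion_ne_zero {η : S.RatDiff}
    (h : ∀ b, S.branchDiffExpansion η b ≠ 0) (i : Fin r) : η i ≠ 0 := by
  obtain ⟨p, hp⟩ := S.exists_over i
  exact mt (S.diffExpansion_eq_zero_iff _).mpr (h ⟨⟨i, p⟩, hp⟩)

/-- Only one point lies over `ν p` and the local rings agree there. Testing against all powers `t^n`
of the uniformiser kills the coefficients of degree `-1 - n`, that is, the whole principal part. -/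
theorem mem_dualisingStalk_of_ne {j : Fin r} {p : S.C j} (hp : IsClosed ({p} : Set (S.C j)))
    (hq : S.ν j p ≠ S.q) {η : S.RatDiff} :
    η ∈ S.dualisingStalk (S.ν j p) ↔ (∀ i ≠ j, η i = 0) ∧ η j ∈ S.regularDiff j p := by
  have huniq : ∀ p' : Σ i, S.C i, S.ν p'.1 p'.2 = S.ν j p → p' = ⟨j, p⟩ := fun p' hp' =>
    (S.existsUnique_over hq).unique hp' rfl
  have hex : ∀ i, (∃ p', S.ν i p' = S.ν j p) ↔ i = j := fun i =>
    ⟨fun ⟨p', hp'⟩ => congrArg Sigma.fst (huniq ⟨i, p'⟩ hp'), fun h => by subst h; exact ⟨p, rfl⟩⟩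
  obtain ⟨φ, -, hφ, hbij⟩ := S.exists_stalkMap (p := p) rfl ⟨p, rfl⟩
  let uniq : Unique (S.Fibre (S.ν j p)) :=
    ⟨⟨⟨⟨j, p⟩, rfl⟩⟩, fun p' => Subtype.ext (huniq p'.1 p'.2)⟩
  refine and_congr (forall_congr' fun i => by rw [hex]) ?_
  have h1 : ∀ f : S.X.presheaf.stalk (S.ν j p), (∑ᶠ p' : S.Fibre (S.ν j p),
      S.residue p'.1.1 p'.1.2 (S.pull p'.1.1 (S.ν j p) ⟨p'.1.2, p'.2⟩ f • η p'.1.1)) =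
        (S.expansion hp (algebraMap _ _ (φ f)) * S.diffExpansion hp (η j)).coeff (-1) := fun f => by
    rw [finsum_unique, ← hφ, ← diffExpansion_smul]
    exact S.residue_eq hp _
  simp only [h1]
  rw [S.mem_regularDiff_iff hp]
  constructor
  · intro h m hm
    obtain ⟨n, hn⟩ : ∃ n : ℕ, m = -1 - n := ⟨(-1 - m).toNat, by omega⟩
    obtain ⟨f, hf⟩ := (hbij hq).surjective (S.uniformiser j p ^ n)
    have h2 := h f
    have h3 : S.expansion hp (algebraMap _ (S.K j) (S.uniformiser j p ^ n)) =
        HahnSeries.single (n : ℤ) 1 := by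
      rw [map_pow, ← zpow_natCast]
      exact S.expansion_localParam_zpow hp n
    rwa [hf, h3, coeff_single_mul', one_mul, ← hn] at h2
  · intro h f
    exact mul_mem_vanishing_of_eq ((S.exists_algebraMap_eq_iff hp _).mp ⟨_, rfl⟩) h
      (add_zero 0).symm _ (by norm_num)

theorem pullbackDualising_of_ne {j : Fin r} {p : S.C j} (hp : IsClosed ({p} : Set (S.C j)))
    (hq : S.ν j p ≠ S.q) : S.pullbackDualising j p = S.regularDiff j p := by
  classical
  refine le_antisymm (Submodule.span_le.mpr ?_) fun θ hθ => Submodule.subset_span ?_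
  · rintro _ ⟨η, hη, rfl⟩
    exact ((S.mem_dualisingStalk_of_ne hp hq).mp hη).2
  · refine ⟨Pi.single j θ, (S.mem_dualisingStalk_of_ne hp hq).mpr ⟨fun i hi => ?_, ?_⟩, ?_⟩
    · rw [Pi.single_eq_of_ne hi]
    · rwa [Pi.single_eq_same]
    · rw [Pi.single_eq_same]

theorem twistedDiff_zero {i : Fin r} {p : S.C i} (hp : IsClosed ({p} : Set (S.C i))) :
    S.twistedDiff i p 0 = S.regularDiff i p := by
  ext η
  rw [S.mem_twistedDiff_iff hp, S.mem_regularDiff_iff hp, Nat.cast_zero, neg_zero]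

theorem twistedDiff_eq_span {i : Fin r} {p : S.C i} (hp : IsClosed ({p} : Set (S.C i))) {n : ℕ}
    {η : Ω[S.K i⁄k]} (hη : S.diffExpansion hp η ∈ vanishing k (-n)) (hne : (S.diffExpansion hp η).coeff (-n) ≠ 0) :
    S.twistedDiff i p n = Submodule.span (S.O i p) {η} := by
  have h0 : S.diffCoeff hp η ≠ 0 := fun h => hne (by
    rw [diffExpansion_apply, h, map_zero, HahnSeries.coeff_zero])
  ext θ
  rw [S.mem_twistedDiff_iff hp, Submodule.mem_span_singleton]
  constructor
  · intro hθ
    have hθ' : θ = (S.diffCoeff hp θ / S.diffCoeff hp η) • η := by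
      apply (S.diffCoeff hp).injective
      rw [map_smul, smul_eq_mul, div_mul_cancel₀ _ h0]
    rw [hθ', diffExpansion_smul] at hθ
    obtain ⟨a, ha⟩ := (S.exists_algebraMap_eq_iff hp _).mpr
      (mem_vanishing_of_mul_mem hη hne hθ (by simp))
    exact ⟨a, by rw [hθ', ← ha, algebraMap_smul]⟩
  · rintro ⟨a, rfl⟩
    rw [← algebraMap_smul (S.K i) a, diffExpansion_smul]
    exact mul_mem_vanishing_of_eq ((S.exists_algebraMap_eq_iff hp _).mp ⟨a, rfl⟩) hη (by simp)

section

variable (hGor : S.IsGorenstein) (hδ : S.delta ≠ 0) {c : S.Branch → ℕ} (hc : ∀ b, c b ≠ 0)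
  (hcond : BranchExpansion.conductor S.branchExpansion S.localRing =
    fil S.branchExpansion fun b => (c b : ℤ))
include hGor hδ hc hcond

theorem exists_generator_dualisingStalk_q : ∃ η₀ ∈ S.dualisingStalk S.q,
    (∀ b, (S.branchDiffExpansion η₀ b).coeff (-c b) ≠ 0) ∧
      ∀ η, η ∈ S.dualisingStalk S.q ↔ ∃ g ∈ S.localRing, η = g • η₀ := by
  have : Infinite k := IsAlgClosed.instInfinite
  choose p hp using S.exists_over
  have hcl : ∀ i, IsClosed ({p i} : Set (S.C i)) := fun i => S.isClosed_branch ⟨⟨i, p i⟩, hp i⟩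
  simp only [mem_dualisingStalk_q]
  rw [IsGorenstein, conductor_eq, delta_eq] at hGor
  rw [delta_eq] at hδ
  refine exists_generator_dual (θ := fun i => D k (S.K i) (S.localParam i (p i)))
    S.isDense_branchExpansion S.isLocalAt_localRing S.branchDiffExpansion_smul hcond hδ hGor hc
    (fun b => ?_) fun η₀ h => S.exists_eq_smul (S.ne_zero_of_branchDiffExpansion_ne_zero h)
  rw [branchDiffExpansion_apply, Ne, diffExpansion_eq_zero_iff]
  exact S.D_localParam_ne_zero (hcl _)

/-- At `q` a generator comes from residue duality; elsewhere the differential of a uniformiser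
generates. Uniqueness of the coefficient holds since the generator is nonzero on every component
through the point and functions are determined by their pullbacks. -/
theorem dualisingIsLineBundle : S.DualisingIsLineBundle := by
  classical
  intro x hx
  by_cases hq : x = S.q
  · subst hq
    obtain ⟨η₀, hη₀, hne, hgen⟩ := S.exists_generator_dualisingStalk_q hGor hδ hc hcond
    have hne' : ∀ i, η₀ i ≠ 0 := S.ne_zero_of_branchDiffExpansion_ne_zero fun b h =>
      hne b (by rw [h, HahnSeries.coeff_zero])
    refine ⟨η₀, hη₀, fun η => (hgen η).trans ⟨?_, ?_⟩⟩
    · rintro ⟨g, hg, rfl⟩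
      obtain ⟨f, hf⟩ := S.mem_localRing.mp hg
      refine ⟨f, fun i => ⟨fun h => ?_, fun h => absurd (S.exists_over i) h⟩, fun f' hf' => ?_⟩
      · rw [hf]; rfl
      · rw [← sub_eq_zero]
        refine S.eq_zero_of_pull_eq_zero fun i h => ?_
        rw [map_sub, sub_eq_zero, hf]
        exact (smul_left_injective (S.K i) (hne' i) ((hf' i).1 h)).symm
    · rintro ⟨f, hf, -⟩
      exact ⟨_, S.mem_localRing.mpr ⟨f, fun _ => rfl⟩, funext fun i => (hf i).1 _⟩
  · obtain ⟨⟨j, p⟩, rfl : S.ν j p = x, huniq⟩ := S.existsUnique_over hq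
    have hp := S.isClosed_of_isClosed_ν hx
    have := S.isDVR j p hp
    have hex : ∀ i, (∃ p', S.ν i p' = S.ν j p) ↔ i = j := fun i =>
      ⟨fun ⟨p', hp'⟩ => congrArg Sigma.fst (huniq ⟨i, p'⟩ hp'), fun h => by subst h; exact ⟨p, rfl⟩⟩
    obtain ⟨φ, -, hφ, hbij⟩ := S.exists_stalkMap (p := p) rfl ⟨p, rfl⟩
    have hD : ∀ η : Ω[S.K j⁄k], η ∈ S.regularDiff j p ↔
        ∃ f, η = S.pull j (S.ν j p) ⟨p, rfl⟩ f • D k (S.K j) (S.localParam j p) := fun η => by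
      rw [regularDiff, IsDiscreteValuationRing.span_range_D_eq (S.K j)
        (S.exists_sub_algebraMap_mem hp) (S.irreducible_uniformiser hp),
        Submodule.mem_span_singleton, (hbij hq).surjective.exists]
      refine exists_congr fun f => ?_
      rw [hφ, algebraMap_smul]
      exact eq_comm
    refine ⟨Pi.single j (D k (S.K j) (S.localParam j p)), ?_, fun η => ?_⟩
    · rw [S.mem_dualisingStalk_of_ne hp hq, Pi.single_eq_same]
      exact ⟨fun i hi => Pi.single_eq_of_ne hi _, Submodule.subset_span ⟨_, rfl⟩⟩
    rw [S.mem_dualisingStalk_of_ne hp hq, hD]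
    constructor
    · rintro ⟨h0, f, hf⟩
      refine ⟨f, fun i => ⟨fun h => ?_, fun h => h0 i (mt (hex i).mpr h)⟩, fun f' hf' => ?_⟩
      · obtain rfl := (hex i).mp h
        rw [Pi.single_eq_same, hf]
      · have h1 := (hf' j).1 ⟨p, rfl⟩
        rw [Pi.single_eq_same, hf] at h1
        have h2 := smul_left_injective (S.K j) (S.D_localParam_ne_zero hp) h1
        rw [hφ, hφ] at h2
        exact ((hbij hq).injective (IsFractionRing.injective _ _ h2)).symm
    · rintro ⟨f, hf, -⟩
      refine ⟨fun i hi => (hf i).2 (mt (hex i).mp hi), f, ?_⟩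
      rw [(hf j).1 ⟨p, rfl⟩, Pi.single_eq_same]

/-- The conductor bounds the poles of all sections at `q`, and the generator attains the bound on
every branch at once; it therefore already generates the twisted stalk. -/
theorem pullbackDualisingEq : S.PullbackDualisingEq (S.branchDivisor c) := by
  refine ⟨S.dualisingIsLineBundle hGor hδ hc hcond, fun i p hp => ?_⟩
  by_cases hq : S.ν i p = S.q
  · let b : S.Branch := ⟨⟨i, p⟩, hq⟩
    have hD : S.branchDivisor c ⟨i, p⟩ = c b := dif_pos hq
    rw [hD]
    obtain ⟨η₀, hη₀, hne, -⟩ := S.exists_generator_dualisingStalk_q hGor hδ hc hcond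
    have hmem : ∀ η ∈ S.dualisingStalk S.q, S.diffExpansion hp (η i) ∈ vanishing k (-c b) :=
      fun η hη => mem_vanishing_of_mem_dual S.isDense_branchExpansion S.branchDiffExpansion_smul
        hcond (S.mem_dualisingStalk_q.mp hη) b
    refine le_antisymm (Submodule.span_le.mpr ?_) fun θ hθ => ?_
    · rintro _ ⟨η, hη, rfl⟩
      rw [hq] at hη
      exact (S.mem_twistedDiff_iff hp _ _).mpr (hmem η hη)
    · rw [S.twistedDiff_eq_span hp (hmem η₀ hη₀) (hne b)] at hθ
      refine Submodule.span_mono (Set.singleton_subset_iff.mpr ?_) hθ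
      exact ⟨η₀, hq ▸ hη₀, rfl⟩
  · have hD : S.branchDivisor c ⟨i, p⟩ = 0 := dif_neg hq
    rw [hD, S.pullbackDualising_of_ne hp hq, S.twistedDiff_zero hp]

end

end CurveWithNormalisation

end

/-! ### Valuative criteria on an integral curve -/

namespace CurveWithNormalisation

variable {k : Type u} [Field k]

section

variable {Y : Scheme.{u}} [IsIntegral Y] (f : Y ⟶ Spec (CommRingCat.of k))

theorem specializes_genericPoint (p : Y) : genericPoint Y ⤳ p :=
  (genericPoint_spec Y).specializes trivial

theorem algebraMap_comp_constToStalk (p : Y) :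
    (algebraMap (Y.presheaf.stalk p) Y.functionField).comp (constToStalk f p) =
      constToStalk f (genericPoint Y) := by
  change (Y.presheaf.stalkSpecializes (specializes_genericPoint p)).hom.comp
    (constToStalk f p) = _
  rw [constToStalk, constToStalk, ← CommRingCat.hom_comp]
  congr 1
  rw [Category.assoc, Category.assoc, TopCat.Presheaf.germ_stalkSpecializes]

theorem specMap_algebraMap_fromSpecStalk (p : Y) :
    Spec.map (CommRingCat.ofHom (algebraMap (Y.presheaf.stalk p) Y.functionField)) ≫
      Y.fromSpecStalk p = Y.fromSpecStalk (genericPoint Y) :=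
  Scheme.SpecMap_stalkSpecializes_fromSpecStalk (specializes_genericPoint p)

/-- On a separated curve, a point is determined by its local ring inside the function field. -/
theorem eq_of_stalk_hom [IsSeparated f] {p₁ p₂ : Y}
    [IsDiscreteValuationRing (Y.presheaf.stalk p₂)]
    (ψ : Y.presheaf.stalk p₁ →+* Y.presheaf.stalk p₂) [IsLocalHom ψ]
    (hψ : ∀ a, algebraMap (Y.presheaf.stalk p₂) Y.functionField (ψ a) =
      algebraMap (Y.presheaf.stalk p₁) Y.functionField a) : p₁ = p₂ := by
  have hψ' : (algebraMap (Y.presheaf.stalk p₂) Y.functionField).comp ψ =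
      algebraMap (Y.presheaf.stalk p₁) Y.functionField := RingHom.ext hψ
  have hψk : ψ.comp (constToStalk f p₁) = constToStalk f p₂ := by
    refine RingHom.ext fun c => IsFractionRing.injective _ Y.functionField ?_
    rw [← RingHom.comp_apply, ← RingHom.comp_apply, ← RingHom.comp_assoc, hψ',
      algebraMap_comp_constToStalk, algebraMap_comp_constToStalk]
  have h1 : (Spec.map (CommRingCat.ofHom ψ) ≫ Y.fromSpecStalk p₁) ≫ f =
      Spec.map (CommRingCat.ofHom (constToStalk f p₂)) := by
    rw [Category.assoc, fromSpecStalk_comp, ← Spec.map_comp, ← CommRingCat.ofHom_comp, hψk]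
  have h2 : Spec.map (CommRingCat.ofHom (algebraMap (Y.presheaf.stalk p₂) Y.functionField)) ≫
      Spec.map (CommRingCat.ofHom ψ) ≫ Y.fromSpecStalk p₁ = Y.fromSpecStalk (genericPoint Y) := by
    rw [← Spec.map_comp_assoc, ← CommRingCat.ofHom_comp, hψ', specMap_algebraMap_fromSpecStalk]
  -- By separatedness, the morphisms from the spectrum of the local ring at `p₂` given by `ψ` and by
  -- the identity coincide, as they agree generically. Their values at the closed point are `p₁`
  -- (because `ψ` is local) and `p₂`.
  let sq : ValuativeCommSq f :=
    { R := Y.presheaf.stalk p₂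
      K := Y.functionField
      i₁ := Y.fromSpecStalk (genericPoint Y)
      i₂ := Spec.map (CommRingCat.ofHom (constToStalk f p₂))
      commSq := ⟨by
        rw [fromSpecStalk_comp, ← Spec.map_comp, ← CommRingCat.ofHom_comp,
          algebraMap_comp_constToStalk]⟩ }
  let l₁ : sq.commSq.LiftStruct := ⟨Spec.map (CommRingCat.ofHom ψ) ≫ Y.fromSpecStalk p₁, h2, h1⟩
  let l₂ : sq.commSq.LiftStruct := ⟨Y.fromSpecStalk p₂, specMap_algebraMap_fromSpecStalk p₂,
    fromSpecStalk_comp f p₂⟩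
  have h3 : Spec.map (CommRingCat.ofHom ψ) ≫ Y.fromSpecStalk p₁ = Y.fromSpecStalk p₂ :=
    congrArg CommSq.LiftStruct.l ((IsSeparated.valuativeCriterion f sq).elim l₁ l₂)
  have : IsLocalHom (CommRingCat.ofHom ψ).hom := ‹IsLocalHom ψ›
  have h4 : (Spec.map (CommRingCat.ofHom ψ) ≫ Y.fromSpecStalk p₁)
      (IsLocalRing.closedPoint (Y.presheaf.stalk p₂)) = p₂ := by
    rw [h3]
    exact Scheme.fromSpecStalk_closedPoint
  have h5 : Y.fromSpecStalk p₁ (Spec.map (CommRingCat.ofHom ψ)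
      (IsLocalRing.closedPoint (Y.presheaf.stalk p₂))) = p₁ := by
    rw [Spec_closedPoint]
    exact Scheme.fromSpecStalk_closedPoint
  exact h5.symm.trans h4

/-- Every valuation ring of the function field of a complete curve contains a local ring. -/
theorem exists_stalk_le [IsProper f] (V : ValuationSubring Y.functionField)
    (hV : ∀ c, constToStalk f (genericPoint Y) c ∈ V) :
    ∃ p : Y, ∀ a, algebraMap (Y.presheaf.stalk p) Y.functionField a ∈ V := by
  let κ : k →+* V := (constToStalk f (genericPoint Y)).codRestrict V hV
  have hκ : (algebraMap V Y.functionField).comp κ = constToStalk f (genericPoint Y) := rfl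
  let sq : ValuativeCommSq f :=
    { R := V
      K := Y.functionField
      i₁ := Y.fromSpecStalk (genericPoint Y)
      i₂ := Spec.map (CommRingCat.ofHom κ)
      commSq := ⟨by
        rw [fromSpecStalk_comp, ← Spec.map_comp, ← CommRingCat.ofHom_comp, hκ]⟩ }
  have hf := ‹IsProper f›
  rw [IsProper.eq_valuativeCriterion] at hf
  obtain ⟨⟨l, hl, -⟩⟩ := (hf.1.1.1.existence sq).exists_lift
  change Spec (CommRingCat.of V) ⟶ Y at l
  refine ⟨l (IsLocalRing.closedPoint V), fun a => ?_⟩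
  have h1 : Spec.map (Scheme.stalkClosedPointTo l ≫
      CommRingCat.ofHom (algebraMap V Y.functionField)) ≫ Y.fromSpecStalk _ =
      Y.fromSpecStalk (genericPoint Y) := by
    rw [Spec.map_comp, Category.assoc, Scheme.Spec_stalkClosedPointTo_fromSpecStalk]
    exact hl
  rw [← specMap_algebraMap_fromSpecStalk (l (IsLocalRing.closedPoint V)), cancel_mono] at h1
  have h2 := congrArg CommRingCat.Hom.hom (Spec.map_injective h1)
  rw [← CommRingCat.hom_ofHom (algebraMap _ Y.functionField), ← h2]
  exact (Scheme.stalkClosedPointTo l a).2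

/-- A point which is not generic is closed. -/
theorem isClosed_of_not_surjective [CompactSpace Y]
    (hdvr : ∀ p : Y, IsClosed ({p} : Set Y) → IsDiscreteValuationRing (Y.presheaf.stalk p))
    {p : Y} (hp : ¬ Function.Surjective (algebraMap (Y.presheaf.stalk p) Y.functionField)) :
    IsClosed ({p} : Set Y) := by
  have hgen : p ≠ genericPoint Y := by
    rintro rfl
    refine hp fun x => ⟨x, ?_⟩
    change Y.presheaf.stalkSpecializes _ x = x
    rw [TopCat.Presheaf.stalkSpecializes_refl]
    rfl
  -- The point `p` specialises to a closed point `p'`, whose local ring is a discrete valuation ring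
  -- with only two primes; so `p` is generic or equal to `p'`.
  obtain ⟨p', hp', hcl⟩ := (isClosed_closure (s := {p})).exists_closed_singleton
    ⟨p, subset_closure rfl⟩
  have := hdvr p' hcl
  have hs : p ∈ Set.range (Y.fromSpecStalk p') := by
    rw [Scheme.range_fromSpecStalk]
    exact specializes_iff_mem_closure.mpr hp'
  obtain ⟨P, hP⟩ := hs
  have hP' : P = (⊥ : PrimeSpectrum (Y.presheaf.stalk p')) ∨
      P = IsLocalRing.closedPoint (Y.presheaf.stalk p') := by
    by_cases h0 : P.asIdeal = ⊥
    · exact Or.inl (PrimeSpectrum.ext h0)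
    · exact Or.inr (PrimeSpectrum.ext (IsLocalRing.eq_maximalIdeal (P.2.isMaximal h0)))
  rcases hP' with rfl | rfl
  · refine absurd ?_ hgen
    have h1 : Spec.map (CommRingCat.ofHom (algebraMap (Y.presheaf.stalk p') Y.functionField))
        (IsLocalRing.closedPoint Y.functionField) = (⊥ : PrimeSpectrum (Y.presheaf.stalk p')) := by
      refine PrimeSpectrum.ext ?_
      change (IsLocalRing.maximalIdeal Y.functionField).comap
        (algebraMap (Y.presheaf.stalk p') Y.functionField) = ⊥
      rw [IsLocalRing.maximalIdeal_eq_bot]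
      exact Ideal.comap_bot_of_injective _ (IsFractionRing.injective _ _)
    rw [← hP, ← h1]
    have h2 : (Spec.map (CommRingCat.ofHom
        (algebraMap (Y.presheaf.stalk p') Y.functionField)) ≫ Y.fromSpecStalk p')
          (IsLocalRing.closedPoint Y.functionField) = genericPoint Y := by
      rw [specMap_algebraMap_fromSpecStalk]
      exact Scheme.fromSpecStalk_closedPoint
    exact h2
  · have h1 : p' = p := Scheme.fromSpecStalk_closedPoint.symm.trans hP
    exact h1 ▸ hcl

end

end CurveWithNormalisation

/-! ### Orders of functions and differentials on rational curves -/

section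

open LaurentSeries BranchExpansion
open KaehlerDifferential (D)
open scoped IntermediateField

namespace LaurentSeries

variable {k : Type*} [Field k] {f : LaurentSeries k} {n : ℤ}

theorem order_eq_of_mem_vanishing (h : f ∈ vanishing k n) (h0 : f.coeff n ≠ 0) : f.order = n := by
  refine le_antisymm (HahnSeries.order_le_of_coeff_ne_zero h0) ?_
  by_contra hn
  have hf : f ≠ 0 := fun h => h0 (by rw [h, HahnSeries.coeff_zero])
  exact hf (HahnSeries.coeff_order_eq_zero.mp (h _ (not_le.mp hn)))

theorem mem_vanishing_iff_order (hf : f ≠ 0) : f ∈ vanishing k n ↔ n ≤ f.order :=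
  ⟨fun h => not_lt.mp fun hn => hf (HahnSeries.coeff_order_eq_zero.mp (h _ hn)),
    fun h _ hj => HahnSeries.coeff_eq_zero_of_lt_order (hj.trans_le h)⟩

end LaurentSeries

namespace CurveWithNormalisation

variable {k : Type u} [Field k] {r : ℕ} (S : CurveWithNormalisation k r) [IsAlgClosed k]
  {i : Fin r} {p : S.C i} (hp : IsClosed ({p} : Set (S.C i)))

theorem expansion_ne_zero {g : S.K i} (hg : g ≠ 0) : S.expansion hp g ≠ 0 :=
  (map_ne_zero _).mpr hg

theorem order_expansion_mul {g h : S.K i} (hg : g ≠ 0) (hh : h ≠ 0) :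
    (S.expansion hp (g * h)).order = (S.expansion hp g).order + (S.expansion hp h).order := by
  rw [map_mul, HahnSeries.order_mul (S.expansion_ne_zero hp hg) (S.expansion_ne_zero hp hh)]

theorem order_expansion_localParam : (S.expansion hp (S.localParam i p)).order = 1 := by
  have h := S.expansion_localParam_zpow hp 1
  rw [zpow_one] at h
  rw [h, HahnSeries.order_single one_ne_zero]

include hp in
theorem sub_algebraMap_ne_zero_of_adjoin_eq_top {y : S.K i} (hgen : k⟮y⟯ = ⊤) (a : k) :
    y - algebraMap k (S.K i) a ≠ 0 := by
  intro h
  have h1 : S.localParam i p ∈ k⟮y⟯ := hgen ▸ IntermediateField.mem_top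
  rw [IntermediateField.adjoin_simple_eq_bot_iff.mpr
    (IntermediateField.mem_bot.mpr ⟨a, (sub_eq_zero.mp h).symm⟩)] at h1
  obtain ⟨c, hc⟩ := IntermediateField.mem_bot.mp h1
  have h2 := S.order_expansion_localParam hp
  rw [← hc, AlgHom.commutes, algebraMap_eq_single] at h2
  by_cases h0 : c = 0
  · simp [h0] at h2
  · simp [HahnSeries.order_single h0] at h2

section generator

variable {y : S.K i} {a : k} (hy : S.expansion hp (y - algebraMap k (S.K i) a) ∈ vanishing k 1)
include hy

/-- In the factorisation `P = (X - a)^n * q` with `q(a) ≠ 0`, the factor `q(y)` is a unit at `p`. -/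
theorem order_expansion_aeval (hya : y - algebraMap k (S.K i) a ≠ 0) {P : Polynomial k}
    (hP : P ≠ 0) :
    Polynomial.aeval y P ≠ 0 ∧ (S.expansion hp (Polynomial.aeval y P)).order =
      P.rootMultiplicity a * (S.expansion hp (y - algebraMap k (S.K i) a)).order := by
  obtain ⟨q, hq, hdvd⟩ := Polynomial.exists_eq_pow_rootMultiplicity_mul_and_not_dvd P hP a
  rw [Polynomial.dvd_iff_isRoot] at hdvd
  have hyO : S.expansion hp y ∈ vanishing k 0 := by
    have := Submodule.add_mem _ (vanishing_anti (by norm_num) hy) (algebraMap_mem_vanishing a)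
    rwa [map_sub, AlgHom.commutes, sub_add_cancel] at this
  have hpol : ∀ s : Polynomial k, S.expansion hp (Polynomial.aeval y s) ∈ vanishing k 0 := by
    intro s
    obtain ⟨z, hz⟩ := (S.exists_algebraMap_eq_iff hp _).mpr hyO
    rw [← S.exists_algebraMap_eq_iff hp, ← hz]
    exact ⟨Polynomial.aeval z s, (Polynomial.aeval_algebraMap_apply _ _ _).symm⟩
  obtain ⟨s, hs⟩ := Polynomial.X_sub_C_dvd_sub_C_eval (a := a) (p := q)
  have hq' : S.expansion hp (Polynomial.aeval y q) - algebraMap k _ (q.eval a) ∈ vanishing k 1 := by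
    have := congrArg (fun s => S.expansion hp (Polynomial.aeval y s)) hs
    simp only [map_sub, map_mul, Polynomial.aeval_C, Polynomial.aeval_X, AlgHom.commutes] at this
    rw [this]
    rw [map_sub, AlgHom.commutes] at hy
    exact mul_mem_vanishing_of_eq hy (hpol s) (by norm_num)
  have hq0 : (S.expansion hp (Polynomial.aeval y q)).coeff 0 = q.eval a := by
    have := hq' 0 (by norm_num)
    rwa [HahnSeries.coeff_sub, algebraMap_eq_single, HahnSeries.coeff_single_same,
      sub_eq_zero] at this
  have hqne : (S.expansion hp (Polynomial.aeval y q)).coeff 0 ≠ 0 := hq0 ▸ hdvd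
  have hqne' : Polynomial.aeval y q ≠ 0 := fun h =>
    hqne (by rw [h, map_zero, HahnSeries.coeff_zero])
  have hPq : Polynomial.aeval y P =
      (y - algebraMap k (S.K i) a) ^ P.rootMultiplicity a * Polynomial.aeval y q := by
    conv_lhs => rw [hq]
    simp
  rw [hPq]
  refine ⟨mul_ne_zero (pow_ne_zero _ hya) hqne', ?_⟩
  rw [S.order_expansion_mul hp (pow_ne_zero _ hya) hqne', map_pow, HahnSeries.order_pow,
    order_eq_of_mem_vanishing (hpol q) hqne, add_zero, nsmul_eq_mul]

variable (hgen : k⟮y⟯ = ⊤)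
include hgen

theorem exists_order_expansion_eq {g : S.K i} (hg : g ≠ 0) : ∃ P Q : Polynomial k,
    P ≠ 0 ∧ Q ≠ 0 ∧ g = Polynomial.aeval y P / Polynomial.aeval y Q ∧
    (S.expansion hp g).order = (P.rootMultiplicity a - Q.rootMultiplicity a) *
      (S.expansion hp (y - algebraMap k (S.K i) a)).order := by
  have hya := S.sub_algebraMap_ne_zero_of_adjoin_eq_top hp hgen a
  obtain ⟨P, Q, rfl⟩ := (IntermediateField.mem_adjoin_simple_iff k g).mp
    (hgen ▸ IntermediateField.mem_top)
  have hP : P ≠ 0 := by rintro rfl; simp at hg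
  have hQ : Q ≠ 0 := by rintro rfl; simp at hg
  refine ⟨P, Q, hP, hQ, rfl, ?_⟩
  obtain ⟨hP1, hP2⟩ := S.order_expansion_aeval hp hy hya hP
  obtain ⟨hQ1, hQ2⟩ := S.order_expansion_aeval hp hy hya hQ
  have := S.order_expansion_mul hp hg hQ1
  rw [div_mul_cancel₀ _ hQ1] at this
  linear_combination hP2 - hQ2 - this

/-- A generator of the function field is a uniformiser wherever it vanishes. -/
theorem order_expansion_generator :
    (S.expansion hp (y - algebraMap k (S.K i) a)).order = 1 := by
  have h0 : S.localParam i p ≠ 0 := fun h => by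
    have := S.order_expansion_localParam hp
    rw [h, map_zero, HahnSeries.order_zero] at this
    exact zero_ne_one this
  -- All orders at `p` are multiples of the order of `y - a`, and the uniformiser has order `1`.
  obtain ⟨P, Q, -, -, -, h⟩ := S.exists_order_expansion_eq hp hy hgen h0
  rw [S.order_expansion_localParam hp] at h
  have h1 : (1 : ℤ) ≤ (S.expansion hp (y - algebraMap k (S.K i) a)).order :=
    (mem_vanishing_iff_order (S.expansion_ne_zero hp
      (S.sub_algebraMap_ne_zero_of_adjoin_eq_top hp hgen a))).mp hy
  exact Int.eq_one_of_dvd_one (by omega) ⟨_, by rw [mul_comm]; exact h⟩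

/-- On a separated curve whose function field is generated by `y`, the function `y` takes every
value at most once. -/
theorem eq_of_expansion_sub_mem [IsSeparated (S.ν i ≫ S.str)] {p' : S.C i}
    (hp' : IsClosed ({p'} : Set (S.C i)))
    (hy' : S.expansion hp' (y - algebraMap k (S.K i) a) ∈ vanishing k 1) : p = p' := by
  have hya := S.sub_algebraMap_ne_zero_of_adjoin_eq_top hp hgen a
  -- At both points the order of `P(y) / Q(y)` is the difference of the multiplicities of `a` as a
  -- root. So the local ring at `p` is contained in the one at `p'`, by a local homomorphism.
  have key : ∀ (n : ℤ) (g : S.K i), S.expansion hp g ∈ vanishing k n →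
      S.expansion hp' g ∈ vanishing k n := fun n g hg => by
    by_cases h0 : g = 0
    · rw [h0, map_zero]; exact Submodule.zero_mem _
    rw [mem_vanishing_iff_order (S.expansion_ne_zero _ h0)] at hg ⊢
    obtain ⟨P, Q, hP, hQ, hPQ, h⟩ := S.exists_order_expansion_eq hp hy hgen h0
    obtain ⟨hP1, hP2⟩ := S.order_expansion_aeval hp' hy' hya hP
    obtain ⟨hQ1, hQ2⟩ := S.order_expansion_aeval hp' hy' hya hQ
    have := S.order_expansion_mul hp' h0 hQ1
    rw [hPQ, div_mul_cancel₀ _ hQ1, ← hPQ] at this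
    rw [S.order_expansion_generator hp' hy' hgen] at hP2 hQ2
    rw [S.order_expansion_generator hp hy hgen] at h
    linarith
  have := S.isDVR i p' hp'
  have hinj : Function.Injective (algebraMap (S.O i p') (S.K i)) := IsFractionRing.injective _ _
  choose ψ hψ using fun a : S.O i p => (S.exists_algebraMap_eq_iff hp' (algebraMap _ _ a)).mpr
    (key 0 _ ((S.exists_algebraMap_eq_iff hp _).mp ⟨a, rfl⟩))
  let Ψ : S.O i p →+* S.O i p' :=
    { toFun := ψ
      map_one' := hinj (by rw [hψ, map_one, map_one])
      map_zero' := hinj (by rw [hψ, map_zero, map_zero])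
      map_add' := fun a b => hinj (by rw [hψ, map_add, map_add, hψ, hψ])
      map_mul' := fun a b => hinj (by rw [hψ, map_mul, map_mul, hψ, hψ]) }
  have hloc : IsLocalHom Ψ := ⟨fun a ha => by
    by_contra hu
    have h1 := key 1 _ ((S.mem_maxPow_iff hp 1 _).mp (S.mem_maxPow.mpr
      ⟨a, by rw [pow_one]; exact (IsLocalRing.mem_maximalIdeal _).mpr hu, rfl⟩))
    obtain ⟨b, hb, hba⟩ := S.mem_maxPow.mp ((S.mem_maxPow_iff hp' 1 _).mpr h1)
    rw [pow_one, IsLocalRing.mem_maximalIdeal] at hb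
    rw [← hψ] at hba
    exact hb (hinj hba ▸ ha)⟩
  exact eq_of_stalk_hom (S.ν i ≫ S.str) Ψ hψ

end generator

/-- The differential of a uniformiser has neither a zero nor a pole. -/
theorem order_diffExpansion_D {g : S.K i} (h1 : S.expansion hp g ∈ vanishing k 1)
    (h0 : (S.expansion hp g).coeff 1 ≠ 0) :
    S.diffExpansion hp (D k (S.K i) g) ∈ vanishing k 0 ∧
      (S.diffExpansion hp (D k (S.K i) g)).coeff 0 ≠ 0 := by
  have := S.isDVR i p hp
  have ht := S.irreducible_uniformiser hp
  obtain ⟨z, hz, rfl⟩ := S.mem_maxPow.mp ((S.mem_maxPow_iff hp 1 g).mpr (by exact_mod_cast h1))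
  rw [pow_one, ht.maximalIdeal_eq, Ideal.mem_span_singleton] at hz
  obtain ⟨v, rfl⟩ := hz
  have hv : IsUnit v := by
    by_contra hv
    refine h0 ?_
    have : S.uniformiser i p * v ∈ IsLocalRing.maximalIdeal (S.O i p) ^ 2 := by
      rw [pow_two]
      exact Ideal.mul_mem_mul ((IsLocalRing.mem_maximalIdeal _).mpr ht.not_isUnit)
        ((IsLocalRing.mem_maximalIdeal _).mpr hv)
    exact (S.mem_maxPow_iff hp 2 _).mp (S.mem_maxPow.mpr ⟨_, this, rfl⟩) 1 (by norm_num)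
  have hirr : Irreducible (S.uniformiser i p * v) :=
    (associated_mul_unit_right _ _ hv).irreducible ht
  have hreg : D k (S.K i) (algebraMap (S.O i p) (S.K i) (S.uniformiser i p * v)) ∈
      S.regularDiff i p := Submodule.subset_span ⟨_, rfl⟩
  have hreg' := (S.mem_regularDiff_iff hp _).mp hreg
  refine ⟨hreg', fun hc => ?_⟩
  -- Both `t` and `g` are uniformisers, so `dt` is a regular multiple of `dg`. As `dt` expands to
  -- `1`, the constant term of `dg` cannot vanish.
  have h2 : D k (S.K i) (S.localParam i p) ∈ S.regularDiff i p :=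
    Submodule.subset_span ⟨S.uniformiser i p, rfl⟩
  rw [regularDiff, IsDiscreteValuationRing.span_range_D_eq (S.K i)
    (S.exists_sub_algebraMap_mem hp) hirr, Submodule.mem_span_singleton] at h2
  obtain ⟨b, hb⟩ := h2
  have h3 : S.diffExpansion hp (D k (S.K i) (S.localParam i p)) = 1 := by
    have := S.diffCoeff_smul_D hp 1
    rw [one_smul] at this
    rw [diffExpansion_apply, this, map_one]
  rw [← hb, ← algebraMap_smul (S.K i) b, diffExpansion_smul] at h3
  have h4 := coeff_mul_of_mem ((S.exists_algebraMap_eq_iff hp _).mp ⟨b, rfl⟩) hreg'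
  rw [h3, hc, mul_zero, add_zero] at h4
  rw [HahnSeries.coeff_one, if_pos rfl] at h4
  exact one_ne_zero h4

theorem order_diffExpansion_D_inv {g : S.K i} (h1 : S.expansion hp g ∈ vanishing k 1)
    (h0 : (S.expansion hp g).coeff 1 ≠ 0) :
    S.diffExpansion hp (D k (S.K i) g⁻¹) ∈ vanishing k (-2) ∧
      (S.diffExpansion hp (D k (S.K i) g⁻¹)).coeff (-2) ≠ 0 := by
  obtain ⟨hD, hD0⟩ := S.order_diffExpansion_D hp h1 h0
  have hg : g ≠ 0 := fun h => h0 (by rw [h, map_zero, HahnSeries.coeff_zero])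
  have h : S.diffExpansion hp (D k (S.K i) g⁻¹) * S.expansion hp (g ^ 2) =
      -S.diffExpansion hp (D k (S.K i) g) := by
    rw [mul_comm, ← diffExpansion_smul, Derivation.leibniz_inv, smul_smul, ← map_neg]
    congr 1
    rw [inv_pow, mul_neg, mul_inv_cancel₀ (pow_ne_zero 2 hg), neg_one_smul]
  have hsq : S.expansion hp (g ^ 2) ∈ vanishing k 2 := by
    rw [map_pow, pow_two]
    exact mul_mem_vanishing_of_eq h1 h1 (by norm_num)
  have hsq0 : (S.expansion hp (g ^ 2)).coeff 2 ≠ 0 := by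
    have := coeff_mul_of_mem h1 h1
    rw [map_pow, pow_two]
    norm_num at this
    rw [this]
    exact mul_ne_zero h0 h0
  have h2 : S.diffExpansion hp (D k (S.K i) g⁻¹) ∈ vanishing k (-2) :=
    mem_vanishing_of_mul_mem hsq hsq0 (h ▸ Submodule.neg_mem _ hD) (by norm_num)
  refine ⟨h2, fun hc => hD0 ?_⟩
  have h3 := coeff_mul_of_mem h2 hsq
  rw [h, hc, zero_mul, HahnSeries.coeff_neg] at h3
  exact neg_eq_zero.mp h3

theorem twistedDiff_eq_span_localParam_zpow {n : ℕ} {d : ℤ} {η : Ω[S.K i⁄k]}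
    (hη : S.diffExpansion hp η ∈ vanishing k d) (hne : (S.diffExpansion hp η).coeff d ≠ 0) :
    S.twistedDiff i p n = Submodule.span (S.O i p) {S.localParam i p ^ (-(n + d)) • η} := by
  apply S.twistedDiff_eq_span hp
  · rw [diffExpansion_smul, expansion_localParam_zpow]
    exact mul_mem_vanishing_of_eq (single_mem_vanishing le_rfl 1) hη (by ring)
  · rw [diffExpansion_smul, expansion_localParam_zpow, coeff_single_mul', one_mul]
    convert hne using 2
    ring

end CurveWithNormalisation

end

/-! ### The coordinate on a projective line and the degree -/

section

open LaurentSeries BranchExpansion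
open KaehlerDifferential (D)
open scoped IntermediateField

namespace CurveWithNormalisation

variable {k : Type u} [Field k] {r : ℕ} (S : CurveWithNormalisation k r) [IsAlgClosed k]

theorem exists_sub_mem_vanishing_one {i : Fin r} {p : S.C i} (hp : IsClosed ({p} : Set (S.C i)))
    {x : S.K i} (hx : S.expansion hp x ∈ vanishing k 0) :
    ∃ a, S.expansion hp (x - algebraMap k (S.K i) a) ∈ vanishing k 1 := by
  refine ⟨(S.expansion hp x).coeff 0, ?_⟩
  have h1 : (1 : ℤ) = 0 + 1 := by norm_num
  rw [map_sub, AlgHom.commutes, h1, mem_vanishing_add_one]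
  refine ⟨Submodule.sub_mem _ hx (algebraMap_mem_vanishing _), ?_⟩
  rw [HahnSeries.coeff_sub, algebraMap_eq_single, HahnSeries.coeff_single_same, sub_self]

theorem expansion_inv_mem_vanishing_one {i : Fin r} {p : S.C i}
    (hp : IsClosed ({p} : Set (S.C i))) {x : S.K i} (hx : S.expansion hp x ∉ vanishing k 0) :
    S.expansion hp x⁻¹ ∈ vanishing k 1 := by
  have hx0 : x ≠ 0 := by
    rintro rfl
    rw [map_zero] at hx
    exact hx (Submodule.zero_mem _)
  have h := S.order_expansion_mul hp hx0 (inv_ne_zero hx0)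
  rw [mul_inv_cancel₀ hx0, map_one, HahnSeries.order_one] at h
  rw [mem_vanishing_iff_order (S.expansion_ne_zero hp hx0)] at hx
  rw [mem_vanishing_iff_order (S.expansion_ne_zero hp (inv_ne_zero hx0))]
  omega

theorem adjoin_inv_eq_top {k K : Type*} [Field k] [Field K] [Algebra k K] {x : K}
    (h : k⟮x⟯ = ⊤) : k⟮x⁻¹⟯ = ⊤ := by
  rw [eq_top_iff, ← h, IntermediateField.adjoin_simple_le_iff]
  simpa using inv_mem (IntermediateField.mem_adjoin_simple_self k x⁻¹)

/-- A projective line has a coordinate with a pole at exactly one point. -/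
theorem exists_coordinate {i : Fin r} (h : S.IsProjectiveLine i) :
    ∃ x : S.K i, k⟮x⟯ = ⊤ ∧ ∃ p₀ : S.C i, IsClosed ({p₀} : Set (S.C i)) ∧
      ∀ {p : S.C i} (hp : IsClosed ({p} : Set (S.C i))),
      (S.expansion hp x ∉ vanishing k 0 ↔ p = p₀) := by
  classical
  obtain ⟨hprop, ⟨e⟩⟩ := h
  let x : S.K i := e.symm RatFunc.X
  have hgen : k⟮x⟯ = ⊤ := by
    have := congrArg (IntermediateField.map (e.symm : RatFunc k →ₐ[k] S.K i))
      (RatFunc.adjoin_X (K := k))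
    rw [IntermediateField.adjoin_map, Set.image_singleton] at this
    refine this.trans ?_
    rw [← AlgHom.fieldRange_eq_map]
    exact AlgEquiv.fieldRange_eq_top e.symm
  -- The valuation ring at infinity: by properness it contains the local ring of some `p₀`, and
  -- since it omits `x`, that point is a pole of `x`. Any other pole would be another zero of the
  -- generator `x⁻¹`.
  let V : ValuationSubring (S.K i) :=
    (RatFunc.inftyValuation k).valuationSubring.comap (e : S.K i →+* RatFunc k)
  have hVc : ∀ c, constToStalk (S.ν i ≫ S.str) (genericPoint (S.C i)) c ∈ V := fun c => by
    change RatFunc.inftyValuation k (e (algebraMap k (S.K i) c)) ≤ 1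
    rw [AlgEquiv.commutes, RatFunc.algebraMap_eq_C]
    by_cases h0 : c = 0
    · rw [h0, map_zero, map_zero]; exact zero_le_one
    · rw [RatFunc.inftyValuation.C k h0]
  have hVx : x ∉ V := by
    change ¬ RatFunc.inftyValuation k (e (e.symm RatFunc.X)) ≤ 1
    rw [AlgEquiv.apply_symm_apply, RatFunc.inftyValuation.X]
    exact not_le.mpr (by rw [← WithZero.exp_zero]; exact WithZero.exp_lt_exp.mpr one_pos)
  obtain ⟨p₀, hp₀⟩ := exists_stalk_le (S.ν i ≫ S.str) V hVc
  have hx₀ : ∀ a, algebraMap (S.O i p₀) (S.K i) a ≠ x := fun a ha => hVx (ha ▸ hp₀ a)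
  have : CompactSpace (S.C i) := QuasiCompact.compactSpace_of_compactSpace (S.ν i ≫ S.str)
  have hcl : IsClosed ({p₀} : Set (S.C i)) :=
    isClosed_of_not_surjective (S.isDVR i) fun hs => (hs x).elim hx₀
  have hx₀' : S.expansion hcl x ∉ vanishing k 0 := fun h =>
    ((S.exists_algebraMap_eq_iff hcl x).mpr h).elim hx₀
  refine ⟨x, hgen, p₀, hcl, fun {p} hp => ⟨fun h => ?_, fun h => by subst h; exact hx₀'⟩⟩
  have key : ∀ {p : S.C i} (hp : IsClosed ({p} : Set (S.C i))), S.expansion hp x ∉ vanishing k 0 →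
      S.expansion hp (x⁻¹ - algebraMap k (S.K i) 0) ∈ vanishing k 1 := fun hp h => by
    rw [map_zero, sub_zero]
    exact S.expansion_inv_mem_vanishing_one hp h
  exact S.eq_of_expansion_sub_mem hp (key hp h) (adjoin_inv_eq_top hgen) hcl (key hcl hx₀')

theorem coeff_order_generator {i : Fin r} {p : S.C i} (hp : IsClosed ({p} : Set (S.C i)))
    {y : S.K i} {a : k} (hgen : k⟮y⟯ = ⊤)
    (hy : S.expansion hp (y - algebraMap k (S.K i) a) ∈ vanishing k 1) :
    (S.expansion hp (y - algebraMap k (S.K i) a)).coeff 1 ≠ 0 := by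
  rw [← S.order_expansion_generator hp hy hgen]
  exact mt HahnSeries.coeff_order_eq_zero.mp
    (S.expansion_ne_zero hp (S.sub_algebraMap_ne_zero_of_adjoin_eq_top hp hgen a))

/-- The section `dx` has order `-2` at the pole of the coordinate `x` and order `0` elsewhere as a
differential. Viewed in the twisted sheaf, it gains `c b` at the only branch on the component. The
two points may coincide, hence the sum of two separate indicator terms in the order function. -/
theorem rationalMultidegree {c : S.Branch → ℕ} (h : S.PullbackDualisingEq (S.branchDivisor c)) :
    S.RationalMultidegree fun b => (c b : ℤ) - 2 := by
  classical
  intro b hline hb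
  obtain ⟨x, hgen, p₀, hp₀cl, hp₀⟩ := S.exists_coordinate hline
  have hinv := adjoin_inv_eq_top hgen
  have hord : ∀ {p : S.C b.1.1} (hp : IsClosed ({p} : Set (S.C b.1.1))),
      S.diffExpansion hp (D k (S.K b.1.1) x) ∈ vanishing k (if p = p₀ then -2 else 0) ∧
        (S.diffExpansion hp (D k (S.K b.1.1) x)).coeff (if p = p₀ then -2 else 0) ≠ 0 := by
    intro p hp
    split_ifs with hpp
    · have h1 : S.expansion hp (x⁻¹ - algebraMap k (S.K b.1.1) 0) ∈ vanishing k 1 := by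
        rw [map_zero, sub_zero]
        exact S.expansion_inv_mem_vanishing_one hp ((hp₀ hp).mpr hpp)
      have h2 := S.coeff_order_generator hp hinv h1
      rw [map_zero, sub_zero] at h1 h2
      have := S.order_diffExpansion_D_inv hp h1 h2
      rwa [inv_inv] at this
    · obtain ⟨a, ha⟩ := S.exists_sub_mem_vanishing_one hp (not_not.mp ((hp₀ hp).not.mpr hpp))
      have := S.order_diffExpansion_D hp ha (S.coeff_order_generator hp hgen ha)
      rwa [map_sub, Derivation.map_algebraMap, sub_zero] at this
  have hdiv : ∀ p : S.C b.1.1, S.branchDivisor c ⟨b.1.1, p⟩ = if p = b.1.2 then c b else 0 := by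
    intro p
    rw [branchDivisor]
    by_cases hq : S.ν b.1.1 p = S.q
    · have h1 := hb ⟨⟨b.1.1, p⟩, hq⟩ rfl
      have h2 : p = b.1.2 := by
        have := congrArg Subtype.val h1
        exact eq_of_heq (Sigma.mk.inj_iff.mp this).2
      rw [dif_pos hq, if_pos h2, h1]
    · rw [dif_neg hq, if_neg fun h => hq (by rw [h]; exact b.2)]
  refine ⟨D k (S.K b.1.1) x, fun h0 => ?_,
    fun p => (if p = ⟨b.1.2, S.isClosed_branch b⟩ then (c b : ℤ) else 0) +
      (if p = ⟨p₀, hp₀cl⟩ then -2 else 0), ?_, fun p => ?_, ?_⟩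
  · have := (hord hp₀cl).2
    rw [h0, map_zero, HahnSeries.coeff_zero] at this
    exact this rfl
  · refine (Set.toFinite {⟨b.1.2, S.isClosed_branch b⟩, ⟨p₀, hp₀cl⟩}).subset fun p hp => ?_
    by_contra hn
    rw [Set.mem_insert_iff, Set.mem_singleton_iff, not_or] at hn
    rw [Function.mem_support, if_neg hn.1, if_neg hn.2] at hp
    exact hp (add_zero 0)
  · rw [h.2 _ _ p.2, S.twistedDiff_eq_span_localParam_zpow p.2 (hord p.2).1 (hord p.2).2, hdiv]
    simp only [Subtype.ext_iff, Nat.cast_ite, Nat.cast_zero]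
  · rw [finsum_add_distrib, finsum_eq_single _ ⟨b.1.2, S.isClosed_branch b⟩,
      finsum_eq_single _ ⟨p₀, hp₀cl⟩, if_pos rfl, if_pos rfl]
    · exact (sub_eq_add_neg _ _).symm
    · intro p hp
      rw [if_neg hp]
    · intro p hp
      rw [if_neg hp]
    · refine (Set.finite_singleton ⟨b.1.2, S.isClosed_branch b⟩).subset fun p hp => ?_
      by_contra hn
      exact hp (if_neg hn)
    · refine (Set.finite_singleton ⟨p₀, hp₀cl⟩).subset fun p hp => ?_
      by_contra hn
      exact hp (if_neg hn)

end CurveWithNormalisation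

end

/-! ### Conclusion: the two types -/

theorem lemma4p1 {k : Type u} [Field k] [IsAlgClosed k]
    (h2 : (2 : k) ≠ 0) (h3 : (3 : k) ≠ 0) (h5 : (5 : k) ≠ 0)
    {r : ℕ} (S : CurveWithNormalisation k r)
    (hGor : S.IsGorenstein) (hgenus : S.genus = 2) :
    (S.IsTypeI →
      ∃ b₀ : S.Branch, (∀ b, S.IsSingularBranch b ↔ b = b₀) ∧
        S.PullbackDualisingEq (S.branchDivisor (S.branchValues {b₀} 4 2)) ∧
        S.RationalMultidegree (S.branchValues {b₀} 2 0)) ∧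
    (S.IsTypeII →
      ∃ b₁ b₂ : S.Branch, b₁ ≠ b₂ ∧
        (∀ a b, a ≠ b → (S.AreTangent a b ↔ (a = b₁ ∧ b = b₂) ∨ (a = b₂ ∧ b = b₁))) ∧
        S.PullbackDualisingEq (S.branchDivisor (S.branchValues {b₁, b₂} 3 2)) ∧
        S.RationalMultidegree (S.branchValues {b₁, b₂} 1 0)) := by
  classical
  have hδ := S.delta_eq_card_add_one hgenus
  -- Genus two means `δ = m + 1`, which is nonzero; this makes `R̃ / R` finite dimensional.
  have hδ0 : S.delta ≠ 0 := by omega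
  have hGor' := hGor
  rw [CurveWithNormalisation.IsGorenstein, S.conductor_eq] at hGor'
  rw [S.delta_eq] at hδ hGor'
  constructor
  · rintro ⟨h1, h2, h3⟩
    rw [S.gradedDim_eq] at h1 h2 h3
    obtain ⟨b₀, hb₀, hcond⟩ := BranchExpansion.exists_singular_branch S.isDense_branchExpansion
      S.isLocalAt_localRing hδ hGor' h1 h2 h3
    have hval : (fun b => if b = b₀ then 4 else 2) = S.branchValues {b₀} 4 2 := by
      funext b
      simp [CurveWithNormalisation.branchValues]
    have hD := S.pullbackDualisingEq hGor hδ0 (fun b => by split_ifs <;> norm_num) hcond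
    rw [hval] at hD
    refine ⟨b₀, fun b => ?_, hD, ?_⟩
    · rw [S.isSingularBranch_iff, hb₀, not_not]
    · convert S.rationalMultidegree hD using 2 with b
      simp only [CurveWithNormalisation.branchValues]
      split_ifs <;> norm_num
  · rintro ⟨h1, h2, -⟩
    rw [S.gradedDim_eq] at h1 h2
    obtain ⟨b₁, b₂, hne, hns, htan, hcond⟩ := BranchExpansion.exists_tangent_branches S.isDense_branchExpansion
      S.isLocalAt_localRing hδ hGor' h1 h2
    have hval : (fun b => if b = b₁ ∨ b = b₂ then 3 else 2) = S.branchValues {b₁, b₂} 3 2 := by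
      funext b
      simp [CurveWithNormalisation.branchValues]
    have hD := S.pullbackDualisingEq hGor hδ0 (fun b => by split_ifs <;> norm_num) hcond
    rw [hval] at hD
    refine ⟨b₁, b₂, hne, fun a b hab => ?_, hD, ?_⟩
    · rw [S.areTangent_iff hns, htan a b hab]
    · convert S.rationalMultidegree hD using 2 with b
      simp only [CurveWithNormalisation.branchValues]
      split_ifs <;> norm_num
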